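/- **Setting.** Let $G$ be a finite connected graph with vertex set $\Lambda$, graph distance $\mathsf d$ and balls $B_r(x)=\{y:\mathsf d(x,y)\le r\}$. Assume that $G$ is $d$-dimensional with constant $M$: $|B_r(x)|\le M r^d$ for all $x\in\Lambda$ and $r\ge 1$. Put $\operatorname{diam}(S)=\max_{x,y\in S}\mathsf d(x,y)$ and $\mathsf d(S,T)=\min_{x\in S,y\in T}\mathsf d(x,y)$ (and $\mathsf d(S,T)=0$ if $S$ or $T$ is empty). The boundary $\partial S$ is the set of vertices of $S$ that have a neighbour outside $S$. A qubit sits at each vertex. Operators act on $(\mathbb C^2)^{\otimes\Lambda}$, $\|\cdot\|$ is the operator norm, and an operator is supported on $S$ if it has the form $O_S\otimes 1_{\Lambda\setminus S}$. **Hamiltonian.** $H=H_0+V_\varepsilon$ with $\varepsilon\ge 0$, where - $H_0=\sum_{I:\operatorname{diam}(I)\le k}h_I Z_I$ with real $h_I$ and $Z_I=\prod_{v\in I}Z_v$ a product of Pauli-$Z$ operators; - $V_\varepsilon=\sum_{r\ge1}\varepsilon^r V_r$ is self-adjoint, and $V_r=\sum_S V_{r,S}$ with $V_{r,S}$ supported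 on $S$, the sum running over nonempty $S$ with $\operatorname{diam}(S)\le r$, and $\sum_{r\ge1}\max_{v}\sum_{S\ni v}\|V_{r,S}\|\le h$. Here $h>0$. Write $A(t)=e^{\mathrm iHt}Ae^{-\mathrm iHt}$. **Non-resonance.** Let $\Delta>0$ and $r_*\in\mathbb N=\{0,1,2,\dots\}$. The ball $B_{r_*}(x)$ is *non-resonant* if for every $S\subseteq B_{r_*}(x)$ any two of the $2^{|S|}$ energy levels of $H_0|_S=\sum_{I\subseteq S}h_IZ_I$ on the qubits of $S$ (one level for each spin configuration on $S$) differ by at least $h\Delta$. **Paths.** Fix a total order on $\Lambda$, a vertex $x$ and $n_*\in\mathbb N$. The set $\Gamma^{(n_*)}(x)$ consists of the sequences $(\Gamma_1,\dots,\Gamma_l)$, $1\le l\le n_*+1$, of subsets of $\Lambda$ for which the following holds with interiors $S^{(i)}$ defined along the way. Put $S^{(-1)}=\emptyset$ and $S^{(0)}=\{x\}$. For each $i$, $$\Gamma_i\cap S^{(i-2)}=\emptyset,\qquad \Gamma_i\cap S^{(i-1)}\ne\emptyset,\qquad \Gamma_i\setminus S^{(i-1)}\neq\emptyset .$$ The set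 $\Gamma_i$ is *small* if there is $y\in\partial(\Lambda\setminus S^{(i-1)})$ with $\Gamma_i\setminus S^{(i-1)}\subseteq B_{r_*}(y)$. In this case $x_i$ denotes the least such $y$, and $S^{(i)}=S^{(i-1)}\cup B_{r_*}(x_i)$. Otherwise $\Gamma_i$ is *big* and $S^{(i)}=S^{(i-1)}\cup\Gamma_i$. The path stops at the first $i$ at which $\Gamma_i$ contains a point at distance at least $n_*(r_*+1)$ from $x$, and at $i=n_*+1$ if this has not happened before. **Partial non-resonance.** $H_0$ satisfies the $(h,r_*,\Delta,n_*,\zeta)$ partial non-resonance condition at $x$ if $|h_I|\le h$ for all $I$, and on every path in $\Gamma^{(n_*)}(x)$ there are at most $(1-\zeta)n_*$ indices $i$ such that $\Gamma_i$ is small and $B_{r_*}(x_i)$ is not non-resonant. **Theorem.** Let $d,k\in\mathbb N$, $M\in\mathbb R$, $0<\zeta\le1$ and $0<\alpha<\frac1{5k+1}$. There are constants $C,C'>0$, depending only on $d,M,k,\zeta,\alpha$, such that the following holds for all $G$, $H=H_0+V_\varepsilon$, $h$, $\Delta$, $r_*$ and total orders as above and all $S_0,S_1\subseteq\Lambda$.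 Put $$n_*=\Big\lfloor\frac{\mathsf d(S_0,S_1)-1}{r_*+1}\Big\rfloor,\quad r=\min(r_*+1,\mathsf d(S_0,S_1)),\quad V_*=\max_{x}|B_{r_*}(x)|,\quad \tilde\varepsilon=32\pi^2\Big(\frac{V_*}{\Delta}\Big)^2\varepsilon .$$ Suppose that $r>8k/\zeta$, that $\tilde\varepsilon<e^{-1}$, and that $H_0$ satisfies the $(h,r_*,\Delta,n_*,\zeta)$ partial non-resonance condition at every $x\in\partial S_0$ if $|\partial S_0|\le|\partial S_1|$, and at every $y\in\partial S_1$ otherwise. Then for all operators $A$ supported on $S_1$ and $B$ supported on $S_0$ and all $t\ge0$, $$\|[B,A(t)]\|\le C\,\min(|\partial S_0|,|\partial S_1|)\,\|A\|\,\|B\|\Big[\exp\!\big(C'h\,(e\tilde\varepsilon)^{\alpha(\zeta r/8-k)}\,t\big)-1\Big]\exp\!\Big(-\frac{\alpha\zeta}{8}\,\mathsf d(S_0,S_1)\Big).$$ -/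

import Mathlib

open scoped Matrix.Norms.L2Operator

namespace SlowLR

/-! ### Finite graphs -/

section Graph

variable {Λ : Type*} [Fintype Λ] [LinearOrder Λ] (G : SimpleGraph Λ)

open scoped Classical in
/-- The closed ball `B_r(x)` for the graph distance. -/
noncomputable def ball (x : Λ) (r : ℕ) : Finset Λ :=
  Finset.univ.filter fun y => G.dist x y ≤ r

/-- The graph has spatial dimension `d` with constant `M`: `|B_r(x)| ≤ M r ^ d` for all `r ≥ 1`. -/
def HasDimension (d : ℕ) (M : ℝ) : Prop :=
  ∀ (x : Λ) (r : ℕ), 1 ≤ r → ((ball G x r).card : ℝ) ≤ M * (r : ℝ) ^ d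

/-- The diameter of a set of vertices, in the graph distance of the whole graph. -/
noncomputable def graphDiam (S : Finset Λ) : ℕ :=
  S.sup fun x => S.sup fun y => G.dist x y

/-- The distance `d(S, T) = min {d(x, y) : x ∈ S, y ∈ T}` (equal to `0` if `S` or `T` is empty). -/
noncomputable def setDist (S T : Finset Λ) : ℕ :=
  sInf {n : ℕ | ∃ x ∈ S, ∃ y ∈ T, n = G.dist x y}

open scoped Classical in
/-- The boundary `∂S`: the vertices of `S` that have a neighbour outside `S`. -/
noncomputable def boundary (S : Finset Λ) : Finset Λ :=
  S.filter fun x => ∃ y, y ∉ S ∧ G.Adj x y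

/-- `V_* = max_x |B_r(x)|`. -/
noncomputable def maxBallCard (r : ℕ) : ℕ :=
  Finset.univ.sup fun x => (ball G x r).card

end Graph

/-! ### Operators on the qubits at the vertices -/

section Operators

/-- Operators on `(ℂ²)^{⊗ Λ}`, as matrices in the computational basis `Λ → Bool`.
The norm on them is the operator norm of `ℓ²`. -/
abbrev Op (Λ : Type*) := Matrix (Λ → Bool) (Λ → Bool) ℂ

variable {Λ : Type*} [Fintype Λ] [LinearOrder Λ]

open scoped Classical in
/-- `O` is supported in `S`: it is of the form `O_S ⊗ 1`, with `O_S` acting on the qubits of `S`. -/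
def SupportedIn (S : Finset Λ) (O : Op Λ) : Prop :=
  ∃ OS : Matrix (S → Bool) (S → Bool) ℂ, ∀ σ τ : Λ → Bool,
    O σ τ = if ∀ v, v ∉ S → σ v = τ v then OS (fun v => σ v) (fun v => τ v) else 0

/-- The eigenvalue of the Pauli matrix `Z` on a basis state of one qubit. -/
def spin (b : Bool) : ℝ := if b then -1 else 1

/-- `Z_I`, the product of the Pauli matrices `Z_v` over `v ∈ I`. -/
noncomputable def pauliZ (I : Finset Λ) : Op Λ :=
  Matrix.diagonal fun σ => ((∏ v ∈ I, spin (σ v) : ℝ) : ℂ)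

/-- The classical Hamiltonian `H_0 = ∑_I J_I Z_I`. -/
noncomputable def classicalHamiltonian (J : Finset Λ → ℝ) : Op Λ :=
  ∑ I : Finset Λ, (J I : ℂ) • pauliZ I

/-- The Heisenberg evolution `A(t) = e^{iHt} A e^{-iHt}`. -/
noncomputable def heisenberg (H : Op Λ) (t : ℝ) (A : Op Λ) : Op Λ :=
  NormedSpace.exp ((Complex.I * (t : ℂ)) • H) * A * NormedSpace.exp (-((Complex.I * (t : ℂ)) • H))

/-- The perturbation `V_ε = ∑_{r ≥ 1} ε ^ r V_r`, where `V_r = ∑_S V_{r,S}`. -/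
noncomputable def perturbation (ε : ℝ) (V : ℕ → Finset Λ → Op Λ) : Op Λ :=
  ∑' r : ℕ, ((ε ^ (r + 1) : ℝ) : ℂ) • ∑ S : Finset Λ, V (r + 1) S

/-- The local strength `max_v ∑_{S ∋ v} ‖Φ_S‖` of a decomposition `∑_S Φ_S`
(the `κ`-norm of the decomposition at `κ = 0`). -/
noncomputable def localStrength (Φ : Finset Λ → Op Λ) : ℝ :=
  ⨆ v : Λ, ∑ S ∈ Finset.univ.filter (fun S : Finset Λ => v ∈ S), ‖Φ S‖

/-- The operators `V_r = ∑_S V_{r,S}` (`r ≥ 1`) have range at most `r` and total strength at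
most `h`: the term `V_{r,S}` is supported in `S`, only nonempty sets `S` of diameter at most `r`
occur, and `∑_{r ≥ 1} max_v ∑_{S ∋ v} ‖V_{r,S}‖ ≤ h`. -/
structure IsLocalPerturbation (G : SimpleGraph Λ) (h : ℝ) (V : ℕ → Finset Λ → Op Λ) : Prop where
  supported : ∀ r S, SupportedIn S (V r S)
  range_le : ∀ r S, V r S ≠ 0 → S.Nonempty ∧ graphDiam G S ≤ r
  strength_le : ∀ N : ℕ, ∑ r ∈ Finset.Icc 1 N, localStrength (V r) ≤ h

end Operators

/-! ### Non-resonance -/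

section NonResonance

variable {Λ : Type*} [Fintype Λ] [LinearOrder Λ] (G : SimpleGraph Λ)

/-- The energy of the spin configuration `σ` for `H_0|_S = ∑_{I ⊆ S} J_I Z_I`; it only depends on
the values of `σ` on `S`. -/
noncomputable def energy (J : Finset Λ → ℝ) (S : Finset Λ) (σ : Λ → Bool) : ℝ :=
  ∑ I ∈ S.powerset, J I * ∏ v ∈ I, spin (σ v)

/-- Any two of the `2^{|S|}` energy levels of `H_0|_S` (on the qubits of `S`) are at least `g`
apart: the minimal gap of `H_0|_S` is at least `g`, and `H_0|_S` is non-degenerate. -/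
def HasGap (J : Finset Λ → ℝ) (S : Finset Λ) (g : ℝ) : Prop :=
  ∀ σ τ : Λ → Bool, (∃ v ∈ S, σ v ≠ τ v) → g ≤ |energy J S σ - energy J S τ|

/-- The non-resonance condition with gap `h Δ` in the ball `B_{r_*}(x)`: it concerns every subset
of the ball. -/
def NonResonantBall (J : Finset Λ → ℝ) (h Δ : ℝ) (rs : ℕ) (x : Λ) : Prop :=
  ∀ S ⊆ ball G x rs, HasGap J S (h * Δ)

open scoped Classical in
/-- The boundary points `x` of the complement of `T` such that the part of `Γ` outside `T` lies
in `B_{r_*}(x)`. The set `Γ` is small (relative to `T`) if there is such a point, and big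
otherwise. -/
noncomputable def centers (rs : ℕ) (T Γ : Finset Λ) : Finset Λ :=
  (boundary G Tᶜ).filter fun x => Γ \ T ⊆ ball G x rs

open scoped Classical in
/-- One step of the growth of the interior: add the ball around the least center if `Γ` is small,
and `Γ` itself if `Γ` is big. -/
noncomputable def grow (rs : ℕ) (T Γ : Finset Λ) : Finset Λ :=
  if hc : (centers G rs T Γ).Nonempty then T ∪ ball G ((centers G rs T Γ).min' hc) rs else T ∪ Γ

/-- The interiors of a path `Γ_1, Γ_2, …` that starts at `S₀`. The sequence is indexed from `0`:
`Γ j` is `Γ_{j+1}`, and `pathInterior G rs S₀ Γ j` is the interior after `j` steps. -/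
noncomputable def pathInterior (rs : ℕ) (S₀ : Finset Λ) (Γ : ℕ → Finset Λ) : ℕ → Finset Λ
  | 0 => S₀
  | j + 1 => grow G rs (pathInterior rs S₀ Γ j) (Γ j)

/-- Seen from every point of `S₀`, the set `Γ` reaches the distance `n_* (r_* + 1)`. -/
def IsFar (rs ns : ℕ) (S₀ Γ : Finset Λ) : Prop :=
  ∀ y ∈ S₀, ∃ x ∈ Γ, ns * (rs + 1) ≤ G.dist x y

/-- `(Γ_1, …, Γ_l)` is a path of `Γ^{(n_*)}(S₀)`. Each set meets the current interior and its
complement, and avoids the previous interior; the path stops at the first far set, and at the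
latest after `n_* + 1` steps. -/
structure IsPath (rs ns : ℕ) (S₀ : Finset Λ) (Γ : ℕ → Finset Λ) (l : ℕ) : Prop where
  one_le : 1 ≤ l
  le_succ : l ≤ ns + 1
  avoids : ∀ j, j + 1 < l → Disjoint (Γ (j + 1)) (pathInterior G rs S₀ Γ j)
  meets_interior : ∀ j < l, (Γ j ∩ pathInterior G rs S₀ Γ j).Nonempty
  meets_exterior : ∀ j < l, (Γ j \ pathInterior G rs S₀ Γ j).Nonempty
  not_far : ∀ j, j + 1 < l → ¬ IsFar G rs ns S₀ (Γ j)
  stops : ∀ j, j + 1 = l → j = ns ∨ IsFar G rs ns S₀ (Γ j)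

open scoped Classical in
/-- The steps `j < l` of a path at which `Γ j` is small and the non-resonance condition fails in
the ball that is added to the interior. -/
noncomputable def resonantSteps (J : Finset Λ → ℝ) (h Δ : ℝ) (rs : ℕ) (S₀ : Finset Λ)
    (Γ : ℕ → Finset Λ) (l : ℕ) : Finset ℕ :=
  (Finset.range l).filter fun j =>
    ∃ hc : (centers G rs (pathInterior G rs S₀ Γ j) (Γ j)).Nonempty,
      ¬ NonResonantBall G J h Δ rs ((centers G rs (pathInterior G rs S₀ Γ j) (Γ j)).min' hc)

/-- The `(h, r_*, Δ, n_*, ζ)` partial non-resonance condition at the vertex `x`. -/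
structure PartiallyNonResonantAt (J : Finset Λ → ℝ) (h : ℝ) (rs : ℕ) (Δ : ℝ) (ns : ℕ) (ζ : ℝ)
    (x : Λ) : Prop where
  strength_le : ∀ I, |J I| ≤ h
  resonant_le : ∀ (Γ : ℕ → Finset Λ) (l : ℕ), IsPath G rs ns {x} Γ l →
    ((resonantSteps G J h Δ rs {x} Γ l).card : ℝ) ≤ (1 - ζ) * ns

/-- `ε̃ = 32 π² (V_* / Δ)² ε`. -/
noncomputable def epsTilde (rs : ℕ) (Δ ε : ℝ) : ℝ :=
  32 * Real.pi ^ 2 * ((maxBallCard G rs : ℝ) / Δ) ^ 2 * ε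

end NonResonance

end SlowLR

open SlowLR

/-! Let `R` be a region disjoint from `S₁`. If the terms of `H` that cross the boundary of `R` are
removed, the evolved `A` commutes with all operators in `R`. By Duhamel's formula, the commutator of
an operator touching `R` with `A(t)` is therefore controlled by the commutators of the crossing
terms ("hops") with `A` evolved outside `R`. Iterating this from a vertex `x ∈ ∂S₀` makes regions
grow step by step towards `S₁`: these are the paths of the non-resonance condition. Every Duhamel
integral, measured against `e^{lu}`, costs a factor `h * volume / l`. The aim is to afford these
factors for a very small rate `l = C' h δ`, `δ = (eθ)^{α(ζr/8-k)}`, where `θ` is slightly larger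
than `ε̃`.

The gain comes from the non-resonant regions. There `H_0|_R` has level spacing at least `hΔ`, and an
iterative rotation (`exists_rotation`) makes the Hamiltonian of `R` diagonal up to high order. The
off-diagonal part is removed by dividing its entries by energy differences. Although there are
`2^|R|` levels, this costs only `2|R|/g` (`norm_invAd_le`): in the order of the energies, the `n`-th
off-diagonal is divided by at least `g n`, and the harmonic sum up to `2^|R|` is at most `|R|`. A
generator of order `m` has range at most `(2k+1)m`, so locality survives (`Dec` records orders and
sizes together).

Diagonal operators commute with each other, so a diagonal local Hamiltonian transports nothing
across `R`. This is `exists_decoupling`: `H = K + E`, where the main part of the observable commutes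
with `A` evolved under `K`, and the errors have size `θ^γ` with `γ = μ(r/4-k) - p/2` for an incoming
hop of order `p`. A hop of order `p` is itself of size `ε^p`, so that a high order pays for itself;
only resonant steps gain nothing.

The induction is backwards along the paths. `DecaySetup.Bound` states what the hops leaving the
current interior satisfy; `IsState.bound_of_succ` derives it from the same statement one step later.
At the end of a path the asserted bound exceeds the trivial bound, so nothing has to be proved
there. A path with `b` resonant and `e` other steps, covering the length `v` outside the resonant
ones, gathers the factor `θ^{μ(rv/4-ke)}`. Partial non-resonance gives `b ≤ (1-ζ)n`, hence `v ≥ ζn`,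
and `path_total_le` divides the exponent: the part `μ - α` pays for the volume factors, and the part
`α` pays for the powers of `1/δ` (one for each Duhamel integral, at most two per non-resonant step)
and for the decay in the distance.

What remains is a reduction to truncated perturbations with self-adjoint terms, the observation that
the hypotheses force `Δ ≤ 2`, and the symmetry that exchanges `S₀` and `S₁` and replaces `H` by
`-H`. -/

namespace SlowLR

/-! ### Heisenberg dynamics in a C⋆-algebra -/

section Dynamics

variable {𝔄 : Type*} [CStarAlgebra 𝔄]

/-- The one-parameter group `e^{itK}`. -/
noncomputable def evol (K : 𝔄) (t : ℝ) : 𝔄 := NormedSpace.exp ((Complex.I * (t : ℂ)) • K)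

/-- The Heisenberg evolution `e^{itK} A e^{-itK}`. -/
noncomputable def heis (K : 𝔄) (t : ℝ) (A : 𝔄) : 𝔄 := evol K t * A * evol K (-t)

theorem evol_zero (K : 𝔄) : evol K 0 = 1 := by simp [evol]

theorem evol_add_of_commute {K L : 𝔄} (h : Commute K L) (t : ℝ) :
    evol (K + L) t = evol K t * evol L t := by
  let +nondep : NormedAlgebra ℚ 𝔄 := .restrictScalars ℚ ℂ 𝔄
  rw [evol, evol, evol, smul_add]
  exact NormedSpace.exp_add_of_commute ((h.smul_left _).smul_right _)

theorem evol_mul_evol (K : 𝔄) (s t : ℝ) : evol K s * evol K t = evol K (s + t) := by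
  let +nondep : NormedAlgebra ℚ 𝔄 := .restrictScalars ℚ ℂ 𝔄
  rw [evol, evol, evol,
    ← NormedSpace.exp_add_of_commute (((Commute.refl K).smul_left _).smul_right _), ← add_smul]
  congr 2
  push_cast
  ring

theorem evol_mul_evol_neg (K : 𝔄) (t : ℝ) : evol K t * evol K (-t) = 1 := by
  rw [evol_mul_evol, add_neg_cancel, evol_zero]

theorem evol_neg_mul_evol (K : 𝔄) (t : ℝ) : evol K (-t) * evol K t = 1 := by
  rw [evol_mul_evol, neg_add_cancel, evol_zero]

theorem Commute.evol_left {K A : 𝔄} (h : Commute K A) (t : ℝ) : Commute (evol K t) A := by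
  let +nondep : NormedAlgebra ℚ 𝔄 := .restrictScalars ℚ ℂ 𝔄
  exact (h.smul_left _).exp_left

theorem evol_star {K : 𝔄} (hK : IsSelfAdjoint K) (t : ℝ) : star (evol K t) = evol K (-t) := by
  rw [evol, evol, NormedSpace.star_exp, star_smul, hK.star_eq]
  congr 2
  simp

theorem evol_mem_unitary {K : 𝔄} (hK : IsSelfAdjoint K) (t : ℝ) : evol K t ∈ unitary 𝔄 := by
  rw [Unitary.mem_iff, evol_star hK]
  exact ⟨evol_neg_mul_evol K t, evol_mul_evol_neg K t⟩

theorem norm_conj_unitary {U : 𝔄} (hU : U ∈ unitary 𝔄) (A : 𝔄) : ‖star U * A * U‖ = ‖A‖ := by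
  rw [CStarRing.norm_mul_mem_unitary _ hU,
    CStarRing.norm_mem_unitary_mul _ (Unitary.star_mem hU)]

theorem norm_heis {K : 𝔄} (hK : IsSelfAdjoint K) (t : ℝ) (A : 𝔄) : ‖heis K t A‖ = ‖A‖ := by
  rw [heis, CStarRing.norm_mul_mem_unitary _ (evol_mem_unitary hK _),
    CStarRing.norm_mem_unitary_mul _ (evol_mem_unitary hK _)]

theorem norm_lie_le' (A B : 𝔄) : ‖⁅A, B⁆‖ ≤ 2 * ‖A‖ * ‖B‖ := by
  rw [Ring.lie_def]
  calc ‖A * B - B * A‖ ≤ ‖A * B‖ + ‖B * A‖ := norm_sub_le _ _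
    _ ≤ ‖A‖ * ‖B‖ + ‖B‖ * ‖A‖ := add_le_add (norm_mul_le _ _) (norm_mul_le _ _)
    _ = _ := by ring

theorem lie_eq_zero_of_commute {A B : 𝔄} (h : Commute A B) : ⁅A, B⁆ = 0 := by
  rw [Ring.lie_def, h.eq, sub_self]

theorem heis_lie (K : 𝔄) (t : ℝ) (A B : 𝔄) : ⁅heis K t A, heis K t B⁆ = heis K t ⁅A, B⁆ := by
  have e := evol_neg_mul_evol K t
  have aux : ∀ A B : 𝔄, heis K t A * heis K t B = heis K t (A * B) := by
    intro A B
    simp only [heis]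
    calc evol K t * A * evol K (-t) * (evol K t * B * evol K (-t))
        = evol K t * A * (evol K (-t) * evol K t) * B * evol K (-t) := by noncomm_ring
      _ = _ := by rw [e]; noncomm_ring
  rw [Ring.lie_def, Ring.lie_def, aux, aux]
  simp only [heis]
  noncomm_ring

theorem heis_neg_heis (K : 𝔄) (t : ℝ) (A : 𝔄) : heis K (-t) (heis K t A) = A := by
  simp only [heis, neg_neg]
  calc evol K (-t) * (evol K t * A * evol K (-t)) * evol K t
      = (evol K (-t) * evol K t) * A * (evol K (-t) * evol K t) := by noncomm_ring
    _ = A := by rw [evol_neg_mul_evol]; simp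

theorem norm_lie_heis {K : 𝔄} (hK : IsSelfAdjoint K) (t : ℝ) (A B : 𝔄) :
    ‖⁅A, heis K t B⁆‖ = ‖⁅heis K (-t) A, B⁆‖ := by
  rw [← norm_heis hK (-t) ⁅A, heis K t B⁆, ← heis_lie, heis_neg_heis]

theorem heis_of_commute {K A : 𝔄} (h : Commute K A) (t : ℝ) : heis K t A = A := by
  rw [heis, (h.evol_left t).eq, mul_assoc, evol_mul_evol_neg, mul_one]

theorem heis_add_of_commute {K L : 𝔄} (h : Commute K L) (t : ℝ) (A : 𝔄) :
    heis (K + L) t A = heis K t (heis L t A) := by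
  have h1 := evol_add_of_commute h t
  have h2 : evol (K + L) (-t) = evol L (-t) * evol K (-t) := by
    rw [add_comm K L]; exact evol_add_of_commute h.symm (-t)
  simp only [heis, h1, h2]
  noncomm_ring

theorem Commute.heis_right {K A B : 𝔄} (hK : Commute B K) (hA : Commute B A) (t : ℝ) :
    Commute B (heis K t A) :=
  (((hK.symm.evol_left t).symm).mul_right hA).mul_right ((hK.symm.evol_left (-t)).symm)

theorem heis_conj {U : 𝔄} (hU : U ∈ unitary 𝔄) (K : 𝔄) (t : ℝ) (A : 𝔄) :
    star U * heis K t A * U = heis (star U * K * U) t (star U * A * U) := by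
  have h1 : U * star U = 1 := Unitary.mul_star_self_of_mem hU
  have h2 : star U * U = 1 := Unitary.star_mul_self_of_mem hU
  have key : ∀ s, evol (star U * K * U) s = star U * evol K s * U := by
    intro s
    let +nondep : NormedAlgebra ℚ 𝔄 := .restrictScalars ℚ ℂ 𝔄
    have := NormedSpace.exp_units_conj' (⟨U, star U, h1, h2⟩ : 𝔄ˣ) ((Complex.I * (s : ℂ)) • K)
    simp only [Units.inv_mk] at this
    rw [evol, evol, ← this]
    simp
  simp only [heis, key]
  calc star U * (evol K t * A * evol K (-t)) * U
      = star U * evol K t * 1 * A * 1 * evol K (-t) * U := by noncomm_ring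
    _ = star U * evol K t * (U * star U) * A * (U * star U) * evol K (-t) * U := by rw [h1]
    _ = _ := by noncomm_ring

theorem hasDerivAt_evol (K : 𝔄) (t : ℝ) :
    HasDerivAt (evol K) (evol K t * (Complex.I • K)) t := by
  have h := hasDerivAt_exp_smul_const (𝕂 := ℝ) (Complex.I • K) t
  have e : evol K = fun u : ℝ => NormedSpace.exp (u • (Complex.I • K)) := by
    funext u
    rw [evol, ← Complex.coe_smul, smul_smul, mul_comm]
  rw [e]
  exact h

theorem evol_mul_self (K : 𝔄) (t : ℝ) : evol K t * K = K * evol K t :=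
  ((Commute.refl K).evol_left t).eq

/-- Duhamel's formula, as an estimate. -/
theorem norm_heis_add_sub_heis_le {K E : 𝔄} (hK : IsSelfAdjoint K) (hE : IsSelfAdjoint E) (A : 𝔄)
    {κ l s : ℝ} (hl : 0 < l) (hs : 0 ≤ s)
    (h : ∀ u, 0 ≤ u → u ≤ s → ‖⁅E, heis K u A⁆‖ ≤ κ * Real.exp (l * u)) :
    ‖heis (K + E) s A - heis K s A‖ ≤ κ * (Real.exp (l * s) - 1) / l := by
  set H := K + E with hH
  have hHs : IsSelfAdjoint H := hK.add hE
  -- Interaction picture: the derivative of `f` is a unitary conjugate of `-i[E, K-evolution of A]`,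
  -- so its norm is the given commutator bound. Integrating `κ e^{lu}` gives the claim.
  let f : ℝ → 𝔄 := fun u => heis H (-u) (heis K u A) - A
  have hneg : ∀ (L : 𝔄) (u : ℝ),
      HasDerivAt (fun u => evol L (-u)) (-(evol L (-u) * (Complex.I • L))) u := by
    intro L u
    have h1 := (hasDerivAt_evol L (-u)).scomp u (hasDerivAt_neg u)
    simpa [Function.comp_def] using h1
  have hder : ∀ u : ℝ, HasDerivAt f (heis H (-u) (-(Complex.I • ⁅E, heis K u A⁆))) u := by
    intro u
    have h1 := ((((hneg H u).mul (((hasDerivAt_evol K u).mul_const A).mul (hneg K u))).mul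
      (hasDerivAt_evol H u))).sub_const A
    have h2 : f = fun u => evol H (-u) * (evol K u * A * evol K (-u)) * evol H u - A := by
      funext v
      simp [f, heis]
    rw [h2]
    refine h1.congr_deriv ?_
    have e1 : ∀ v, evol H v * H = H * evol H v := evol_mul_self H
    have e2 : ∀ v, evol K v * K = K * evol K v := evol_mul_self K
    have hE' : E = H - K := by rw [hH]; abel
    simp only [Pi.mul_apply, heis, Ring.lie_def, neg_neg, hE', mul_smul_comm, smul_mul_assoc, e1, e2]
    simp only [← e1 (-u)]
    simp only [mul_neg, neg_mul, mul_sub, sub_mul, smul_sub, mul_add, add_mul, smul_mul_assoc,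
      mul_smul_comm, mul_assoc, e2]
    abel
  have hbound := image_norm_le_of_norm_deriv_right_le_deriv_boundary (f := f)
    (f' := fun u => heis H (-u) (-(Complex.I • ⁅E, heis K u A⁆))) (a := 0) (b := s)
    (B := fun u => κ * (Real.exp (l * u) - 1) / l) (B' := fun u => κ * Real.exp (l * u))
    (fun u _ => (hder u).continuousAt.continuousWithinAt)
    (fun u _ => (hder u).hasDerivWithinAt)
    (by simp [f, heis, evol_zero])
    (fun u => by
      have h1 : HasDerivAt (fun u : ℝ => Real.exp (l * u)) (Real.exp (l * u) * (l * 1)) u :=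
        ((hasDerivAt_id u).const_mul l).exp
      have h2 := ((h1.sub_const 1).const_mul κ).div_const l
      refine h2.congr_deriv ?_
      field_simp)
    (fun u hu => by
      rw [norm_heis hHs, norm_neg, norm_smul, Complex.norm_I, one_mul]
      exact h u hu.1 hu.2.le)
    (Set.right_mem_Icc.2 hs)
  have h3 : heis K s A - heis H s A = heis H s (f s) := by
    have : heis H s (heis H (-s) (heis K s A)) = heis K s A := by
      simpa using heis_neg_heis H (-s) (heis K s A)
    have hsub : ∀ X Y : 𝔄, heis H s (X - Y) = heis H s X - heis H s Y := by
      intro X Y; simp only [heis]; noncomm_ring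
    rw [hsub, this]
  rw [norm_sub_rev, h3, norm_heis hHs]
  exact hbound

theorem exp_sub_one_div_le {l s : ℝ} (hl : 0 < l) :
    (Real.exp (l * s) - 1) / l ≤ Real.exp (l * s) / l := by
  gcongr
  linarith

end Dynamics

/-! ### Weighted decompositions along a filtration -/

section Decomposition

variable {𝔄 : Type*} [CStarAlgebra 𝔄]

/-- `A` is a sum of elements `a i ∈ F (m i)` with `∑ y ^ (m i) ‖a i‖ ≤ N`. -/
def Dec (F : ℕ → Submodule ℂ 𝔄) (y : ℝ) (A : 𝔄) (N : ℝ) : Prop :=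
  ∃ (ι : Type) (m : ι → ℕ) (a : ι → 𝔄), (∀ i, a i ∈ F (m i)) ∧
    Summable (fun i => y ^ m i * ‖a i‖) ∧ ∑' i, y ^ m i * ‖a i‖ ≤ N ∧ HasSum a A

namespace Dec

variable {F F' S : ℕ → Submodule ℂ 𝔄} {y : ℝ} {A B X : 𝔄} {N N' s : ℝ}

theorem mono (h : Dec F y A N) (hN : N ≤ N') : Dec F y A N' := by
  obtain ⟨ι, m, a, h1, h2, h3, h4⟩ := h
  exact ⟨ι, m, a, h1, h2, h3.trans hN, h4⟩

theorem mono_left (h : Dec F y A N) (hF : ∀ m, F m ≤ F' m) : Dec F' y A N := by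
  obtain ⟨ι, m, a, h1, h2, h3, h4⟩ := h
  exact ⟨ι, m, a, fun i => hF _ (h1 i), h2, h3, h4⟩

theorem of_mem {m : ℕ} (h : A ∈ F m) : Dec F y A (y ^ m * ‖A‖) := by
  refine ⟨Unit, fun _ => m, fun _ => A, fun _ => h, ?_, ?_, ?_⟩
  · exact Summable.of_finite
  · simp
  · simp

theorem nonneg (hy : 1 ≤ y) (h : Dec F y A N) : 0 ≤ N := by
  obtain ⟨ι, m, a, h1, h2, h3, h4⟩ := h
  exact (tsum_nonneg fun i => by positivity).trans h3

/-- The part of a decomposition in the orders up to `M`, and the size of the rest. -/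
theorem truncate (hy : 1 ≤ y) (h : Dec F y A N) (hF : Monotone F)
    (hc : ∀ m, IsClosed (F m : Set 𝔄)) (M : ℕ) :
    ∃ A' ∈ F M, ‖A'‖ ≤ N ∧ ‖A - A'‖ ≤ N / y ^ (M + 1) := by
  obtain ⟨ι, m, a, h1, h2, h3, h4⟩ := h
  have hy0 : 0 < y := by linarith
  have hle : ∀ i, ‖a i‖ ≤ y ^ m i * ‖a i‖ := fun i =>
    le_mul_of_one_le_left (norm_nonneg _) (one_le_pow₀ hy)
  let b : ι → 𝔄 := fun i => if m i ≤ M then a i else 0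
  have hb : ∀ i, ‖b i‖ ≤ y ^ m i * ‖a i‖ := by
    intro i
    by_cases hi : m i ≤ M
    · simpa [b, hi] using hle i
    · simp [b, hi]; positivity
  have hbs : Summable b := Summable.of_norm_bounded h2 hb
  have hr : ∀ i, ‖a i - b i‖ ≤ (y ^ m i * ‖a i‖) / y ^ (M + 1) := by
    intro i
    by_cases hi : m i ≤ M
    · simpa [b, hi] using by positivity
    · simp only [b, hi, if_false, sub_zero]
      rw [le_div_iff₀ (by positivity), mul_comm]
      gcongr
      omega
  refine ⟨∑' i, b i, ?_, ?_, ?_⟩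
  · refine (hc M).mem_of_tendsto hbs.hasSum (Filter.Eventually.of_forall fun s => ?_)
    refine Submodule.sum_mem _ fun i _ => ?_
    by_cases hi : m i ≤ M
    · simpa [b, hi] using hF hi (h1 i)
    · simp [b, hi]
  · exact (tsum_of_norm_bounded h2.hasSum hb).trans h3
  · rw [← h4.tsum_eq, ← h4.summable.tsum_sub hbs]
    refine (tsum_of_norm_bounded (h2.hasSum.div_const _) hr).trans ?_
    gcongr

/-- A decomposition into orders `≥ n` only. -/
theorem norm_le_of_bot (hy : 1 ≤ y) (h : Dec F y A N) {n : ℕ} (hF : ∀ m < n, F m = ⊥) :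
    ‖A‖ ≤ N / y ^ n := by
  obtain ⟨ι, m, a, h1, h2, h3, h4⟩ := h
  have hy0 : 0 < y := by linarith
  have : ‖A‖ ≤ (∑' i, y ^ m i * ‖a i‖) / y ^ n := by
    rw [← h4.tsum_eq]
    refine tsum_of_norm_bounded (h2.hasSum.div_const _) fun i => ?_
    rcases lt_or_ge (m i) n with hi | hi
    · have := h1 i
      rw [hF _ hi, Submodule.mem_bot] at this
      simp [this]
    · rw [le_div_iff₀ (by positivity), mul_comm]
      gcongr
  refine this.trans ?_
  gcongr

theorem map (hy : 0 ≤ y) (h : Dec F y A N) (T : 𝔄 →L[ℂ] 𝔄) {c : ℝ} (hc : 0 ≤ c)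
    (hT : ∀ m, ∀ x ∈ F m, T x ∈ F' m ∧ ‖T x‖ ≤ c * ‖x‖) : Dec F' y (T A) (c * N) := by
  obtain ⟨ι, m, a, h1, h2, h3, h4⟩ := h
  have hb : ∀ i, y ^ m i * ‖T (a i)‖ ≤ c * (y ^ m i * ‖a i‖) := by
    intro i
    calc y ^ m i * ‖T (a i)‖ ≤ y ^ m i * (c * ‖a i‖) := by
          gcongr; exact (hT _ _ (h1 i)).2
      _ = _ := by ring
  have hs : Summable fun i => y ^ m i * ‖T (a i)‖ :=
    Summable.of_nonneg_of_le (fun i => by positivity) hb (h2.mul_left c)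
  refine ⟨ι, m, fun i => T (a i), fun i => (hT _ _ (h1 i)).1, hs, ?_, T.hasSum h4⟩
  calc _ ≤ ∑' i, c * (y ^ m i * ‖a i‖) := hs.tsum_le_tsum hb (h2.mul_left c)
    _ = c * ∑' i, y ^ m i * ‖a i‖ := tsum_mul_left
    _ ≤ c * N := by gcongr

theorem hasSum {a : ℕ → 𝔄} {n : ℕ → ℝ} (h : ∀ p, Dec F y (a p) (n p))
    (hn : Summable n) (ha : HasSum a A) (h1y : 1 ≤ y) :
    Dec F y A (∑' p, n p) := by
  choose ι m b h1 h2 h3 h4 using h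
  have hsig : Summable fun q : Σ p, ι p => y ^ m q.1 q.2 * ‖b q.1 q.2‖ := by
    refine (summable_sigma_of_nonneg fun q => by positivity).2 ⟨h2, ?_⟩
    exact Summable.of_nonneg_of_le (fun p => tsum_nonneg fun i => by positivity) h3 hn
  have hbs : Summable fun q : Σ p, ι p => b q.1 q.2 :=
    Summable.of_norm_bounded hsig fun q =>
      le_mul_of_one_le_left (norm_nonneg _) (one_le_pow₀ h1y)
  refine ⟨Σ p, ι p, fun q => m q.1 q.2, fun q => b q.1 q.2, fun q => h1 _ _, hsig, ?_, ?_⟩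
  · rw [hsig.tsum_sigma]
    refine Summable.tsum_le_tsum h3 ?_ hn
    exact Summable.of_nonneg_of_le (fun p => tsum_nonneg fun i => by positivity) h3 hn
  · have h5 := hbs.hasSum.sigma fun p => h4 p
    rw [ha.unique h5]
    exact hbs.hasSum

theorem zero (hN : 0 ≤ N) : Dec F y 0 N :=
  (of_mem (m := 0) (zero_mem (F 0))).mono (by simpa using hN)

theorem add (hA : Dec F y A N) (hB : Dec F y B N') : Dec F y (A + B) (N + N') := by
  obtain ⟨ι, m, a, h1, h2, h3, h4⟩ := hA
  obtain ⟨ι', m', a', h1', h2', h3', h4'⟩ := hB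
  have e : (fun i => y ^ (Sum.elim m m' i) * ‖Sum.elim a a' i‖) =
      Sum.elim (fun i => y ^ m i * ‖a i‖) (fun i => y ^ m' i * ‖a' i‖) := by
    funext i; cases i <;> rfl
  have hs : HasSum (Sum.elim (fun i => y ^ m i * ‖a i‖) (fun i => y ^ m' i * ‖a' i‖)) _ :=
    HasSum.sum h2.hasSum h2'.hasSum
  refine ⟨ι ⊕ ι', Sum.elim m m', Sum.elim a a', ?_, ?_, ?_, HasSum.sum (f := Sum.elim a a') h4 h4'⟩
  · rintro (i | i)
    · exact h1 i
    · exact h1' i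
  · rw [e]; exact hs.summable
  · rw [e, hs.tsum_eq]; exact add_le_add h3 h3'

/-- Orders add and `y ^ (i + j)` factorizes, so the weights behave like norms. The target `F'` is
kept separate from `F` so that a commutator can be recorded as having gained an order. -/
theorem lie (hA : Dec F y A N) (hX : Dec S y X s) (h1y : 1 ≤ y)
    (hF : ∀ i j, ∀ a ∈ F i, ∀ x ∈ S j, ⁅a, x⁆ ∈ F' (i + j)) :
    Dec F' y ⁅A, X⁆ (2 * s * N) := by
  have hy : 0 ≤ y := by linarith
  obtain ⟨ι, m, a, h1, h2, h3, h4⟩ := hA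
  obtain ⟨κ, m', x, h1', h2', h3', h4'⟩ := hX
  have hprod := h2.mul_of_nonneg h2' (fun i => by positivity) (fun i => by positivity)
  have hb : ∀ q : ι × κ, y ^ (m q.1 + m' q.2) * ‖⁅a q.1, x q.2⁆‖ ≤
      2 * ((y ^ m q.1 * ‖a q.1‖) * (y ^ m' q.2 * ‖x q.2‖)) := by
    intro q
    calc _ ≤ y ^ (m q.1 + m' q.2) * (2 * ‖a q.1‖ * ‖x q.2‖) := by
          gcongr; exact norm_lie_le' _ _
      _ = _ := by rw [pow_add]; ring
  have hsum : Summable fun q : ι × κ => y ^ (m q.1 + m' q.2) * ‖⁅a q.1, x q.2⁆‖ :=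
    Summable.of_nonneg_of_le (fun q => by positivity) hb (hprod.mul_left 2)
  have hna : Summable fun i => ‖a i‖ := Summable.of_nonneg_of_le (fun i => norm_nonneg _)
    (fun i => le_mul_of_one_le_left (norm_nonneg _) (one_le_pow₀ h1y)) h2
  have hnx : Summable fun i => ‖x i‖ := Summable.of_nonneg_of_le (fun i => norm_nonneg _)
    (fun i => le_mul_of_one_le_left (norm_nonneg _) (one_le_pow₀ h1y)) h2'
  refine ⟨ι × κ, fun q => m q.1 + m' q.2, fun q => ⁅a q.1, x q.2⁆,
    fun q => hF _ _ _ (h1 _) _ (h1' _), hsum, ?_, ?_⟩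
  · calc _ ≤ ∑' q : ι × κ, 2 * ((y ^ m q.1 * ‖a q.1‖) * (y ^ m' q.2 * ‖x q.2‖)) :=
          hsum.tsum_le_tsum hb (hprod.mul_left 2)
      _ = 2 * ((∑' i, y ^ m i * ‖a i‖) * ∑' j, y ^ m' j * ‖x j‖) := by
          rw [tsum_mul_left, h2.tsum_mul_tsum h2' hprod]
      _ ≤ 2 * (N * s) := by
          have hN : 0 ≤ N := le_trans (tsum_nonneg fun i => by positivity) h3
          gcongr
      _ = _ := by ring
  · have p1 : HasSum (fun q : ι × κ => a q.1 * x q.2) (A * X) := by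
      have := summable_mul_of_summable_norm hna hnx
      have h := tsum_mul_tsum_of_summable_norm hna hnx
      rw [h4.tsum_eq, h4'.tsum_eq] at h
      rw [h]; exact this.hasSum
    have p2 : HasSum (fun q : ι × κ => x q.2 * a q.1) (X * A) := by
      have := summable_mul_of_summable_norm hnx hna
      have h := tsum_mul_tsum_of_summable_norm hnx hna
      rw [h4.tsum_eq, h4'.tsum_eq] at h
      rw [h]
      exact (Equiv.prodComm ι κ).hasSum_iff.2 this.hasSum
    simpa only [Ring.lie_def] using p1.sub p2

end Dec

/-- `X ↦ [X, S]`. -/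
noncomputable def adR (S : 𝔄) : 𝔄 →L[ℂ] 𝔄 :=
  (ContinuousLinearMap.mul ℂ 𝔄).flip S - ContinuousLinearMap.mul ℂ 𝔄 S

theorem adR_apply (S X : 𝔄) : adR S X = ⁅X, S⁆ := by
  simp [adR, Ring.lie_def]

/-- `adR S` is the sum of right multiplication by `S` and left multiplication by `-S`. These
commute, so the exponential of `adR S` factorizes into the two multiplications by exponentials. -/
theorem hasSum_conj_exp (S X : 𝔄) :
    HasSum (fun p : ℕ => ((p.factorial : ℂ)⁻¹) • ((adR S) ^ p) X)
      (NormedSpace.exp (-S) * X * NormedSpace.exp S) := by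
  let +nondep : NormedAlgebra ℚ (𝔄 →L[ℂ] 𝔄) := .restrictScalars ℚ ℂ _
  let Lm : 𝔄 →L[ℂ] 𝔄 := ContinuousLinearMap.mul ℂ 𝔄 (-S)
  let Rm : 𝔄 →L[ℂ] 𝔄 := (ContinuousLinearMap.mul ℂ 𝔄).flip S
  have had : adR S = Rm + Lm := by
    ext X; simp [adR, Rm, Lm, sub_eq_add_neg]
  have hcomm : Commute Rm Lm := by
    ext X; simp [Rm, Lm, mul_assoc]
  have hexp : NormedSpace.exp (adR S) = NormedSpace.exp Rm * NormedSpace.exp Lm := by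
    rw [had]; exact NormedSpace.exp_add_of_commute hcomm
  have hLp : ∀ (p : ℕ) (X : 𝔄), (Lm ^ p) X = (-S) ^ p * X := by
    intro p
    induction p with
    | zero => intro X; simp
    | succ p ih => intro X; rw [pow_succ, mul_apply_eq_comp, ih]
                   simp only [Lm, ContinuousLinearMap.mul_apply', pow_succ, mul_assoc]
  have hRp : ∀ (p : ℕ) (X : 𝔄), (Rm ^ p) X = X * S ^ p := by
    intro p
    induction p with
    | zero => intro X; simp
    | succ p ih => intro X; rw [pow_succ, mul_apply_eq_comp, ih]
                   simp only [Rm, ContinuousLinearMap.flip_apply, ContinuousLinearMap.mul_apply',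
                     pow_succ', mul_assoc]
  have hL : ∀ X, NormedSpace.exp Lm X = NormedSpace.exp (-S) * X := by
    intro X
    have h1 := (ContinuousLinearMap.apply ℂ 𝔄 X).hasSum
      (NormedSpace.exp_series_hasSum_exp' (𝕂 := ℂ) Lm)
    have h2 := (NormedSpace.exp_series_hasSum_exp' (𝕂 := ℂ) (-S)).mul_right X
    refine h1.unique ?_
    simpa [Function.comp_def, hLp] using h2
  have hR : ∀ X, NormedSpace.exp Rm X = X * NormedSpace.exp S := by
    intro X
    have h1 := (ContinuousLinearMap.apply ℂ 𝔄 X).hasSum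
      (NormedSpace.exp_series_hasSum_exp' (𝕂 := ℂ) Rm)
    have h2 := (NormedSpace.exp_series_hasSum_exp' (𝕂 := ℂ) S).mul_left X
    refine h1.unique ?_
    simpa [Function.comp_def, hRp] using h2
  have h := (ContinuousLinearMap.apply ℂ 𝔄 X).hasSum
      (NormedSpace.exp_series_hasSum_exp' (𝕂 := ℂ) (adR S))
  have e : (ContinuousLinearMap.apply ℂ 𝔄 X) (NormedSpace.exp (adR S)) =
      NormedSpace.exp (-S) * X * NormedSpace.exp S := by
    rw [hexp]; simp [hL, hR]
  rw [e] at h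
  simpa [Function.comp_def] using h

theorem hasSum_real_exp (x : ℝ) : HasSum (fun p : ℕ => (p.factorial : ℝ)⁻¹ * x ^ p) (Real.exp x) := by
  rw [Real.exp_eq_exp_ℝ]
  simpa using NormedSpace.exp_series_hasSum_exp' (𝕂 := ℝ) x

/-! ### Conjugation of weighted decompositions by exponentials -/

namespace Dec

variable {F F' S : ℕ → Submodule ℂ 𝔄} {y : ℝ} {A B X : 𝔄} {N N' s : ℝ}

theorem adR_pow (h1y : 1 ≤ y) (hA : Dec F y A N) (hX : Dec S y X s)
    (hF : ∀ i j, ∀ a ∈ F i, ∀ x ∈ S j, ⁅a, x⁆ ∈ F (i + j)) (p : ℕ) :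
    Dec F y ((adR X ^ p) A) ((2 * s) ^ p * N) := by
  induction p with
  | zero => simpa using hA
  | succ p ih =>
    rw [pow_succ', mul_apply_eq_comp, adR_apply]
    exact (ih.lie hX h1y hF).mono (by rw [pow_succ]; linarith)

theorem conj_exp (h1y : 1 ≤ y) (hA : Dec F y A N) (hX : Dec S y X s)
    (hF : ∀ i j, ∀ a ∈ F i, ∀ x ∈ S j, ⁅a, x⁆ ∈ F (i + j)) :
    Dec F y (NormedSpace.exp (-X) * A * NormedSpace.exp X) (Real.exp (2 * s) * N) := by
  have hd : ∀ p : ℕ, Dec F y (((p.factorial : ℂ)⁻¹) • ((adR X) ^ p) A)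
      ((p.factorial : ℝ)⁻¹ * (2 * s) ^ p * N) := by
    intro p
    have := (hA.adR_pow h1y hX hF p).map (F' := F) (by linarith)
      (((p.factorial : ℂ)⁻¹) • ContinuousLinearMap.id ℂ 𝔄) (c := (p.factorial : ℝ)⁻¹)
      (by positivity) (fun m x hx => ⟨Submodule.smul_mem _ _ hx, by simp [norm_smul]⟩)
    simpa [mul_assoc] using this
  have hsum := (hasSum_real_exp (2 * s)).mul_right N
  have := Dec.hasSum hd hsum.summable (hasSum_conj_exp X A) h1y
  rwa [hsum.tsum_eq] at this

/-- A combination of the commutators of order at least one. -/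
theorem adR_series (h1y : 1 ≤ y) (hA : Dec F y A N) (hX : Dec S y X s)
    (hF : ∀ i j, ∀ a ∈ F i, ∀ x ∈ S j, ⁅a, x⁆ ∈ F' (i + j)) (hFF : ∀ m, F' m ≤ F m)
    {c : ℕ → ℂ} (hc : ∀ p, ‖c p‖ ≤ ((p + 1).factorial : ℝ)⁻¹)
    (hB : HasSum (fun p : ℕ => c p • ((adR X) ^ (p + 1)) A) B) :
    Dec F' y B ((Real.exp (2 * s) - 1) * N) := by
  have hN := hA.nonneg h1y
  have hs := hX.nonneg h1y
  have hd : ∀ p : ℕ, Dec F' y (c p • ((adR X) ^ (p + 1)) A)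
      (((p + 1).factorial : ℝ)⁻¹ * (2 * s) ^ (p + 1) * N) := by
    intro p
    have h1 : Dec F' y ((adR X ^ (p + 1)) A) ((2 * s) ^ (p + 1) * N) := by
      -- The inner `p` commutators are only placed in `F`; the outermost one lands in the smaller
      -- filtration `F'`.
      rw [pow_succ', mul_apply_eq_comp, adR_apply]
      refine ((hA.adR_pow h1y hX (fun i j a ha x hx => hFF _ (hF i j a ha x hx)) p).lie hX h1y hF).mono (by rw [pow_succ]; linarith)
    have := h1.map (F' := F') (by linarith)
      ((c p) • ContinuousLinearMap.id ℂ 𝔄) (c := ((p + 1).factorial : ℝ)⁻¹)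
      (by positivity) (fun m x hx => ⟨Submodule.smul_mem _ _ hx, by
        simp only [smul_apply, ContinuousLinearMap.id_apply, norm_smul]
        exact mul_le_mul_of_nonneg_right (hc p) (norm_nonneg _)⟩)
    simpa [mul_assoc] using this
  have hsum : HasSum (fun p : ℕ => ((p + 1).factorial : ℝ)⁻¹ * (2 * s) ^ (p + 1) * N)
      ((Real.exp (2 * s) - 1) * N) := by
    refine HasSum.mul_right N ?_
    have := (hasSum_nat_add_iff' 1).2 (hasSum_real_exp (2 * s))
    simpa using this
  have := Dec.hasSum hd hsum.summable hB h1y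
  rwa [hsum.tsum_eq] at this

theorem conj_exp_sub (h1y : 1 ≤ y) (hA : Dec F y A N) (hX : Dec S y X s)
    (hF : ∀ i j, ∀ a ∈ F i, ∀ x ∈ S j, ⁅a, x⁆ ∈ F' (i + j)) (hFF : ∀ m, F' m ≤ F m) :
    Dec F' y (NormedSpace.exp (-X) * A * NormedSpace.exp X - A)
      ((Real.exp (2 * s) - 1) * N) := by
  refine adR_series h1y hA hX hF hFF (c := fun p => ((p + 1).factorial : ℂ)⁻¹)
    (fun p => by simp) ?_
  have := (hasSum_nat_add_iff' 1).2 (hasSum_conj_exp X A)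
  simpa using this

/-- The remainder of second order, for an element whose commutator with `X` is known. -/
theorem conj_exp_sub_sub (h1y : 1 ≤ y) (hA : Dec F y A N) (hX : Dec S y X s)
    (hF : ∀ i j, ∀ a ∈ F i, ∀ x ∈ S j, ⁅a, x⁆ ∈ F' (i + j)) (hFF : ∀ m, F' m ≤ F m)
    {H : 𝔄} (hH : ⁅H, X⁆ = A) :
    Dec F' y (NormedSpace.exp (-X) * H * NormedSpace.exp X - H - A)
      ((Real.exp (2 * s) - 1) * N) := by
  -- Since `[H, X] = A`, the terms of order at least two in `H` are commutators of order at least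
  -- one in `A`, with the smaller coefficients `1/(p+2)!`. The size of `H` itself never enters.
  refine adR_series h1y hA hX hF hFF (c := fun p => ((p + 2).factorial : ℂ)⁻¹)
    (fun p => ?_) ?_
  · simp only [norm_inv, Complex.norm_natCast]
    gcongr
    omega
  · have := (hasSum_nat_add_iff' 2).2 (hasSum_conj_exp X H)
    have e : ∀ p, (adR X ^ (p + 2)) H = (adR X ^ (p + 1)) A := by
      intro p
      rw [show p + 2 = (p + 1) + 1 from rfl, pow_succ, mul_apply_eq_comp, adR_apply, hH]
    simpa [e, Finset.sum_range_succ, adR_apply, hH, sub_sub] using this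

end Dec

end Decomposition

end SlowLR

set_option linter.unusedSectionVars false

namespace SlowLR

/-! ### Supports of operators -/

section Supports

variable {Λ : Type*} [Fintype Λ] [LinearOrder Λ]

/-- Flip the spin at `v`. -/
def flipAt (v : Λ) (σ : Λ → Bool) : Λ → Bool := Function.update σ v (!σ v)

theorem flipAt_flipAt (v : Λ) (σ : Λ → Bool) : flipAt v (flipAt v σ) = σ := by
  simp [flipAt]

theorem flipAt_self (v : Λ) (σ : Λ → Bool) : flipAt v σ v = !σ v := by simp [flipAt]

theorem flipAt_of_ne {v w : Λ} (h : w ≠ v) (σ : Λ → Bool) : flipAt v σ w = σ w := by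
  simp [flipAt, h]

/-- The Pauli matrix `X` at `v`. -/
def pauliX (v : Λ) : Op Λ := Matrix.of fun σ τ => if τ = flipAt v σ then 1 else 0

/-- The operators supported in `S`: the commutant of the Pauli matrices outside `S`. -/
noncomputable def suppAlg (S : Finset Λ) : Subalgebra ℂ (Op Λ) :=
  Subalgebra.centralizer ℂ {g | ∃ v ∉ S, g = pauliX v ∨ g = pauliZ {v}}

theorem spin_injective : Function.Injective spin := by
  intro a b h
  cases a <;> cases b <;> simp [spin] at h ⊢ <;> norm_num at h

/-- Commuting with `Z_v` means that entries between configurations differing at `v` vanish;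
commuting with `X_v` means invariance under a simultaneous flip at `v`. -/
theorem mem_suppAlg_iff {S : Finset Λ} {O : Op Λ} :
    O ∈ suppAlg S ↔ ∀ v ∉ S, (∀ σ τ, σ v ≠ τ v → O σ τ = 0) ∧
      ∀ σ τ, O (flipAt v σ) (flipAt v τ) = O σ τ := by
  have hZ : ∀ v : Λ, pauliZ {v} * O = O * pauliZ {v} ↔ ∀ σ τ, σ v ≠ τ v → O σ τ = 0 := by
    intro v
    rw [← Matrix.ext_iff]
    refine forall_congr' fun σ => forall_congr' fun τ => ?_
    simp only [pauliZ, Matrix.diagonal_mul, Matrix.mul_diagonal, Finset.prod_singleton]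
    constructor
    · intro h hne
      have h2 : ((spin (σ v) : ℂ) - spin (τ v)) * O σ τ = 0 := by
        rw [sub_mul, h]; ring
      rcases mul_eq_zero.1 h2 with h3 | h3
      · exact absurd (spin_injective (by exact_mod_cast sub_eq_zero.1 h3)) hne
      · exact h3
    · intro h
      by_cases hne : σ v = τ v
      · rw [hne]; ring
      · rw [h hne]; ring
  have hX : ∀ v : Λ, pauliX v * O = O * pauliX v ↔
      ∀ σ τ, O (flipAt v σ) (flipAt v τ) = O σ τ := by
    intro v
    have e : ∀ σ τ, (pauliX v * O) σ τ = O (flipAt v σ) τ := by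
      intro σ τ; simp [pauliX, Matrix.mul_apply]
    have e' : ∀ σ τ, (O * pauliX v) σ τ = O σ (flipAt v τ) := by
      intro σ τ
      have : ∀ ρ : Λ → Bool, (τ = flipAt v ρ) ↔ (ρ = flipAt v τ) := by
        intro ρ
        constructor <;> rintro rfl <;> rw [flipAt_flipAt]
      simp [pauliX, Matrix.mul_apply, this]
    rw [← Matrix.ext_iff]
    simp only [e, e']
    constructor
    · intro h σ τ
      rw [h, flipAt_flipAt]
    · intro h σ τ
      have := h σ (flipAt v τ)
      rwa [flipAt_flipAt] at this
  rw [suppAlg, Subalgebra.mem_centralizer_iff]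
  constructor
  · intro h v hv
    exact ⟨(hZ v).1 (h _ ⟨v, hv, Or.inr rfl⟩), (hX v).1 (h _ ⟨v, hv, Or.inl rfl⟩)⟩
  · rintro h g ⟨v, hv, rfl | rfl⟩
    · exact (hX v).2 (h v hv).2
    · exact (hZ v).2 (h v hv).1

theorem apply_eq_zero_of_mem {S : Finset Λ} {O : Op Λ} (hO : O ∈ suppAlg S) {σ τ : Λ → Bool}
    {v : Λ} (hv : v ∉ S) (h : σ v ≠ τ v) : O σ τ = 0 :=
  (mem_suppAlg_iff.1 hO v hv).1 σ τ h

theorem apply_eq_of_mem {S : Finset Λ} {O : Op Λ} (hO : O ∈ suppAlg S) {σ τ σ' τ' : Λ → Bool}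
    (hσ : ∀ v ∈ S, σ' v = σ v) (hτ : ∀ v ∈ S, τ' v = τ v) (h : ∀ v ∉ S, σ v = τ v)
    (h' : ∀ v ∉ S, σ' v = τ' v) : O σ' τ' = O σ τ := by
  -- The vertices outside `S` are changed one at a time, `T` being those already changed. At each of
  -- them the two configurations agree before and after, so the change is either void or a
  -- simultaneous flip.
  have key : ∀ T : Finset Λ, Disjoint T S →
      O (T.piecewise σ' σ) (T.piecewise τ' τ) = O σ τ := by
    intro T
    induction T using Finset.induction_on with
    | empty => simp
    | insert v T hvT ih =>
      intro hd
      rw [Finset.disjoint_insert_left] at hd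
      rw [← ih hd.2, Finset.piecewise_insert, Finset.piecewise_insert]
      by_cases hv : σ' v = σ v
      · have e1 : Function.update (T.piecewise σ' σ) v (σ' v) = T.piecewise σ' σ := by
          rw [Function.update_eq_self_iff, Finset.piecewise_eq_of_notMem _ _ _ hvT, hv]
        have e2 : Function.update (T.piecewise τ' τ) v (τ' v) = T.piecewise τ' τ := by
          rw [Function.update_eq_self_iff, Finset.piecewise_eq_of_notMem _ _ _ hvT,
            ← h' v hd.1, ← h v hd.1, hv]
        rw [e1, e2]
      · have hv2 : σ' v = !σ v := by cases h1 : σ' v <;> cases h2 : σ v <;> simp_all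
        have e1 : Function.update (T.piecewise σ' σ) v (σ' v) = flipAt v (T.piecewise σ' σ) := by
          rw [flipAt, Finset.piecewise_eq_of_notMem _ _ _ hvT, hv2]
        have e2 : Function.update (T.piecewise τ' τ) v (τ' v) = flipAt v (T.piecewise τ' τ) := by
          rw [flipAt, Finset.piecewise_eq_of_notMem _ _ _ hvT, ← h' v hd.1, ← h v hd.1, hv2]
        rw [e1, e2, (mem_suppAlg_iff.1 hO v hd.1).2]
  have := key Sᶜ (Finset.disjoint_left.2 fun v h1 h2 => (Finset.mem_compl.1 h1) h2)
  rw [← this]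
  congr 1
  · funext v
    by_cases hv : v ∈ S
    · rw [Finset.piecewise_eq_of_notMem _ _ _ (by simpa using hv), hσ v hv]
    · rw [Finset.piecewise_eq_of_mem _ _ _ (by simpa using hv)]
  · funext v
    by_cases hv : v ∈ S
    · rw [Finset.piecewise_eq_of_notMem _ _ _ (by simpa using hv), hτ v hv]
    · rw [Finset.piecewise_eq_of_mem _ _ _ (by simpa using hv)]

theorem supportedIn_iff {S : Finset Λ} {O : Op Λ} : SupportedIn S O ↔ O ∈ suppAlg S := by
  classical
  constructor
  · rintro ⟨OS, h⟩
    refine mem_suppAlg_iff.2 fun v hv => ⟨fun σ τ hne => ?_, fun σ τ => ?_⟩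
    · rw [h, if_neg]
      push Not
      exact ⟨v, hv, hne⟩
    · rw [h, h]
      have e : ∀ σ : Λ → Bool, (fun w : S => flipAt v σ w) = fun w : S => σ w := by
        intro σ; funext w
        exact flipAt_of_ne (by rintro rfl; exact hv w.2) σ
      rw [e, e]
      refine if_congr (forall_congr' fun w => forall_congr' fun hw => ?_) rfl rfl
      by_cases hwv : w = v
      · subst hwv; simp [flipAt_self]
      · simp [flipAt_of_ne hwv]
  · intro hO
    -- The value `false` outside `S` is immaterial by `apply_eq_of_mem`.
    let ext : (S → Bool) → Λ → Bool := fun a v => if hv : v ∈ S then a ⟨v, hv⟩ else false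
    refine ⟨fun a b => O (ext a) (ext b), fun σ τ => ?_⟩
    split_ifs with h
    · refine (apply_eq_of_mem hO ?_ ?_ h ?_).symm
      · intro v hv; simp [ext, hv]
      · intro v hv; simp [ext, hv]
      · intro v hv; simp [ext, hv]
    · push Not at h
      obtain ⟨v, hv, hne⟩ := h
      exact apply_eq_zero_of_mem hO hv hne

theorem suppAlg_mono {S T : Finset Λ} (h : S ⊆ T) : suppAlg S ≤ suppAlg T :=
  Subalgebra.centralizer_le ℂ _ _ fun _ ⟨v, hv, hg⟩ => ⟨v, fun hvS => hv (h hvS), hg⟩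

theorem star_mem_suppAlg {S : Finset Λ} {O : Op Λ} (hO : O ∈ suppAlg S) : star O ∈ suppAlg S := by
  refine mem_suppAlg_iff.2 fun v hv => ⟨fun σ τ hne => ?_, fun σ τ => ?_⟩
  · rw [Matrix.star_apply, apply_eq_zero_of_mem hO hv hne.symm, star_zero]
  · rw [Matrix.star_apply, Matrix.star_apply, (mem_suppAlg_iff.1 hO v hv).2]

theorem isClosed_submodule (F : Submodule ℂ (Op Λ)) : IsClosed (F : Set (Op Λ)) :=
  Submodule.closed_of_finiteDimensional F

theorem exp_mem_suppAlg {S : Finset Λ} {O : Op Λ} (hO : O ∈ suppAlg S) :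
    NormedSpace.exp O ∈ suppAlg S := by
  have h := NormedSpace.exp_series_hasSum_exp' (𝕂 := ℂ) O
  refine (isClosed_submodule (Subalgebra.toSubmodule (suppAlg S))).mem_of_tendsto h
    (Filter.Eventually.of_forall fun s => ?_)
  exact Submodule.sum_mem _ fun i _ => Submodule.smul_mem _ _ (pow_mem hO i)

/-- In each product a single intermediate configuration contributes: `p` (equal to `τ` on `S` and to
`σ` elsewhere) for `A * B`, and `q` with the roles exchanged for `B * A`. The entries of `A` and of
`B` that occur are the same in both. -/
theorem commute_of_disjoint {S T : Finset Λ} (h : Disjoint S T) {A B : Op Λ} (hA : A ∈ suppAlg S)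
    (hB : B ∈ suppAlg T) : Commute A B := by
  have hd : ∀ v ∈ S, v ∉ T := fun v hv => Finset.disjoint_left.1 h hv
  ext σ τ
  let p : Λ → Bool := fun v => if v ∈ S then τ v else σ v
  let q : Λ → Bool := fun v => if v ∈ S then σ v else τ v
  have h1 : (A * B) σ τ = A σ p * B p τ := by
    rw [Matrix.mul_apply, Finset.sum_eq_single p]
    · intro ρ _ hρ
      obtain ⟨v, hv⟩ := Function.ne_iff.1 hρ
      by_cases hvS : v ∈ S
      · rw [apply_eq_zero_of_mem hB (hd v hvS) (by simpa [p, hvS] using hv), mul_zero]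
      · rw [apply_eq_zero_of_mem hA hvS (by simpa [p, hvS] using hv.symm), zero_mul]
    · simp
  have h2 : (B * A) σ τ = B σ q * A q τ := by
    rw [Matrix.mul_apply, Finset.sum_eq_single q]
    · intro ρ _ hρ
      obtain ⟨v, hv⟩ := Function.ne_iff.1 hρ
      by_cases hvS : v ∈ S
      · rw [apply_eq_zero_of_mem hB (hd v hvS) (by simpa [q, hvS] using hv.symm), zero_mul]
      · rw [apply_eq_zero_of_mem hA hvS (by simpa [q, hvS] using hv), mul_zero]
    · simp
  have h3 : A q τ = A σ p := by
    refine apply_eq_of_mem hA ?_ ?_ ?_ ?_ <;> intro v hv <;> simp [p, q, hv]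
  have h4 : B σ q = B p τ := by
    by_cases hb : ∃ v, v ∉ T ∧ v ∉ S ∧ σ v ≠ τ v
    · obtain ⟨v, hvT, hvS, hne⟩ := hb
      rw [apply_eq_zero_of_mem hB hvT (by simpa [q, hvS] using hne),
        apply_eq_zero_of_mem hB hvT (by simpa [p, hvS] using hne)]
    · push Not at hb
      refine apply_eq_of_mem hB ?_ ?_ ?_ ?_ <;> intro v hv
      · have : v ∉ S := fun hvS => hd v hvS hv
        simp [p, this]
      · have : v ∉ S := fun hvS => hd v hvS hv
        simp [q, this]
      · by_cases hvS : v ∈ S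
        · simp [p, hvS]
        · simpa [p, hvS] using hb v hv hvS
      · by_cases hvS : v ∈ S
        · simp [q, hvS]
        · simpa [q, hvS] using hb v hv hvS
  rw [h1, h2, h3, h4, mul_comm]

/-! ### Diagonal parts and norms of entries -/

/-- The diagonal part of an operator. -/
noncomputable def diagPart : Op Λ →L[ℂ] Op Λ :=
  LinearMap.toContinuousLinearMap
    { toFun := fun O => Matrix.diagonal fun σ => O σ σ
      map_add' := fun A B => by ext σ τ; by_cases h : σ = τ <;> simp [h]
      map_smul' := fun c A => by ext σ τ; by_cases h : σ = τ <;> simp [h] }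

theorem diagPart_apply (O : Op Λ) : diagPart O = Matrix.diagonal fun σ => O σ σ := rfl

theorem norm_apply_le (A : Op Λ) (σ τ : Λ → Bool) : ‖A σ τ‖ ≤ ‖A‖ := by
  have h := Matrix.l2_opNorm_mulVec A (EuclideanSpace.single τ 1)
  rw [PiLp.norm_single, norm_one, mul_one] at h
  refine le_trans ?_ h
  refine le_trans (le_of_eq ?_) (PiLp.norm_apply_le _ σ)
  simp

theorem norm_diagPart_le (A : Op Λ) : ‖diagPart A‖ ≤ ‖A‖ := by
  rw [diagPart_apply, Matrix.l2_opNorm_diagonal]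
  exact (pi_norm_le_iff_of_nonneg (norm_nonneg _)).2 fun σ => norm_apply_le A σ σ

theorem diagPart_mem_suppAlg {S : Finset Λ} {O : Op Λ} (hO : O ∈ suppAlg S) :
    diagPart O ∈ suppAlg S := by
  refine mem_suppAlg_iff.2 fun v hv => ⟨fun σ τ hne => ?_, fun σ τ => ?_⟩
  · rw [diagPart_apply, Matrix.diagonal_apply_ne]
    exact fun h => hne (congrFun h v)
  · by_cases h : σ = τ
    · subst h
      simp [diagPart_apply, (mem_suppAlg_iff.1 hO v hv).2]
    · have h' : flipAt v σ ≠ flipAt v τ := fun e => h (by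
        rw [← flipAt_flipAt v σ, e, flipAt_flipAt])
      rw [diagPart_apply, Matrix.diagonal_apply_ne _ h, Matrix.diagonal_apply_ne _ h']

theorem commute_of_diagPart {A B : Op Λ} (hA : diagPart A = A) (hB : diagPart B = B) :
    Commute A B := by
  rw [← hA, ← hB, diagPart_apply, diagPart_apply]
  ext σ τ
  by_cases h : σ = τ
  · subst h; simp [mul_comm]
  · simp [h]

theorem diagPart_diagPart (A : Op Λ) : diagPart (diagPart A) = diagPart A := by
  simp [diagPart_apply]

theorem diagPart_star (A : Op Λ) : diagPart (star A) = star (diagPart A) := by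
  ext σ τ
  by_cases h : σ = τ
  · subst h; simp [diagPart_apply, Matrix.star_apply]
  · simp [diagPart_apply, Matrix.star_apply, h, Ne.symm h]

/-- A matrix with at most one nonzero entry in each row and column. -/
theorem norm_le_of_sparse {B : Op Λ} {c : ℝ} (hc : 0 ≤ c) (hB : ∀ σ τ, ‖B σ τ‖ ≤ c)
    (hrow : ∀ σ τ τ', B σ τ ≠ 0 → B σ τ' ≠ 0 → τ = τ')
    (hcol : ∀ σ σ' τ, B σ τ ≠ 0 → B σ' τ ≠ 0 → σ = σ') : ‖B‖ ≤ c := by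
  -- Since `star B * B` is diagonal, the C⋆-identity reads the norm of `B` off its entries.
  have hdiag : star B * B = Matrix.diagonal fun τ => ∑ σ, star (B σ τ) * B σ τ := by
    ext τ τ'
    rw [Matrix.mul_apply]
    by_cases h : τ = τ'
    · subst h; simp [Matrix.star_apply]
    · rw [Matrix.diagonal_apply_ne _ h]
      refine Finset.sum_eq_zero fun σ _ => ?_
      by_contra hne
      rw [Matrix.star_apply] at hne
      exact h (hrow σ τ τ' (fun h0 => hne (by simp [h0])) fun h0 => hne (by simp [h0]))
  have h2 : ‖B‖ * ‖B‖ ≤ c * c := by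
    rw [← CStarRing.norm_star_mul_self, hdiag, Matrix.l2_opNorm_diagonal]
    refine (pi_norm_le_iff_of_nonneg (by positivity)).2 fun τ => ?_
    by_cases h : ∃ σ₀, B σ₀ τ ≠ 0
    · obtain ⟨σ₀, h0⟩ := h
      rw [Finset.sum_eq_single σ₀]
      · rw [norm_mul, norm_star]
        exact mul_le_mul (hB _ _) (hB _ _) (norm_nonneg _) hc
      · intro σ _ hσ
        by_contra hne
        exact hσ (hcol σ σ₀ τ (fun h => hne (by simp [h])) h0)
      · simp
    · push Not at h
      simp [h, mul_self_nonneg]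
  exact abs_le_of_sq_le_sq' (by nlinarith) hc |>.2

end Supports

/-! ### Division by energy differences -/

section Schur

variable {Λ : Type*} [Fintype Λ] [LinearOrder Λ]

/-- Each dyadic block contributes at most one. Used with `m = |R|`, where `2 ^ m` bounds the number
of energy levels. -/
theorem sum_Ico_one_two_pow_inv_le (m : ℕ) : ∑ n ∈ Finset.Ico (1 : ℕ) (2 ^ m), (n : ℝ)⁻¹ ≤ m := by
  induction m with
  | zero => simp
  | succ m ih =>
    rw [← Finset.sum_Ico_consecutive _ Nat.one_le_two_pow
      (Nat.pow_le_pow_right two_pos (Nat.le_succ m))]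
    have h : ∑ n ∈ Finset.Ico ((2 : ℕ) ^ m) (2 ^ (m + 1)), (n : ℝ)⁻¹ ≤ 1 := by
      calc _ ≤ ∑ n ∈ Finset.Ico ((2 : ℕ) ^ m) (2 ^ (m + 1)), ((2 : ℝ) ^ m)⁻¹ := by
            refine Finset.sum_le_sum fun n hn => ?_
            have := (Finset.mem_Ico.1 hn).1
            gcongr
            exact_mod_cast this
        _ = 1 := by
            rw [Finset.sum_const, Nat.card_Ico, pow_succ, mul_two, Nat.add_sub_cancel]
            simp
    push_cast
    linarith

/-- The solution `B` of `[E, B] = A` (off the diagonal) for a diagonal operator `E`. -/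
noncomputable def invAd (E : (Λ → Bool) → ℝ) : Op Λ →L[ℂ] Op Λ :=
  LinearMap.toContinuousLinearMap
    -- Division by zero gives zero, so entries between configurations of equal energy, in particular
    -- the diagonal, are dropped.
    { toFun := fun A => Matrix.of fun σ τ => A σ τ / ((E σ - E τ : ℝ) : ℂ)
      map_add' := fun A B => by ext σ τ; simp [add_div]
      map_smul' := fun c A => by ext σ τ; simp [mul_div_assoc] }

theorem invAd_apply (E : (Λ → Bool) → ℝ) (A : Op Λ) (σ τ : Λ → Bool) :
    invAd E A σ τ = A σ τ / ((E σ - E τ : ℝ) : ℂ) := rfl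

variable {R : Finset Λ} {E : (Λ → Bool) → ℝ} {g : ℝ}

theorem card_image_le_two_pow (hR : ∀ σ τ : Λ → Bool, (∀ v ∈ R, σ v = τ v) → E σ = E τ) :
    (Finset.univ.image E).card ≤ 2 ^ R.card := by
  classical
  let f : (R → Bool) → ℝ := fun a => E fun v => if hv : v ∈ R then a ⟨v, hv⟩ else false
  have : Finset.univ.image E ⊆ Finset.univ.image f := by
    intro e he
    obtain ⟨σ, -, rfl⟩ := Finset.mem_image.1 he
    refine Finset.mem_image.2 ⟨fun v => σ v, Finset.mem_univ _, hR _ _ fun v hv => ?_⟩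
    simp [hv]
  calc _ ≤ (Finset.univ.image f).card := Finset.card_le_card this
    _ ≤ (Finset.univ : Finset (R → Bool)).card := Finset.card_image_le
    _ = _ := by simp

/-- The number of energy levels below that of `σ`. -/
noncomputable def levelRank (E : (Λ → Bool) → ℝ) (σ : Λ → Bool) : ℕ :=
  ((Finset.univ.image E).filter fun e => e < E σ).card

theorem mul_levelRank_sub_le (hg : 0 < g)
    (hR : ∀ σ τ : Λ → Bool, (∀ v ∈ R, σ v = τ v) → E σ = E τ)
    (hE : ∀ σ τ : Λ → Bool, (∃ v ∈ R, σ v ≠ τ v) → g ≤ |E σ - E τ|) {σ τ : Λ → Bool} {n : ℕ}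
    (h : levelRank E σ = levelRank E τ + n) (hn : 0 < n) : g * n ≤ E σ - E τ := by
  have hsep : ∀ e ∈ Finset.univ.image E, ∀ e' ∈ Finset.univ.image E, e < e' → e + g ≤ e' := by
    intro e he e' he' hlt
    obtain ⟨a, -, rfl⟩ := Finset.mem_image.1 he
    obtain ⟨b, -, rfl⟩ := Finset.mem_image.1 he'
    have hne : ∃ v ∈ R, a v ≠ b v := by
      by_contra hcon
      push Not at hcon
      exact hlt.ne (hR a b hcon)
    have := hE a b hne
    rw [abs_of_neg (by linarith)] at this
    linarith
  have hlt : E τ < E σ := by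
    by_contra hcon
    push Not at hcon
    have : levelRank E σ ≤ levelRank E τ := by
      refine Finset.card_le_card fun e he => ?_
      rw [Finset.mem_filter] at he ⊢
      exact ⟨he.1, he.2.trans_le hcon⟩
    omega
  let s := (Finset.univ.image E).filter fun e => E τ ≤ e ∧ e < E σ
  have hcard : n ≤ s.card := by
    have hsub : (Finset.univ.image E).filter (fun e => e < E σ) ⊆
        (Finset.univ.image E).filter (fun e => e < E τ) ∪ s := by
      intro e he
      rw [Finset.mem_filter] at he
      rw [Finset.mem_union, Finset.mem_filter, Finset.mem_filter]
      rcases lt_or_ge e (E τ) with h1 | h1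
      · exact Or.inl ⟨he.1, h1⟩
      · exact Or.inr ⟨he.1, h1, he.2⟩
    have := (Finset.card_le_card hsub).trans (Finset.card_union_le _ _)
    change levelRank E σ ≤ levelRank E τ + s.card at this
    omega
  -- The levels in `s` are `g` apart, so they occupy different cells of length `g` between `E τ` and
  -- `E σ`; hence there is room for at least `n` cells.
  have hmaps : ∀ e ∈ s, ⌊(e - E τ) / g⌋₊ ∈ Finset.range ⌊(E σ - E τ) / g⌋₊ := by
    intro e he
    obtain ⟨h1, h2, h3⟩ := Finset.mem_filter.1 he
    have h4 := hsep e h1 (E σ) (Finset.mem_image_of_mem _ (Finset.mem_univ _)) h3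
    rw [Finset.mem_range, Nat.lt_iff_add_one_le]
    refine Nat.le_floor ?_
    push_cast
    have h5 := Nat.floor_le (show 0 ≤ (e - E τ) / g from div_nonneg (by linarith) hg.le)
    have h6 : (e - E τ) / g + 1 ≤ (E σ - E τ) / g := by
      rw [div_add_one hg.ne']
      gcongr
      linarith
    linarith
  have hinj : Set.InjOn (fun e => ⌊(e - E τ) / g⌋₊) (s : Set ℝ) := by
    have key : ∀ e ∈ s, ∀ e' ∈ s, e < e' → ⌊(e - E τ) / g⌋₊ ≠ ⌊(e' - E τ) / g⌋₊ := by
      intro e he e' he' hlt heq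
      obtain ⟨h1, h2, h3⟩ := Finset.mem_filter.1 he
      obtain ⟨h1', h2', h3'⟩ := Finset.mem_filter.1 he'
      have h4 := hsep e h1 e' h1' hlt
      have h5 := Nat.floor_le (show 0 ≤ (e - E τ) / g from div_nonneg (by linarith) hg.le)
      have h6 := Nat.lt_floor_add_one ((e' - E τ) / g)
      have h7 : (e - E τ) / g + 1 ≤ (e' - E τ) / g := by
        rw [div_add_one hg.ne']
        gcongr
        linarith
      have h8 : ⌊(e - E τ) / g⌋₊ + 1 ≤ ⌊(e' - E τ) / g⌋₊ := by
        refine Nat.le_floor ?_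
        push_cast
        linarith
      omega
    intro e he e' he' heq
    rcases lt_trichotomy e e' with hlt | h | hlt
    · exact absurd heq (key e he e' he' hlt)
    · exact h
    · exact absurd heq.symm (key e' he' e he hlt)
  have h1 : s.card ≤ ⌊(E σ - E τ) / g⌋₊ := by
    have := Finset.card_le_card_of_injOn _ hmaps hinj
    simpa using this
  have h2 : (n : ℝ) ≤ (E σ - E τ) / g :=
    (Nat.le_floor_iff (div_nonneg (by linarith) hg.le)).1 (hcard.trans h1)
  rw [le_div_iff₀ hg] at h2
  linarith

theorem levelRank_injective (hg : 0 < g)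
    (hE : ∀ σ τ : Λ → Bool, (∃ v ∈ R, σ v ≠ τ v) → g ≤ |E σ - E τ|)
    {σ τ : Λ → Bool} (h : levelRank E σ = levelRank E τ) : ∀ v ∈ R, σ v = τ v := by
  have key : ∀ σ τ : Λ → Bool, E σ < E τ → levelRank E σ < levelRank E τ := by
    intro σ τ hlt
    refine Finset.card_lt_card ⟨fun e he => ?_, fun hcon => ?_⟩
    · rw [Finset.mem_filter] at he ⊢
      exact ⟨he.1, he.2.trans hlt⟩
    · have := hcon (Finset.mem_filter.2 ⟨Finset.mem_image_of_mem E (Finset.mem_univ σ), hlt⟩)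
      exact lt_irrefl _ (Finset.mem_filter.1 this).2
  have heq : E σ = E τ := by
    rcases lt_trichotomy (E σ) (E τ) with h1 | h1 | h1
    · have := key _ _ h1; omega
    · exact h1
    · have := key _ _ h1; omega
  by_contra hcon
  push Not at hcon
  have := hE σ τ hcon
  rw [heq, sub_self, abs_zero] at this
  linarith

/-- The matrix is split by the difference `n` of the energy ranks. Each piece has at most one entry
in every row and column, so its norm is its largest entry, at most `‖A‖ / (g n)`. Two signs and the
harmonic sum give `2|R|/g`, instead of a factor exponential in `|R|`. -/
theorem norm_invAd_le (hg : 0 < g)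
    (hR : ∀ σ τ : Λ → Bool, (∀ v ∈ R, σ v = τ v) → E σ = E τ)
    (hE : ∀ σ τ : Λ → Bool, (∃ v ∈ R, σ v ≠ τ v) → g ≤ |E σ - E τ|)
    {A : Op Λ} (hA : A ∈ suppAlg R) : ‖invAd E A‖ ≤ 2 * R.card / g * ‖A‖ := by
  classical
  have hrk : ∀ σ, levelRank E σ < 2 ^ R.card := by
    intro σ
    refine lt_of_lt_of_le (Finset.card_lt_card ?_) (card_image_le_two_pow hR)
    refine ⟨Finset.filter_subset _ _, fun hcon => ?_⟩
    have := hcon (Finset.mem_image_of_mem E (Finset.mem_univ σ))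
    exact lt_irrefl _ (Finset.mem_filter.1 this).2
  have hoff : ∀ σ τ, invAd E A σ τ ≠ 0 → ∀ v ∉ R, σ v = τ v := by
    intro σ τ hne v hv
    by_contra hcon
    exact hne (by rw [invAd_apply, apply_eq_zero_of_mem hA hv hcon, zero_div])
  -- The `n`-th off-diagonal in the order of the energies. Within it, a row `σ` fixes the rank of
  -- `τ`, hence `τ` on `R`; outside `R` the two agree because `A` is supported in `R`.
  let Bp : ℕ → Op Λ := fun n => Matrix.of fun σ τ =>
    if levelRank E σ = levelRank E τ + n then invAd E A σ τ else 0
  let Bm : ℕ → Op Λ := fun n => Matrix.of fun σ τ =>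
    if levelRank E τ = levelRank E σ + n then invAd E A σ τ else 0
  have hext : ∀ σ τ : Λ → Bool, levelRank E σ = levelRank E τ → (∀ v ∉ R, σ v = τ v) → σ = τ := by
    intro σ τ h h'
    funext v
    by_cases hv : v ∈ R
    · exact levelRank_injective hg hE h v hv
    · exact h' v hv
  have hentry : ∀ (σ τ : Λ → Bool) (n : ℕ), 0 < n → g * n ≤ |E σ - E τ| →
      ‖invAd E A σ τ‖ ≤ ‖A‖ / g * (n : ℝ)⁻¹ := by
    intro σ τ n hn h
    have hn' : (0 : ℝ) < n := by exact_mod_cast hn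
    rw [invAd_apply, norm_div, Complex.norm_real, Real.norm_eq_abs, div_mul_eq_mul_div,
      ← div_eq_mul_inv, div_div, mul_comm (n : ℝ) g]
    exact div_le_div₀ (norm_nonneg _) (norm_apply_le A σ τ) (by positivity) h
  have hBp : ∀ n ∈ Finset.Ico 1 (2 ^ R.card), ‖Bp n‖ ≤ ‖A‖ / g * (n : ℝ)⁻¹ := by
    intro n hn
    have hn1 := (Finset.mem_Ico.1 hn).1
    refine norm_le_of_sparse (by positivity) ?_ ?_ ?_
    · intro σ τ
      simp only [Bp, Matrix.of_apply]
      split_ifs with h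
      · exact hentry σ τ n hn1 ((mul_levelRank_sub_le hg hR hE h hn1).trans (le_abs_self _))
      · simp; positivity
    · intro σ τ τ' h1 h2
      simp only [Bp, Matrix.of_apply, ne_eq, ite_eq_right_iff, Classical.not_imp] at h1 h2
      refine hext τ τ' (by omega) fun v hv => ?_
      rw [← hoff _ _ h1.2 v hv, hoff _ _ h2.2 v hv]
    · intro σ σ' τ h1 h2
      simp only [Bp, Matrix.of_apply, ne_eq, ite_eq_right_iff, Classical.not_imp] at h1 h2
      refine hext σ σ' (by omega) fun v hv => ?_
      rw [hoff _ _ h1.2 v hv, ← hoff _ _ h2.2 v hv]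
  have hBm : ∀ n ∈ Finset.Ico 1 (2 ^ R.card), ‖Bm n‖ ≤ ‖A‖ / g * (n : ℝ)⁻¹ := by
    intro n hn
    have hn1 := (Finset.mem_Ico.1 hn).1
    refine norm_le_of_sparse (by positivity) ?_ ?_ ?_
    · intro σ τ
      simp only [Bm, Matrix.of_apply]
      split_ifs with h
      · refine hentry σ τ n hn1 ((mul_levelRank_sub_le hg hR hE h hn1).trans ?_)
        rw [abs_sub_comm]
        exact le_abs_self _
      · simp; positivity
    · intro σ τ τ' h1 h2
      simp only [Bm, Matrix.of_apply, ne_eq, ite_eq_right_iff, Classical.not_imp] at h1 h2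
      refine hext τ τ' (by omega) fun v hv => ?_
      rw [← hoff _ _ h1.2 v hv, hoff _ _ h2.2 v hv]
    · intro σ σ' τ h1 h2
      simp only [Bm, Matrix.of_apply, ne_eq, ite_eq_right_iff, Classical.not_imp] at h1 h2
      refine hext σ σ' (by omega) fun v hv => ?_
      rw [hoff _ _ h1.2 v hv, ← hoff _ _ h2.2 v hv]
  have hdec : invAd E A = ∑ n ∈ Finset.Ico (1 : ℕ) (2 ^ R.card), (Bp n + Bm n) := by
    ext σ τ
    rw [Matrix.sum_apply]
    simp only [Matrix.add_apply, Bp, Bm, Matrix.of_apply]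
    rcases lt_trichotomy (levelRank E σ) (levelRank E τ) with h | h | h
    · rw [Finset.sum_eq_single (levelRank E τ - levelRank E σ)]
      · rw [if_neg (by omega), if_pos (by omega), zero_add]
      · intro n _ hn
        rw [if_neg (by omega), if_neg (by omega), zero_add]
      · intro hn
        exact absurd (Finset.mem_Ico.2 ⟨by omega, by have := hrk τ; omega⟩) hn
    · rw [Finset.sum_eq_zero]
      · have : E σ = E τ := hR σ τ (levelRank_injective hg hE h)
        rw [invAd_apply, this, sub_self]
        simp
      · intro n hn
        have hn1 := (Finset.mem_Ico.1 hn).1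
        rw [if_neg (by omega), if_neg (by omega), zero_add]
    · rw [Finset.sum_eq_single (levelRank E σ - levelRank E τ)]
      · rw [if_pos (by omega), if_neg (by omega), add_zero]
      · intro n _ hn
        rw [if_neg (by omega), if_neg (by omega), zero_add]
      · intro hn
        exact absurd (Finset.mem_Ico.2 ⟨by omega, by have := hrk σ; omega⟩) hn
  rw [hdec]
  calc _ ≤ ∑ n ∈ Finset.Ico (1 : ℕ) (2 ^ R.card), 2 * (‖A‖ / g) * (n : ℝ)⁻¹ := by
        refine norm_sum_le_of_le _ fun n hn => (norm_add_le _ _).trans ?_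
        linarith [hBp n hn, hBm n hn]
    _ = 2 * (‖A‖ / g) * ∑ n ∈ Finset.Ico (1 : ℕ) (2 ^ R.card), (n : ℝ)⁻¹ := by rw [Finset.mul_sum]
    _ ≤ 2 * (‖A‖ / g) * R.card := by
        gcongr
        exact sum_Ico_one_two_pow_inv_le _
    _ = _ := by ring

/-- Off-diagonal part: the commutator with the diagonal operator undoes the division. -/
theorem lie_invAd (hg : 0 < g)
    (hE : ∀ σ τ : Λ → Bool, (∃ v ∈ R, σ v ≠ τ v) → g ≤ |E σ - E τ|)
    {A : Op Λ} (hA : A ∈ suppAlg R) :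
    ⁅(Matrix.diagonal fun σ => (E σ : ℂ) : Op Λ), invAd E A⁆ = A - diagPart A := by
  ext σ τ
  rw [Ring.lie_def, Matrix.sub_apply, Matrix.diagonal_mul, Matrix.mul_diagonal, Matrix.sub_apply,
    diagPart_apply, invAd_apply]
  by_cases h : σ = τ
  · subst h; simp
  · rw [Matrix.diagonal_apply_ne _ h, sub_zero]
    by_cases hoff : ∃ v, v ∉ R ∧ σ v ≠ τ v
    · obtain ⟨v, hv, hne⟩ := hoff
      rw [apply_eq_zero_of_mem hA hv hne]; simp
    · push Not at hoff
      have hne : ∃ v ∈ R, σ v ≠ τ v := by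
        by_contra hcon
        push Not at hcon
        exact h (funext fun v => if hv : v ∈ R then hcon v hv else hoff v hv)
      have h2 := hE σ τ hne
      have h3 : ((E σ - E τ : ℝ) : ℂ) ≠ 0 := by
        intro h0
        rw [Complex.ofReal_eq_zero] at h0
        rw [h0, abs_zero] at h2
        linarith
      rw [mul_comm (A σ τ / _), ← sub_mul, ← Complex.ofReal_sub]
      field_simp

/-- Makes the generators skew-adjoint, so that their exponentials are unitary. -/
theorem invAd_star (E : (Λ → Bool) → ℝ) (A : Op Λ) : invAd E (star A) = -star (invAd E A) := by
  ext σ τ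
  rw [Matrix.neg_apply, invAd_apply, Matrix.star_apply, Matrix.star_apply, invAd_apply, star_div₀,
    ← neg_sub (E τ), Complex.ofReal_neg, div_neg]
  simp

end Schur

/-! ### Local operators -/

section LieRules

variable {Λ : Type*} [Fintype Λ] [LinearOrder Λ]

theorem op_lie_swap (A B : Op Λ) : -⁅B, A⁆ = ⁅A, B⁆ := by
  rw [Ring.lie_def, Ring.lie_def]; abel

theorem op_zero_lie (A : Op Λ) : ⁅(0 : Op Λ), A⁆ = 0 := by
  rw [Ring.lie_def]; simp

theorem op_lie_zero (A : Op Λ) : ⁅A, (0 : Op Λ)⁆ = 0 := by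
  rw [Ring.lie_def]; simp

theorem op_lie_neg (A B : Op Λ) : ⁅A, -B⁆ = -⁅A, B⁆ := by
  rw [Ring.lie_def, Ring.lie_def, mul_neg, neg_mul]; abel

end LieRules

section Locality

variable {Λ : Type*} [Fintype Λ] [LinearOrder Λ] {G : SimpleGraph Λ}

theorem graphDiam_le_iff {S : Finset Λ} {q : ℕ} :
    graphDiam G S ≤ q ↔ ∀ u ∈ S, ∀ v ∈ S, G.dist u v ≤ q := by
  simp [graphDiam, Finset.sup_le_iff]

/-- The span of the operators supported in subsets of `R` of diameter at most `q`. -/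
noncomputable def locOps (G : SimpleGraph Λ) (R : Finset Λ) (q : ℕ) : Submodule ℂ (Op Λ) :=
  Submodule.span ℂ {A | ∃ S ⊆ R, graphDiam G S ≤ q ∧ A ∈ suppAlg S}

theorem mem_locOps {R S : Finset Λ} {q : ℕ} {A : Op Λ} (hS : S ⊆ R) (hq : graphDiam G S ≤ q)
    (hA : A ∈ suppAlg S) : A ∈ locOps G R q :=
  Submodule.subset_span ⟨S, hS, hq, hA⟩

theorem locOps_mono (R : Finset Λ) {q q' : ℕ} (h : q ≤ q') : locOps G R q ≤ locOps G R q' :=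
  Submodule.span_mono fun _ ⟨S, hS, hq, hA⟩ => ⟨S, hS, hq.trans h, hA⟩

theorem locOps_le_suppAlg (R : Finset Λ) (q : ℕ) :
    locOps G R q ≤ Subalgebra.toSubmodule (suppAlg R) :=
  Submodule.span_le.2 fun _ ⟨_, hS, _, hA⟩ => suppAlg_mono hS hA

/-- A linear map between local operators can be checked on the operators with small support. -/
theorem map_mem_of_mem_locOps {R : Finset Λ} {q : ℕ} {P : Submodule ℂ (Op Λ)}
    (T : Op Λ →L[ℂ] Op Λ)
    (hT : ∀ S ⊆ R, graphDiam G S ≤ q → ∀ A ∈ suppAlg S, T A ∈ P) {A : Op Λ}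
    (hA : A ∈ locOps G R q) : T A ∈ P := by
  have : locOps G R q ≤ P.comap T.toLinearMap :=
    Submodule.span_le.2 fun A ⟨S, hS, hq, hA⟩ => hT S hS hq A hA
  exact this hA

theorem diagPart_mem_locOps {R : Finset Λ} {q : ℕ} {A : Op Λ} (hA : A ∈ locOps G R q) :
    diagPart A ∈ locOps G R q :=
  map_mem_of_mem_locOps diagPart
    (fun _ hS hq _ hA => mem_locOps hS hq (diagPart_mem_suppAlg hA)) hA

theorem lie_mem_locOps (hG : G.Connected) {R : Finset Λ} {q q' : ℕ} {A B : Op Λ}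
    (hA : A ∈ locOps G R q) (hB : B ∈ locOps G R q') : ⁅A, B⁆ ∈ locOps G R (q + q') := by
  rw [← adR_apply]
  refine map_mem_of_mem_locOps (adR B) (fun S hS hq A hA => ?_) hA
  have e : ∀ B : Op Λ, adR B A = (-adR A) B := by
    intro B; rw [adR_apply, _root_.neg_apply, adR_apply, op_lie_swap]
  rw [e]
  refine map_mem_of_mem_locOps (-adR A) (fun S' hS' hq' B hB => ?_) hB
  rw [← e, adR_apply]
  by_cases hd : Disjoint S S'
  · rw [lie_eq_zero_of_commute (commute_of_disjoint hd hA hB)]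
    exact zero_mem _
  · obtain ⟨w, hw, hw'⟩ := Finset.not_disjoint_iff.1 hd
    refine mem_locOps (S := S ∪ S') (Finset.union_subset hS hS') ?_ ?_
    · rw [graphDiam_le_iff] at hq hq' ⊢
      have key : ∀ u ∈ S, ∀ v ∈ S', G.dist u v ≤ q + q' := fun u hu v hv =>
        (hG.dist_triangle (v := w)).trans (add_le_add (hq u hu w hw) (hq' w hw' v hv))
      intro u hu v hv
      rcases Finset.mem_union.1 hu with hu | hu <;> rcases Finset.mem_union.1 hv with hv | hv
      · exact (hq u hu v hv).trans (Nat.le_add_right _ _)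
      · exact key u hu v hv
      · rw [G.dist_comm]; exact key v hv u hu
      · exact (hq' u hu v hv).trans (Nat.le_add_left _ _)
    · have h1 := suppAlg_mono (Finset.subset_union_left (s₂ := S')) hA
      have h2 := suppAlg_mono (Finset.subset_union_right (s₁ := S)) hB
      rw [Ring.lie_def]
      exact sub_mem (mul_mem h1 h2) (mul_mem h2 h1)

open scoped Classical in
/-- The set `Q` and the points of `R` at distance at most `j` from `Q ∩ R`. -/
noncomputable def spread (G : SimpleGraph Λ) (R Q : Finset Λ) (j : ℕ) : Finset Λ :=
  Q ∪ R.filter fun v => ∃ u ∈ Q, u ∈ R ∧ G.dist u v ≤ j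

theorem mem_spread {R Q : Finset Λ} {j : ℕ} {v : Λ} :
    v ∈ spread G R Q j ↔ v ∈ Q ∨ v ∈ R ∧ ∃ u ∈ Q, u ∈ R ∧ G.dist u v ≤ j := by
  classical
  simp [spread]

theorem spread_mono (R Q : Finset Λ) {i j : ℕ} (h : i ≤ j) :
    spread G R Q i ⊆ spread G R Q j := by
  intro v hv
  rw [mem_spread] at hv ⊢
  rcases hv with hv | ⟨hv, u, hu, huR, hd⟩
  · exact Or.inl hv
  · exact Or.inr ⟨hv, u, hu, huR, hd.trans h⟩

/-- The support of `A` grows only through `B`, which lives in `R`; so it grows only inside `R`,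
starting from `Q ∩ R`. Vertices of `Q` outside `R` cause no spreading. -/
theorem lie_mem_spread (hG : G.Connected) {R Q : Finset Λ} {i j : ℕ} {A B : Op Λ}
    (hA : A ∈ suppAlg (spread G R Q i)) (hB : B ∈ locOps G R j) :
    ⁅A, B⁆ ∈ suppAlg (spread G R Q (i + j)) := by
  have e : ∀ B : Op Λ, ⁅A, B⁆ = (-adR A) B := by
    intro B; rw [_root_.neg_apply, adR_apply, op_lie_swap]
  rw [e]
  refine map_mem_of_mem_locOps (P := Subalgebra.toSubmodule (suppAlg (spread G R Q (i + j)))) (-adR A)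
    (fun S hS hq B hB => ?_) hB
  rw [← e]
  by_cases hd : Disjoint (spread G R Q i) S
  · rw [lie_eq_zero_of_commute (commute_of_disjoint hd hA hB)]
    exact zero_mem _
  · obtain ⟨w, hw, hw'⟩ := Finset.not_disjoint_iff.1 hd
    have h1 := suppAlg_mono (spread_mono (G := G) R Q (Nat.le_add_right i j)) hA
    have h2 : B ∈ suppAlg (spread G R Q (i + j)) := by
      refine suppAlg_mono (fun v hv => ?_) hB
      have hwv := graphDiam_le_iff.1 hq w hw' v hv
      rw [mem_spread] at hw ⊢
      refine Or.inr ⟨hS hv, ?_⟩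
      rcases hw with hw | ⟨hw, u, hu, huR, hud⟩
      · exact ⟨w, hw, hS hw', hwv.trans (Nat.le_add_left _ _)⟩
      · exact ⟨u, hu, huR, (hG.dist_triangle (v := w)).trans (add_le_add hud hwv)⟩
    rw [Ring.lie_def, Subalgebra.mem_toSubmodule]
    exact sub_mem (mul_mem h1 h2) (mul_mem h2 h1)

theorem energy_congr (J : Finset Λ → ℝ) {R : Finset Λ} {σ τ : Λ → Bool}
    (h : ∀ v ∈ R, σ v = τ v) : energy J R σ = energy J R τ := by
  refine Finset.sum_congr rfl fun I hI => ?_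
  congr 1
  exact Finset.prod_congr rfl fun v hv => by rw [h v (Finset.mem_powerset.1 hI hv)]

/-- For `A` supported in `S`, only configurations agreeing off `S` matter. Their energy difference
involves only the classical terms that meet `S`, hence only spins within distance `k` of `S`; this
adds `2k` to the diameter. -/
theorem invAd_mem_locOps (hG : G.Connected) {J : Finset Λ → ℝ} {k : ℕ}
    (hJ : ∀ I, J I ≠ 0 → graphDiam G I ≤ k) {R : Finset Λ} {q : ℕ} {A : Op Λ}
    (hA : A ∈ locOps G R q) : invAd (energy J R) A ∈ locOps G R (q + 2 * k) := by
  classical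
  refine map_mem_of_mem_locOps _ (fun S hS hq A hA => ?_) hA
  have hSk : S ⊆ R.filter fun v => ∃ u ∈ S, G.dist u v ≤ k := fun v hv =>
    Finset.mem_filter.2 ⟨hS hv, v, hv, by simp⟩
  refine mem_locOps (S := R.filter fun v => ∃ u ∈ S, G.dist u v ≤ k)
    (Finset.filter_subset _ _) ?_ ?_
  · rw [graphDiam_le_iff] at hq ⊢
    intro u hu v hv
    obtain ⟨-, u', hu', h1⟩ := Finset.mem_filter.1 hu
    obtain ⟨-, v', hv', h2⟩ := Finset.mem_filter.1 hv
    have h3 := hq u' hu' v' hv'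
    have h4 := hG.dist_triangle (u := u) (v := u') (w := v)
    have h5 := hG.dist_triangle (u := u') (v := v') (w := v)
    rw [G.dist_comm] at h1
    omega
  · refine mem_suppAlg_iff.2 fun v hv => ⟨fun σ τ hne => ?_, fun σ τ => ?_⟩
    · rw [invAd_apply, apply_eq_zero_of_mem hA (fun h => hv (hSk h)) hne, zero_div]
    · rw [invAd_apply, invAd_apply, (mem_suppAlg_iff.1 hA v fun h => hv (hSk h)).2]
      by_cases h0 : A σ τ = 0
      · simp [h0]
      · have hoff : ∀ w, w ∉ S → σ w = τ w := by
          intro w hw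
          by_contra hne
          exact h0 (apply_eq_zero_of_mem hA hw hne)
        congr 2
        rw [energy, energy, energy, energy, ← Finset.sum_sub_distrib, ← Finset.sum_sub_distrib]
        refine Finset.sum_congr rfl fun I hI => ?_
        by_cases hvI : v ∈ I
        · by_cases hJI : J I = 0
          · simp [hJI]
          have hdis : ∀ w ∈ I, w ∉ S := by
            intro w hw hwS
            refine hv (Finset.mem_filter.2 ⟨Finset.mem_powerset.1 hI hvI, w, hwS, ?_⟩)
            exact graphDiam_le_iff.1 (hJ I hJI) w hw v hvI
          have e1 : ∏ w ∈ I, spin (σ w) = ∏ w ∈ I, spin (τ w) :=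
            Finset.prod_congr rfl fun w hw => by rw [hoff w (hdis w hw)]
          have e2 : ∏ w ∈ I, spin (flipAt v σ w) = ∏ w ∈ I, spin (flipAt v τ w) := by
            refine Finset.prod_congr rfl fun w hw => ?_
            by_cases hwv : w = v
            · subst hwv; rw [flipAt_self, flipAt_self, hoff w (hdis w hw)]
            · rw [flipAt_of_ne hwv, flipAt_of_ne hwv, hoff w (hdis w hw)]
          rw [e1, e2, sub_self, sub_self]
        · have e : ∀ σ : Λ → Bool, ∏ w ∈ I, spin (flipAt v σ w) = ∏ w ∈ I, spin (σ w) := by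
            intro σ
            refine Finset.prod_congr rfl fun w hw => ?_
            rw [flipAt_of_ne]
            rintro rfl
            exact hvI hw
          rw [e, e]

/-! ### Diagonalization in a non-resonant region -/

/-- The filtration with the orders below `n` removed. -/
def fromOrder (n : ℕ) (F : ℕ → Submodule ℂ (Op Λ)) (m : ℕ) : Submodule ℂ (Op Λ) :=
  if n ≤ m then F m else ⊥

theorem fromOrder_anti {n n' : ℕ} (h : n ≤ n') (F : ℕ → Submodule ℂ (Op Λ)) (m : ℕ) :
    fromOrder n' F m ≤ fromOrder n F m := by
  unfold fromOrder
  split_ifs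
  · exact le_rfl
  · omega
  · exact bot_le
  · exact le_rfl

theorem mem_fromOrder {n m : ℕ} {F : ℕ → Submodule ℂ (Op Λ)} {A : Op Λ}
    (hA : A ∈ fromOrder n F m) : A = 0 ∨ n ≤ m ∧ A ∈ F m := by
  unfold fromOrder at hA
  split_ifs at hA with h
  · exact Or.inr ⟨h, hA⟩
  · exact Or.inl ((Submodule.mem_bot ℂ).1 hA)

/-- The locality of the terms of order `m` of the Hamiltonian. -/
noncomputable def hamLoc (G : SimpleGraph Λ) (k : ℕ) (R : Finset Λ) (m : ℕ) :
    Submodule ℂ (Op Λ) := locOps G R ((2 * k + 1) * m - 2 * k)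

/-- The locality of the terms of order `m` of the generators. -/
noncomputable def genLoc (G : SimpleGraph Λ) (k : ℕ) (R : Finset Λ) (m : ℕ) :
    Submodule ℂ (Op Λ) := locOps G R ((2 * k + 1) * m)

/-- The locality of the terms of order `m` of a rotated operator that is supported in `Q`. -/
noncomputable def obsLoc (G : SimpleGraph Λ) (k : ℕ) (R Q : Finset Λ) (m : ℕ) :
    Submodule ℂ (Op Λ) := Subalgebra.toSubmodule (suppAlg (spread G R Q ((2 * k + 1) * m)))

theorem hamLoc_mono (k : ℕ) (R : Finset Λ) : Monotone (hamLoc G k R) := fun _ _ h =>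
  locOps_mono R (Nat.sub_le_sub_right (Nat.mul_le_mul_left _ h) _)

theorem fromOrder_mono (n : ℕ) {F : ℕ → Submodule ℂ (Op Λ)} (hF : Monotone F) :
    Monotone (fromOrder n F) := by
  intro i j h
  unfold fromOrder
  split_ifs
  · exact hF h
  · omega
  · exact bot_le
  · exact le_rfl

theorem obsLoc_mono (k : ℕ) (R Q : Finset Λ) : Monotone (obsLoc G k R Q) := fun _ _ h =>
  suppAlg_mono (spread_mono R Q (Nat.mul_le_mul_left _ h))

/-- The diameters `(2k+1)m - 2k` for Hamiltonians and `(2k+1)m` for generators are consistent: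
division by energies adds `2k`, commutators add diameters. Orders `i ≥ 1` are needed because the
natural subtraction is not additive at order `0`. -/
theorem lie_ham_gen (hG : G.Connected) {k n : ℕ} {R : Finset Λ} {i j : ℕ} {A X : Op Λ}
    (hA : A ∈ fromOrder 1 (hamLoc G k R) i) (hX : X ∈ fromOrder n (genLoc G k R) j) :
    ⁅A, X⁆ ∈ fromOrder (n + 1) (hamLoc G k R) (i + j) := by
  rcases mem_fromOrder hA with rfl | ⟨hi, hA⟩
  · rw [op_zero_lie]; exact zero_mem _
  rcases mem_fromOrder hX with rfl | ⟨hj, hX⟩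
  · rw [op_lie_zero]; exact zero_mem _
  rw [fromOrder, if_pos (by omega)]
  have h := lie_mem_locOps hG hA hX
  refine locOps_mono R (le_of_eq ?_) h
  have : 2 * k ≤ (2 * k + 1) * i := by nlinarith
  rw [mul_add]
  omega

theorem lie_obs_gen (hG : G.Connected) {k n : ℕ} {R Q : Finset Λ} {i j : ℕ} {A X : Op Λ}
    (hA : A ∈ obsLoc G k R Q i) (hX : X ∈ fromOrder n (genLoc G k R) j) :
    ⁅A, X⁆ ∈ obsLoc G k R Q (i + j) := by
  rcases mem_fromOrder hX with rfl | ⟨hj, hX⟩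
  · rw [op_lie_zero]; exact zero_mem _
  rw [obsLoc, mul_add]
  exact lie_mem_spread hG hA hX

/-- The energy operator `H_0|_R`. -/
noncomputable def energyOp (J : Finset Λ → ℝ) (R : Finset Λ) : Op Λ :=
  Matrix.diagonal fun σ => (energy J R σ : ℂ)

theorem isSelfAdjoint_energyOp (J : Finset Λ → ℝ) (R : Finset Λ) :
    IsSelfAdjoint (energyOp J R) := by
  rw [IsSelfAdjoint, energyOp, Matrix.star_eq_conjTranspose, Matrix.diagonal_conjTranspose]
  congr 1
  funext σ
  simp

/-- `n` steps of the iterative diagonalization. -/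
theorem exists_rotation (hG : G.Connected) {J : Finset Λ → ℝ} {k : ℕ}
    (hJ : ∀ I, J I ≠ 0 → graphDiam G I ≤ k) {R : Finset Λ} {g y v : ℝ} (hg : 0 < g)
    (hgap : HasGap J R g) (hy : 1 ≤ y) {V : Op Λ} (hVs : IsSelfAdjoint V)
    (hV : Dec (fromOrder 1 (hamLoc G k R)) y V v) (hv : 80 * R.card * v ≤ g) (n : ℕ) :
    ∃ U D W : Op Λ, U ∈ unitary (Op Λ) ∧ U ∈ suppAlg R ∧
      star U * (energyOp J R + V) * U = energyOp J R + D + W ∧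
      diagPart D = D ∧ IsSelfAdjoint D ∧ IsSelfAdjoint W ∧
      Dec (fromOrder 1 (hamLoc G k R)) y D (2 * v * (1 - (1 / 2) ^ n)) ∧
      Dec (fromOrder (n + 1) (hamLoc G k R)) y W (v * (1 / 2) ^ n) ∧
      ∀ (Q : Finset Λ) (O : Op Λ), O ∈ suppAlg Q →
        Dec (obsLoc G k R Q) y (star U * O * U)
          (Real.exp (8 * R.card / g * v * (1 - (1 / 2) ^ n)) * ‖O‖) := by
  have hv0 : 0 ≤ v := hV.nonneg hy
  induction n with
  | zero =>
    refine ⟨1, 0, V, one_mem _, one_mem _, by simp, by simp, IsSelfAdjoint.zero _, hVs,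
      Dec.zero (by simp), by simpa using hV, fun Q O hO => ?_⟩
    have hm : star (1 : Op Λ) * O * 1 ∈ obsLoc G k R Q 0 := by
      rw [star_one, one_mul, mul_one]
      refine suppAlg_mono (fun u hu => ?_) hO
      exact mem_spread.2 (Or.inl hu)
    simpa using Dec.of_mem (y := y) hm
  | succ n ih =>
    obtain ⟨U, D, W, hU, hUR, hUH, hDd, hDs, hWs, hD, hW, hobs⟩ := ih
    set w := v * (1 / 2 : ℝ) ^ n with hw
    have hw0 : 0 ≤ w := by positivity
    have hp1 : (1 / 2 : ℝ) ^ n ≤ 1 := pow_le_one₀ (by norm_num) (by norm_num)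
    have hp0 : (0 : ℝ) < (1 / 2 : ℝ) ^ n := by positivity
    have hwv : w ≤ v := mul_le_of_le_one_right hv0 hp1
    have hloc : ∀ m, fromOrder (n + 1) (hamLoc G k R) m ≤ Subalgebra.toSubmodule (suppAlg R) := by
      intro m
      unfold fromOrder
      split_ifs
      · exact locOps_le_suppAlg _ _
      · exact bot_le
    have hWR : W ∈ suppAlg R := by
      obtain ⟨ι, m, a, h1, h2, h3, h4⟩ := hW
      exact (isClosed_submodule (Subalgebra.toSubmodule (suppAlg R))).mem_of_tendsto h4
        (Filter.Eventually.of_forall fun s => Submodule.sum_mem _ fun i _ => hloc _ (h1 i))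
    -- The solution of `[H0, X] = -(W - diagPart W)`: conjugation by `exp X` cancels the
    -- off-diagonal part of `W` to first order.
    set X : Op Λ := -invAd (energy J R) W with hX
    have hRE : ∀ σ τ : Λ → Bool, (∀ v ∈ R, σ v = τ v) → energy J R σ = energy J R τ :=
      fun σ τ h => energy_congr J h
    set s := 2 * R.card / g * w with hs
    have hs0 : 0 ≤ s := by positivity
    have hXdec : Dec (fromOrder (n + 1) (genLoc G k R)) y X s := by
      have := hW.map (F' := fromOrder (n + 1) (genLoc G k R)) (by linarith)
        (-invAd (energy J R)) (c := 2 * R.card / g) (by positivity) (fun m x hx => by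
          have hxR : x ∈ suppAlg R := hloc m hx
          rw [neg_apply, norm_neg]
          refine ⟨?_, norm_invAd_le hg hRE hgap hxR⟩
          rcases mem_fromOrder hx with rfl | ⟨hm, hx⟩
          · simp
          · rw [fromOrder, if_pos hm]
            refine neg_mem (locOps_mono R (le_of_eq ?_) (invAd_mem_locOps hG hJ hx))
            have : 2 * k ≤ (2 * k + 1) * m := by nlinarith
            omega)
      simpa [hX, hs] using this
    have hXstar : star X = -X := by
      have h := invAd_star (energy J R) W
      rw [hWs.star_eq] at h
      rw [hX, neg_neg, star_neg, ← h]
    set T := NormedSpace.exp X with hT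
    have hTstar : star T = NormedSpace.exp (-X) := by
      rw [hT, NormedSpace.star_exp, hXstar]
    have hTU : T ∈ unitary (Op Λ) := by
      let +nondep : NormedAlgebra ℚ (Op Λ) := .restrictScalars ℚ ℂ _
      exact NormedSpace.exp_mem_unitary_of_mem_skewAdjoint hXstar
    have hXR : X ∈ suppAlg R := by
      refine neg_mem ?_
      have : W ∈ locOps G R (R.sup fun x => R.sup fun y => G.dist x y) :=
        mem_locOps subset_rfl le_rfl hWR
      exact locOps_le_suppAlg _ _ (invAd_mem_locOps hG hJ this)
    have hTR : T ∈ suppAlg R := exp_mem_suppAlg hXR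
    set H0 := energyOp J R with hH0
    set A0 : Op Λ := -(W - diagPart W) with hA0
    have hlie : ⁅H0, X⁆ = A0 := by
      rw [hX, op_lie_neg, hH0, energyOp, lie_invAd hg hgap hWR]
    have hdW : Dec (fromOrder (n + 1) (hamLoc G k R)) y (diagPart W) w := by
      have := hW.map (F' := fromOrder (n + 1) (hamLoc G k R)) (by linarith) diagPart (c := 1)
        zero_le_one (fun m x hx => by
          refine ⟨?_, by rw [one_mul]; exact norm_diagPart_le x⟩
          rcases mem_fromOrder hx with rfl | ⟨hm, hx⟩
          · simp
          · rw [fromOrder, if_pos hm]; exact diagPart_mem_locOps hx)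
      simpa using this
    have hnegW : Dec (fromOrder (n + 1) (hamLoc G k R)) y (-W) w := by
      have := hW.map (F' := fromOrder (n + 1) (hamLoc G k R)) (by linarith)
        (-ContinuousLinearMap.id ℂ _) (c := 1) zero_le_one
        (fun m x hx => ⟨by simpa using hx, by simp⟩)
      simpa using this
    have h1n : ∀ m, fromOrder (n + 1) (hamLoc G k R) m ≤ fromOrder 1 (hamLoc G k R) m :=
      fromOrder_anti (by omega) _
    have h2n : ∀ m, fromOrder (n + 1 + 1) (hamLoc G k R) m ≤ fromOrder 1 (hamLoc G k R) m :=
      fromOrder_anti (by omega) _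
    have hA0dec : Dec (fromOrder 1 (hamLoc G k R)) y A0 (w + w) := by
      have e : A0 = -W + diagPart W := by rw [hA0]; abel
      rw [e]
      exact (hnegW.add hdW).mono_left h1n
    have hbr : ∀ i j, ∀ a ∈ fromOrder 1 (hamLoc G k R) i, ∀ x ∈ fromOrder (n + 1) (genLoc G k R) j,
        ⁅a, x⁆ ∈ fromOrder (n + 1 + 1) (hamLoc G k R) (i + j) :=
      fun i j a ha x hx => lie_ham_gen hG ha hx
    -- All three remainders contain a commutator of `X` (order at least `n + 1`) with a term of
    -- order at least one, so the new error starts at order `n + 2`.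
    have r1 := hD.conj_exp_sub hy hXdec hbr h2n
    have r2 := (hW.mono_left h1n).conj_exp_sub hy hXdec hbr h2n
    have r3 := hA0dec.conj_exp_sub_sub hy hXdec hbr h2n hlie
    set W' : Op Λ := (NormedSpace.exp (-X) * D * T - D) + (NormedSpace.exp (-X) * W * T - W) +
      (NormedSpace.exp (-X) * H0 * T - H0 - A0) with hW'
    have hW'dec := (r1.add r2).add r3
    rw [← hT, ← hW'] at hW'dec
    have hnew : star T * (H0 + D + W) * T = H0 + (D + diagPart W) + W' := by
      rw [hTstar, hW', hA0]
      simp only [mul_add, add_mul]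
      abel
    have hDs' : IsSelfAdjoint (D + diagPart W) := by
      refine hDs.add ?_
      rw [IsSelfAdjoint, ← diagPart_star, hWs.star_eq]
    have hsmall : 40 * (2 * R.card / g) * v ≤ 1 := by
      rw [← mul_div_assoc, div_mul_eq_mul_div, div_le_one hg]
      linarith
    refine ⟨U * T, D + diagPart W, W', mul_mem hU hTU, mul_mem hUR hTR, ?_, ?_, hDs', ?_, ?_, ?_,
      ?_⟩
    · rw [star_mul, ← hnew, ← hUH]
      noncomm_ring
    · rw [map_add, hDd, diagPart_diagPart]
    · have e : W' = star T * (H0 + D + W) * T - H0 - (D + diagPart W) := by rw [hnew]; abel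
      rw [e]
      have hH0s : IsSelfAdjoint H0 := isSelfAdjoint_energyOp J R
      exact ((((hH0s.add hDs).add hWs).conjugate' T).sub hH0s).sub hDs'
    · refine (hD.add (hdW.mono_left h1n)).mono (le_of_eq ?_)
      rw [hw, pow_succ]; ring
    · refine hW'dec.mono ?_
      have hx : 2 * s ≤ 1 / 20 := by
        have : s ≤ 2 * R.card / g * v := by rw [hs]; gcongr
        linarith
      have hexp : Real.exp (2 * s) - 1 ≤ 2 * (2 * s) := by
        have := Real.abs_exp_sub_one_le (x := 2 * s) (by rw [abs_of_nonneg (by linarith)]; linarith)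
        rw [abs_of_nonneg (by linarith : 0 ≤ 2 * s)] at this
        exact (le_abs_self _).trans this
      have hexp0 : 0 ≤ Real.exp (2 * s) - 1 := by
        have := Real.add_one_le_exp (2 * s); linarith
      have hd : 2 * v * (1 - (1 / 2) ^ n) ≤ 2 * v := by
        refine mul_le_of_le_one_right (by linarith) (by linarith)
      -- The last bracket is at most `5v` and `exp(2s) - 1 ≤ 4s`. With `s = 2|R|w/g`, halving the
      -- error requires `40 * (2|R|/g) * v ≤ 1`: this is the constant `80`.
      calc _ = (Real.exp (2 * s) - 1) * (2 * v * (1 - (1 / 2) ^ n) + w + (w + w)) := by ring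
        _ ≤ (2 * (2 * s)) * (2 * v + v + (v + v)) := by
            refine mul_le_mul hexp (by linarith) (add_nonneg (add_nonneg (mul_nonneg (by linarith)
              (by linarith)) hw0) (by linarith)) (by linarith)
        _ = 20 * (2 * R.card / g) * v * w := by rw [hs]; ring
        _ ≤ 1 / 2 * w := by
            refine mul_le_mul_of_nonneg_right ?_ hw0
            linarith
        _ = v * (1 / 2) ^ (n + 1) := by rw [hw, pow_succ]; ring
    · intro Q O hO
      have := (hobs Q O hO).conj_exp hy hXdec (fun i j a ha x hx => lie_obs_gen hG ha hx)
      rw [← hT] at this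
      have e : star (U * T) * O * (U * T) = NormedSpace.exp (-X) * (star U * O * U) * T := by
        rw [star_mul, hTstar]; noncomm_ring
      rw [e]
      refine this.mono (le_of_eq ?_)
      rw [← mul_assoc, ← Real.exp_add]
      congr 2
      rw [hs, hw, pow_succ]
      ring

end Locality

/-! ### Averaging over the qubits of a set -/

section Averaging

variable {Λ : Type*} [Fintype Λ] [LinearOrder Λ]

theorem pauliZ_mem_suppAlg (I : Finset Λ) : pauliZ I ∈ suppAlg I := by
  refine mem_suppAlg_iff.2 fun v hv => ⟨fun σ τ hne => ?_, fun σ τ => ?_⟩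
  · rw [pauliZ, Matrix.diagonal_apply_ne]
    exact fun h => hne (congrFun h v)
  · by_cases h : σ = τ
    · subst h
      rw [pauliZ, Matrix.diagonal_apply_eq, Matrix.diagonal_apply_eq]
      congr 1
      refine Finset.prod_congr rfl fun w hw => ?_
      rw [flipAt_of_ne (by rintro rfl; exact hv hw)]
    · have h' : flipAt v σ ≠ flipAt v τ := fun e => h (by
        rw [← flipAt_flipAt v σ, e, flipAt_flipAt])
      rw [pauliZ, Matrix.diagonal_apply_ne _ h, Matrix.diagonal_apply_ne _ h']

theorem diagPart_pauliZ (I : Finset Λ) : diagPart (pauliZ I) = pauliZ I := by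
  simp [diagPart_apply, pauliZ]

theorem isSelfAdjoint_pauliZ (I : Finset Λ) : IsSelfAdjoint (pauliZ I) := by
  rw [IsSelfAdjoint, pauliZ, Matrix.star_eq_conjTranspose, Matrix.diagonal_conjTranspose]
  congr 1
  funext σ
  simp

theorem spin_mul_self (b : Bool) : spin b * spin b = 1 := by cases b <;> norm_num [spin]

theorem pauliZ_mul_self (I : Finset Λ) : pauliZ I * pauliZ I = 1 := by
  rw [pauliZ, Matrix.diagonal_mul_diagonal, ← Matrix.diagonal_one]
  congr 1
  funext σ
  rw [← Complex.ofReal_mul, ← Finset.prod_mul_distrib]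
  simp [spin_mul_self]

theorem pauliX_mul_apply (v : Λ) (O : Op Λ) (σ τ : Λ → Bool) :
    (pauliX v * O) σ τ = O (flipAt v σ) τ := by
  simp [pauliX, Matrix.mul_apply]

theorem mul_pauliX_apply (v : Λ) (O : Op Λ) (σ τ : Λ → Bool) :
    (O * pauliX v) σ τ = O σ (flipAt v τ) := by
  have : ∀ ρ : Λ → Bool, (τ = flipAt v ρ) ↔ (ρ = flipAt v τ) := by
    intro ρ
    constructor <;> rintro rfl <;> rw [flipAt_flipAt]
  simp [pauliX, Matrix.mul_apply, this]

theorem pauliX_mul_self (v : Λ) : pauliX v * pauliX v = 1 := by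
  ext σ τ
  rw [pauliX_mul_apply]
  simp only [pauliX, Matrix.of_apply, flipAt_flipAt, Matrix.one_apply, eq_comm]

theorem isSelfAdjoint_pauliX (v : Λ) : IsSelfAdjoint (pauliX v) := by
  ext σ τ
  have : (σ = flipAt v τ) ↔ (τ = flipAt v σ) := by
    constructor <;> rintro rfl <;> rw [flipAt_flipAt]
  simp [pauliX, Matrix.star_apply, this]

theorem pauliX_mem_suppAlg (v : Λ) : pauliX v ∈ suppAlg {v} := by
  refine mem_suppAlg_iff.2 fun w hw => ⟨fun σ τ hne => ?_, fun σ τ => ?_⟩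
  · have hw' : w ≠ v := by simpa using hw
    simp only [pauliX, Matrix.of_apply]
    rw [if_neg]
    rintro rfl
    exact hne (flipAt_of_ne hw' σ).symm
  · have hw' : w ≠ v := by simpa using hw
    have hc : flipAt v (flipAt w σ) = flipAt w (flipAt v σ) := by
      rw [flipAt, flipAt, flipAt, flipAt, Function.update_of_ne hw'.symm,
        Function.update_of_ne hw', Function.update_comm hw'.symm]
    have : (flipAt w τ = flipAt v (flipAt w σ)) ↔ (τ = flipAt v σ) := by
      rw [hc]
      constructor
      · intro h
        rw [← flipAt_flipAt w τ, h, flipAt_flipAt]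
      · rintro rfl; rfl
    simp [pauliX, this]

theorem pauliZ_mul_pauliX (v : Λ) : pauliZ {v} * pauliX v = -(pauliX v * pauliZ {v}) := by
  ext σ τ
  rw [mul_pauliX_apply, Matrix.neg_apply, pauliX_mul_apply]
  by_cases h : τ = flipAt v σ
  · subst h
    rw [flipAt_flipAt]
    have : spin (!σ v) = -spin (σ v) := by cases σ v <;> simp [spin]
    simp [pauliZ, flipAt_self, this]
  · have h1 : σ ≠ flipAt v τ := by rintro rfl; exact h (flipAt_flipAt v τ).symm
    rw [pauliZ, Matrix.diagonal_apply_ne _ h1, Matrix.diagonal_apply_ne _ (Ne.symm h), neg_zero]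

/-- The average of `A` and `W A W`. -/
noncomputable def avg (W : Op Λ) : Op Λ →L[ℂ] Op Λ :=
  LinearMap.toContinuousLinearMap
    { toFun := fun A => (1 / 2 : ℂ) • (A + W * A * W)
      map_add' := fun A B => by simp only [mul_add, add_mul, smul_add]; abel
      map_smul' := fun c A => by
        simp only [Algebra.mul_smul_comm, Algebra.smul_mul_assoc, RingHom.id_apply, smul_add,
          smul_comm c (1 / 2 : ℂ)] }

theorem avg_apply (W A : Op Λ) : avg W A = (1 / 2 : ℂ) • (A + W * A * W) := rfl

theorem avg_of_commute {W A : Op Λ} (hW : W * W = 1) (h : Commute W A) : avg W A = A := by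
  rw [avg_apply, h.eq, mul_assoc, hW, mul_one, ← two_smul ℂ, smul_smul]
  norm_num

theorem commute_avg {W : Op Λ} (hW : W * W = 1) (A : Op Λ) : Commute W (avg W A) := by
  rw [avg_apply]
  refine Commute.smul_right ?_ _
  rw [Commute, SemiconjBy, mul_add, add_mul, mul_assoc (W * A), hW, mul_one, ← mul_assoc,
    ← mul_assoc, hW, one_mul, add_comm]

theorem norm_avg_le {W : Op Λ} (hW : W * W = 1) (hs : IsSelfAdjoint W) (A : Op Λ) :
    ‖avg W A‖ ≤ ‖A‖ := by
  have hU : W ∈ unitary (Op Λ) := by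
    rw [Unitary.mem_iff, hs.star_eq]; exact ⟨hW, hW⟩
  have h := norm_conj_unitary hU A
  rw [hs.star_eq] at h
  rw [avg_apply, norm_smul]
  have h2 := norm_add_le A (W * A * W)
  rw [h] at h2
  norm_num
  linarith

theorem avg_star {W : Op Λ} (hs : IsSelfAdjoint W) (A : Op Λ) : avg W (star A) = star (avg W A) := by
  rw [avg_apply, avg_apply, star_smul, star_add, star_mul, star_mul, hs.star_eq, mul_assoc]
  simp

theorem avg_lie {W B : Op Λ} (h : Commute W B) (A : Op Λ) : avg W ⁅A, B⁆ = ⁅avg W A, B⁆ := by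
  have h1 : W * (A * B) * W = W * A * W * B := by
    rw [← mul_assoc, mul_assoc, ← h.eq, ← mul_assoc]
  have h2 : W * (B * A) * W = B * (W * A * W) := by
    rw [← mul_assoc, h.eq, mul_assoc, mul_assoc, mul_assoc]
  rw [Ring.lie_def, Ring.lie_def, map_sub, avg_apply, avg_apply, avg_apply, h1, h2,
    Algebra.smul_mul_assoc, Algebra.mul_smul_comm, add_mul, mul_add]

theorem avg_mem_suppAlg {W A : Op Λ} {v : Λ} {Q : Finset Λ} (hW : W * W = 1)
    (hv : W ∈ suppAlg {v}) (hA : A ∈ suppAlg Q) : avg W A ∈ suppAlg Q := by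
  by_cases hvQ : v ∈ Q
  · have hWQ := suppAlg_mono (Finset.singleton_subset_iff.2 hvQ) hv
    exact Subalgebra.smul_mem _ (add_mem hA (mul_mem (mul_mem hWQ hA) hWQ)) _
  · rwa [avg_of_commute hW (commute_of_disjoint (Finset.disjoint_singleton_left.2 hvQ) hv hA)]

/-- The normalized partial trace over the qubits of a set `P`. -/
theorem exists_condExp (P : Finset Λ) : ∃ E : Op Λ →L[ℂ] Op Λ,
    (∀ A, ‖E A‖ ≤ ‖A‖) ∧ (∀ Q A, A ∈ suppAlg Q → E A ∈ suppAlg (Q \ P)) ∧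
    (∀ A, ∀ Q, Disjoint Q P → A ∈ suppAlg Q → E A = A) ∧ (∀ A, E (star A) = star (E A)) ∧
    (∀ A, diagPart A = A → diagPart (E A) = E A) ∧
    ∀ A B, (∀ C ∈ suppAlg P, Commute C B) → E ⁅A, B⁆ = ⁅E A, B⁆ := by
  induction P using Finset.induction_on with
  | empty =>
    exact ⟨ContinuousLinearMap.id ℂ _, by simp, by simp, by simp, by simp, by simp, by simp⟩
  | insert v P hv ih =>
    obtain ⟨E, h1, h2, h3, h4, h5, h6⟩ := ih
    have hX := pauliX_mul_self v
    have hZ := pauliZ_mul_self {v}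
    have hXs := isSelfAdjoint_pauliX v
    have hZs := isSelfAdjoint_pauliZ {v}
    have hXm := pauliX_mem_suppAlg v
    have hZm := pauliZ_mem_suppAlg {v}
    have hsub : ({v} : Finset Λ) ⊆ insert v P := by simp
    -- Averaging with `X_v` does not destroy the commutation with `Z_v`: moving `Z_v` past both
    -- factors `X_v` produces two signs that cancel. So the composition of both averages removes `v`
    -- from the support.
    have hcX : ∀ A, Commute (pauliZ {v}) (avg (pauliX v) (avg (pauliZ {v}) A)) := by
      intro A
      have hA := commute_avg hZ A
      rw [avg_apply]
      refine Commute.smul_right (hA.add_right ?_) _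
      set B := avg (pauliZ {v}) A
      have e := pauliZ_mul_pauliX v
      rw [Commute, SemiconjBy]
      calc pauliZ {v} * (pauliX v * B * pauliX v)
          = (pauliZ {v} * pauliX v) * B * pauliX v := by noncomm_ring
        _ = -(pauliX v * (pauliZ {v} * B) * pauliX v) := by rw [e]; noncomm_ring
        _ = -(pauliX v * B * (pauliZ {v} * pauliX v)) := by rw [hA.eq]; noncomm_ring
        _ = pauliX v * B * pauliX v * pauliZ {v} := by rw [e]; noncomm_ring
    refine ⟨(avg (pauliX v)).comp ((avg (pauliZ {v})).comp E), fun A => ?_, fun Q A hA => ?_,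
      fun A Q hd hA => ?_, fun A => ?_, fun A hA => ?_, fun A B hB => ?_⟩
    · exact (norm_avg_le hX hXs _).trans ((norm_avg_le hZ hZs _).trans (h1 A))
    · have hm := avg_mem_suppAlg hX hXm (avg_mem_suppAlg hZ hZm (h2 Q A hA))
      rw [suppAlg, Subalgebra.mem_centralizer_iff]
      rintro g ⟨u, hu, hg⟩
      by_cases huv : u = v
      · subst huv
        rcases hg with rfl | rfl
        · exact (commute_avg hX _).eq
        · exact (hcX _).eq
      · refine Subalgebra.mem_centralizer_iff ℂ |>.1 hm g ⟨u, fun h => hu ?_, hg⟩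
        simp only [Finset.mem_sdiff, Finset.mem_insert, not_or] at h ⊢
        exact ⟨h.1, huv, h.2⟩
    · rw [Finset.disjoint_insert_right] at hd
      have hdv : Disjoint {v} Q := Finset.disjoint_singleton_left.2 hd.1
      simp only [ContinuousLinearMap.comp_apply]
      rw [h3 A Q hd.2 hA, avg_of_commute hZ (commute_of_disjoint hdv hZm hA),
        avg_of_commute hX (commute_of_disjoint hdv hXm hA)]
    · simp only [ContinuousLinearMap.comp_apply]
      rw [h4, avg_star hZs, avg_star hXs]
    · simp only [ContinuousLinearMap.comp_apply]
      have hE := h5 A hA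
      rw [avg_of_commute hZ (commute_of_diagPart (diagPart_pauliZ _) hE)]
      generalize E A = B at hE
      rw [avg_apply, map_smul, map_add, hE]
      congr 2
      have e : ∀ σ τ, (pauliX v * B * pauliX v) σ τ = B (flipAt v σ) (flipAt v τ) := by
        intro σ τ; rw [mul_pauliX_apply, pauliX_mul_apply]
      ext σ τ
      rw [diagPart_apply]
      by_cases h : σ = τ
      · subst h; simp
      · have h' : flipAt v σ ≠ flipAt v τ := fun e => h (by
          rw [← flipAt_flipAt v σ, e, flipAt_flipAt])
        rw [Matrix.diagonal_apply_ne _ h, e, ← hE, diagPart_apply, Matrix.diagonal_apply_ne _ h']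
    · simp only [ContinuousLinearMap.comp_apply]
      rw [h6 A B fun C hC => hB C (suppAlg_mono (Finset.subset_insert _ _) hC),
        avg_lie (hB _ (suppAlg_mono hsub hZm)), avg_lie (hB _ (suppAlg_mono hsub hXm))]

theorem star_mem_locOps {G : SimpleGraph Λ} {R : Finset Λ} {q : ℕ} {A : Op Λ}
    (hA : A ∈ locOps G R q) : star A ∈ locOps G R q := by
  induction hA using Submodule.span_induction with
  | mem A h =>
    obtain ⟨S, hS, hq, hA⟩ := h
    exact mem_locOps hS hq (star_mem_suppAlg hA)
  | zero => simp
  | add A B _ _ hA hB => rw [star_add]; exact add_mem hA hB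
  | smul c A _ hA => rw [star_smul]; exact Submodule.smul_mem _ _ hA

end Averaging

/-! ### Local Hamiltonians -/

section LocalHamiltonian

variable {Λ : Type*} [Fintype Λ] [LinearOrder Λ] {G : SimpleGraph Λ}

/-- The largest diameter of the terms of order `p`: the classical terms have order `0`. -/
def hopRange (k p : ℕ) : ℕ := if p = 0 then k else p

/-- The terms `Φ p Z` of order `p ≤ N` of a local Hamiltonian with classical part `J`. -/
structure IsModel (G : SimpleGraph Λ) (k : ℕ) (J : Finset Λ → ℝ) (Φ : ℕ → Finset Λ → Op Λ) :
    Prop where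
  supported : ∀ p Z, Φ p Z ∈ suppAlg Z
  selfAdjoint : ∀ p Z, IsSelfAdjoint (Φ p Z)
  range_le : ∀ p Z, Φ p Z ≠ 0 → graphDiam G Z ≤ hopRange k p
  zero_eq : ∀ Z, Φ 0 Z = (J Z : ℂ) • pauliZ Z
  classical_range_le : ∀ I, J I ≠ 0 → graphDiam G I ≤ k

/-- The orders and supports of the terms inside `Y`. -/
def bonds (N : ℕ) (Y : Finset Λ) : Finset (ℕ × Finset Λ) :=
  Finset.range (N + 1) ×ˢ Y.powerset.erase ∅

theorem mem_bonds {N : ℕ} {Y : Finset Λ} {i : ℕ × Finset Λ} :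
    i ∈ bonds N Y ↔ i.1 ≤ N ∧ i.2 ≠ ∅ ∧ i.2 ⊆ Y := by
  simp [bonds]

open scoped Classical in
/-- The terms inside `Y` that touch both `R` and its complement. -/
noncomputable def hops (N : ℕ) (Y R : Finset Λ) : Finset (ℕ × Finset Λ) :=
  (bonds N Y).filter fun i => ¬ i.2 ⊆ R ∧ ¬ Disjoint i.2 R

theorem mem_hops {N : ℕ} {Y R : Finset Λ} {i : ℕ × Finset Λ} :
    i ∈ hops N Y R ↔ i.1 ≤ N ∧ i.2 ⊆ Y ∧ ¬ i.2 ⊆ R ∧ ¬ Disjoint i.2 R := by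
  classical
  rw [hops, Finset.mem_filter, mem_bonds]
  constructor
  · rintro ⟨⟨h1, -, h2⟩, h3, h4⟩; exact ⟨h1, h2, h3, h4⟩
  · rintro ⟨h1, h2, h3, h4⟩
    refine ⟨⟨h1, ?_, h2⟩, h3, h4⟩
    intro h; rw [h] at h3; simp at h3

/-- The Hamiltonian of the terms inside `Y`. -/
noncomputable def hamOn (N : ℕ) (Φ : ℕ → Finset Λ → Op Λ) (Y : Finset Λ) : Op Λ :=
  ∑ i ∈ bonds N Y, Φ i.1 i.2

/-- The perturbation inside `Y`. -/
noncomputable def pertOn (N : ℕ) (Φ : ℕ → Finset Λ → Op Λ) (Y : Finset Λ) : Op Λ :=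
  ∑ i ∈ (bonds N Y).filter (fun i => i.1 ≠ 0), Φ i.1 i.2

variable {k N : ℕ} {J : Finset Λ → ℝ} {Φ : ℕ → Finset Λ → Op Λ}

theorem hamOn_eq_add {Y R : Finset Λ} (hR : R ⊆ Y) :
    hamOn N Φ Y = hamOn N Φ (Y \ R) + hamOn N Φ R + ∑ i ∈ hops N Y R, Φ i.1 i.2 := by
  classical
  rw [hamOn, ← Finset.sum_filter_add_sum_filter_not (bonds N Y) (fun i => i.2 ⊆ R),
    ← Finset.sum_filter_add_sum_filter_not ((bonds N Y).filter fun i => ¬ i.2 ⊆ R)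
      (fun i => Disjoint i.2 R)]
  have e1 : (bonds N Y).filter (fun i => i.2 ⊆ R) = bonds N R := by
    ext i
    rw [Finset.mem_filter, mem_bonds, mem_bonds]
    exact ⟨fun h => ⟨h.1.1, h.1.2.1, h.2⟩, fun h => ⟨⟨h.1, h.2.1, h.2.2.trans hR⟩, h.2.2⟩⟩
  have e2 : ((bonds N Y).filter fun i => ¬ i.2 ⊆ R).filter (fun i => Disjoint i.2 R) =
      bonds N (Y \ R) := by
    ext i
    rw [Finset.mem_filter, Finset.mem_filter, mem_bonds, mem_bonds, Finset.subset_sdiff]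
    constructor
    · rintro ⟨⟨⟨h1, h2, h3⟩, h4⟩, h5⟩; exact ⟨h1, h2, h3, h5⟩
    · rintro ⟨h1, h2, h3, h5⟩
      refine ⟨⟨⟨h1, h2, h3⟩, fun h => h2 ?_⟩, h5⟩
      exact Finset.disjoint_self_iff_empty _ |>.1 (h5.mono_right h)
  have e3 : ((bonds N Y).filter fun i => ¬ i.2 ⊆ R).filter (fun i => ¬ Disjoint i.2 R) =
      hops N Y R := by
    rw [hops, Finset.filter_filter]
  rw [e1, e2, e3, hamOn, hamOn]
  abel

namespace IsModel

theorem hamOn_mem (hM : IsModel G k J Φ) (Y : Finset Λ) : hamOn N Φ Y ∈ suppAlg Y :=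
  sum_mem fun _ hi => suppAlg_mono (mem_bonds.1 hi).2.2 (hM.supported _ _)

theorem isSelfAdjoint_hamOn (hM : IsModel G k J Φ) (Y : Finset Λ) :
    IsSelfAdjoint (hamOn N Φ Y) :=
  isSelfAdjoint_sum _ fun i _ => hM.selfAdjoint i.1 i.2

theorem isSelfAdjoint_pertOn (hM : IsModel G k J Φ) (Y : Finset Λ) :
    IsSelfAdjoint (pertOn N Φ Y) :=
  isSelfAdjoint_sum _ fun i _ => hM.selfAdjoint i.1 i.2

/-- The Hamiltonian inside `R` commutes both with that of `Y \ R` and with `A`, so it drops out. -/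
theorem heis_hamOn_of_disjoint (hM : IsModel G k J Φ) {Y R S₁ : Finset Λ} {A : Op Λ}
    (hA : A ∈ suppAlg S₁) (hS : Disjoint R S₁) (t : ℝ) :
    heis (hamOn N Φ (Y \ R) + hamOn N Φ R) t A = heis (hamOn N Φ (Y \ R)) t A := by
  rw [heis_add_of_commute (commute_of_disjoint Finset.sdiff_disjoint (hM.hamOn_mem _)
    (hM.hamOn_mem _)), heis_of_commute (commute_of_disjoint hS (hM.hamOn_mem _) hA)]

/-- The effect of the terms that connect `R` to the rest of `Y`. -/
theorem norm_lie_heis_le (hM : IsModel G k J Φ) {Y R S₁ : Finset Λ} (hR : R ⊆ Y) {A : Op Λ}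
    (hA : A ∈ suppAlg S₁) (hS : Disjoint R S₁) (Q : Op Λ) {κ : ℕ × Finset Λ → ℝ} {l s : ℝ}
    (hl : 0 < l) (hs : 0 ≤ s)
    (h : ∀ i ∈ hops N Y R, ∀ u, 0 ≤ u →
      ‖⁅Φ i.1 i.2, heis (hamOn N Φ (Y \ R)) u A⁆‖ ≤ κ i * Real.exp (l * u)) :
    ‖⁅Q, heis (hamOn N Φ Y) s A⁆‖ ≤ ‖⁅Q, heis (hamOn N Φ (Y \ R)) s A⁆‖ +
      2 * ‖Q‖ * ((∑ i ∈ hops N Y R, κ i) * (Real.exp (l * s) - 1) / l) := by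
  have hK : IsSelfAdjoint (hamOn N Φ (Y \ R) + hamOn N Φ R) :=
    (hM.isSelfAdjoint_hamOn _).add (hM.isSelfAdjoint_hamOn _)
  have hE : IsSelfAdjoint (∑ i ∈ hops N Y R, Φ i.1 i.2) :=
    isSelfAdjoint_sum _ fun i _ => hM.selfAdjoint i.1 i.2
  have key := norm_heis_add_sub_heis_le hK hE A (κ := ∑ i ∈ hops N Y R, κ i) hl hs
    (fun u hu _ => by
      rw [hM.heis_hamOn_of_disjoint hA hS, Ring.lie_def, Finset.sum_mul, Finset.mul_sum,
        ← Finset.sum_sub_distrib, Finset.sum_mul]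
      refine norm_sum_le_of_le _ fun i hi => ?_
      rw [← Ring.lie_def]
      exact h i hi u hu)
  rw [← hamOn_eq_add hR, hM.heis_hamOn_of_disjoint hA hS] at key
  set B := heis (hamOn N Φ Y) s A
  set B' := heis (hamOn N Φ (Y \ R)) s A
  have e : ⁅Q, B⁆ = ⁅Q, B'⁆ + ⁅Q, B - B'⁆ := by
    simp only [Ring.lie_def, mul_sub, sub_mul]; abel
  rw [e]
  refine (norm_add_le _ _).trans (add_le_add le_rfl ((norm_lie_le' _ _).trans ?_))
  gcongr

theorem energyOp_eq_sum (J : Finset Λ → ℝ) (R : Finset Λ) :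
    energyOp J R = ∑ I ∈ R.powerset, (J I : ℂ) • pauliZ I := by
  ext σ τ
  rw [Matrix.sum_apply]
  by_cases h : σ = τ
  · subst h
    simp [energyOp, energy, pauliZ]
  · simp [energyOp, pauliZ, h]

theorem energyOp_mem_locOps (hM : IsModel G k J Φ) (R : Finset Λ) :
    energyOp J R ∈ locOps G R k := by
  rw [energyOp_eq_sum]
  refine Submodule.sum_mem _ fun I hI => ?_
  by_cases h : J I = 0
  · simp [h]
  · exact Submodule.smul_mem _ _ (mem_locOps (Finset.mem_powerset.1 hI)
      (hM.classical_range_le I h) (pauliZ_mem_suppAlg I))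

/-- The constant is subtracted because `bonds` omits the empty set while `energy` includes it. -/
theorem hamOn_eq (hM : IsModel G k J Φ) (R : Finset Λ) :
    hamOn N Φ R = energyOp J R + pertOn N Φ R - (J ∅ : ℂ) • 1 := by
  have h1 : ∑ i ∈ (bonds N R).filter (fun i => ¬ i.1 ≠ 0), Φ i.1 i.2 =
      energyOp J R - (J ∅ : ℂ) • 1 := by
    rw [energyOp_eq_sum, ← Finset.add_sum_erase _ _ (Finset.empty_mem_powerset R)]
    have : pauliZ (∅ : Finset Λ) = 1 := by simp [pauliZ]
    rw [this, add_sub_cancel_left]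
    refine Finset.sum_bij' (fun i _ => i.2) (fun Z _ => (0, Z)) ?_ ?_ ?_ ?_ ?_
    · intro i hi
      obtain ⟨h1, -⟩ := Finset.mem_filter.1 hi
      rw [mem_bonds] at h1
      exact Finset.mem_erase.2 ⟨h1.2.1, Finset.mem_powerset.2 h1.2.2⟩
    · intro Z hZ
      obtain ⟨h1, h2⟩ := Finset.mem_erase.1 hZ
      refine Finset.mem_filter.2 ⟨mem_bonds.2 ⟨Nat.zero_le _, h1, Finset.mem_powerset.1 h2⟩, ?_⟩
      simp
    · intro i hi
      have := (Finset.mem_filter.1 hi).2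
      rw [not_not] at this
      exact Prod.ext this.symm rfl
    · intro Z _; rfl
    · intro i hi
      have := (Finset.mem_filter.1 hi).2
      rw [not_not] at this
      rw [this, hM.zero_eq]
  rw [hamOn, ← Finset.sum_filter_add_sum_filter_not (bonds N R) (fun i => i.1 ≠ 0), h1, pertOn]
  abel

end IsModel

end LocalHamiltonian

/-! ### Decoupling by diagonalization in a non-resonant region -/

section Decoupling

variable {Λ : Type*} [Fintype Λ] [LinearOrder Λ] {G : SimpleGraph Λ} {k N : ℕ}
  {J : Finset Λ → ℝ} {Φ : ℕ → Finset Λ → Op Λ}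

theorem mem_suppAlg_compl {R : Finset Λ} {B : Op Λ} (h : ∀ C ∈ suppAlg R, Commute C B) :
    B ∈ suppAlg Rᶜ := by
  rw [suppAlg, Subalgebra.mem_centralizer_iff]
  rintro g ⟨v, hv, hg⟩
  have hv' : ({v} : Finset Λ) ⊆ R := by simpa using hv
  rcases hg with rfl | rfl
  · exact (h _ (suppAlg_mono hv' (pauliX_mem_suppAlg v))).eq
  · exact (h _ (suppAlg_mono hv' (pauliZ_mem_suppAlg _))).eq

theorem Dec.mem_suppAlg {F : ℕ → Submodule ℂ (Op Λ)} {y n : ℝ} {A : Op Λ} {R : Finset Λ}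
    (h : Dec F y A n) (hF : ∀ m, F m ≤ Subalgebra.toSubmodule (suppAlg R)) : A ∈ suppAlg R := by
  obtain ⟨ι, m, a, h1, h2, h3, h4⟩ := h
  exact (isClosed_submodule (Subalgebra.toSubmodule (suppAlg R))).mem_of_tendsto h4
    (Filter.Eventually.of_forall fun s => Submodule.sum_mem _ fun i _ => hF _ (h1 i))

theorem fromOrder_hamLoc_le (n : ℕ) (R : Finset Λ) (m : ℕ) :
    fromOrder n (hamLoc G k R) m ≤ Subalgebra.toSubmodule (suppAlg R) := by
  unfold fromOrder
  split_ifs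
  · exact locOps_le_suppAlg _ _
  · exact bot_le

/-- The orders below `m` do not reach `P` and are fixed by the partial trace. The rest has norm at
most `2n / y ^ m` and is counted twice. For `m = 0` the bound is trivial. -/
theorem norm_sub_condExp_le {R Q P : Finset Λ} {y n : ℝ} (hy : 1 ≤ y) {O : Op Λ}
    (hO : Dec (obsLoc G k R Q) y O (2 * n)) (hn : ‖O‖ ≤ n) {E : Op Λ →L[ℂ] Op Λ}
    (hE : ∀ A, ‖E A‖ ≤ ‖A‖) (hE' : ∀ A, ∀ Q, Disjoint Q P → A ∈ suppAlg Q → E A = A) (m : ℕ)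
    (hd : 0 < m → Disjoint (spread G R Q ((2 * k + 1) * (m - 1))) P) :
    ‖O - E O‖ ≤ 4 * n / y ^ m := by
  rcases Nat.eq_zero_or_pos m with rfl | hm
  · have h0 : 0 ≤ n := (norm_nonneg _).trans hn
    have := (norm_sub_le O (E O)).trans (add_le_add hn ((hE O).trans hn))
    rw [pow_zero, div_one]
    linarith
  · obtain ⟨O', h1, -, h2⟩ := hO.truncate hy (obsLoc_mono k R Q)
      (fun m => isClosed_submodule _) (m - 1)
    rw [Nat.sub_add_cancel hm] at h2
    have h3 : E O' = O' := hE' O' _ (hd hm) h1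
    have e : O - E O = (O - O') - E (O - O') := by rw [map_sub, h3]; abel
    rw [e]
    refine (norm_sub_le _ _).trans ((add_le_add h2 ((hE _).trans h2)).trans (le_of_eq ?_))
    ring

set_option maxHeartbeats 1000000 in
/-- In a region `R` without resonances, the dynamics is the sum of a part that does not connect
the observables `O` and `A`, and of a small error. -/
theorem exists_decoupling (hG : G.Connected) (hM : IsModel G k J Φ) {Y R X S₁ : Finset Λ}
    (hRY : R ⊆ Y) (hXR : X ⊆ R) (hSY : S₁ ⊆ Y) (hSR : Disjoint R S₁) {A O : Op Λ}
    (hA : A ∈ suppAlg S₁) (hO : O ∈ suppAlg (X ∪ Yᶜ)) {g y v : ℝ} (hg : 0 < g)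
    (hgap : HasGap J R g) (hy : 1 ≤ y)
    (hV : Dec (fromOrder 1 (hamLoc G k R)) y (pertOn N Φ R) v) (hv : 80 * R.card * v ≤ g)
    (a : ℕ) (τ : ℕ → ℕ)
    (hfar : ∀ i ∈ hops N Y R, Φ i.1 i.2 ≠ 0 → 0 < τ i.1 → ∀ u ∈ X, ∀ w ∈ i.2, w ∈ R →
      (2 * k + 1) * a + ((2 * k + 1) * a + k) + (2 * k + 1) * (τ i.1 - 1) < G.dist u w) :
    ∃ K E O₁ O₂ : Op Λ, hamOn N Φ Y = K + E ∧ IsSelfAdjoint K ∧ IsSelfAdjoint E ∧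
      O = O₁ + O₂ ∧ ‖O₁‖ ≤ ‖O‖ ∧ (∀ u, ⁅O₁, heis K u A⁆ = 0) ∧ ‖O₂‖ ≤ 4 * ‖O‖ / y ^ (a + 1) ∧
      O₂ ∈ suppAlg (R ∪ Yᶜ) ∧
      ‖E‖ ≤ 3 * v / y ^ (a + 1) + ∑ i ∈ hops N Y R, 4 * ‖Φ i.1 i.2‖ / y ^ τ i.1 ∧
      ∀ B, (∀ C ∈ suppAlg R, Commute C B) →
        ‖⁅E, B⁆‖ ≤ ∑ i ∈ hops N Y R, 4 * ‖⁅Φ i.1 i.2, B⁆‖ / y ^ τ i.1 := by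
  classical
  have hv0 : 0 ≤ v := hV.nonneg hy
  have hy0 : 0 < y := by linarith
  obtain ⟨U, D, W, hU, hUR, hUH, hDd, hDs, hWs, hD, hW, hobs⟩ :=
    exists_rotation hG hM.classical_range_le hg hgap hy (hM.isSelfAdjoint_pertOn R) hV hv a
  have hUU : U * star U = 1 := Unitary.mul_star_self_of_mem hU
  have hUU' : star U * U = 1 := Unitary.star_mul_self_of_mem hU
  have hU' : star U ∈ unitary (Op Λ) := Unitary.star_mem hU
  have hUsR : star U ∈ suppAlg R := star_mem_suppAlg hUR
  have hp1 : (1 / 2 : ℝ) ^ a ≤ 1 := pow_le_one₀ (by norm_num) (by norm_num)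
  have hp0 : (0 : ℝ) < (1 / 2 : ℝ) ^ a := by positivity
  -- dressed operators
  have hdress : ∀ (Q : Finset Λ) (O : Op Λ), O ∈ suppAlg Q →
      Dec (obsLoc G k R Q) y (star U * O * U) (2 * ‖O‖) := by
    intro Q O hO
    refine (hobs Q O hO).mono ?_
    gcongr
    have h1 : 8 * R.card / g * v * (1 - (1 / 2) ^ a) ≤ 1 / 10 := by
      have h2 : 8 * R.card / g * v ≤ 1 / 10 := by
        rw [div_mul_eq_mul_div, div_le_iff₀ hg]; linarith
      exact (mul_le_of_le_one_right (by positivity) (by linarith)).trans h2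
    have h3 := Real.exp_le_exp.2 h1
    have h4 : Real.exp (1 / 10) ≤ 2 := by
      have := Real.exp_one_lt_d9
      have h5 : Real.exp (1 / 10) ^ 10 = Real.exp 1 := by
        rw [← Real.exp_nat_mul]; norm_num
      by_contra hcon
      push Not at hcon
      have : (2 : ℝ) ^ 10 ≤ Real.exp (1 / 10) ^ 10 := by gcongr
      norm_num at this
      linarith
    linarith
  have hnormconj : ∀ O : Op Λ, ‖star U * O * U‖ = ‖O‖ := norm_conj_unitary hU
  have hnormconj' : ∀ O : Op Λ, ‖U * O * star U‖ = ‖O‖ := fun O => by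
    have := norm_conj_unitary hU' O
    rwa [star_star] at this
  -- the truncated diagonal part
  obtain ⟨D₁, hD₁, -, hD₁D⟩ := hD.truncate hy (fromOrder_mono 1 (hamLoc_mono k R))
    (fun m => isClosed_submodule _) a
  -- The truncation `D₁` need not be diagonal or self-adjoint. Projecting it restores both and does
  -- not increase its distance to `D`, which is diagonal and self-adjoint.
  set D₂ : Op Λ := (1 / 2 : ℂ) • (diagPart D₁ + star (diagPart D₁)) with hD₂
  have hD₂s : IsSelfAdjoint D₂ := by
    rw [IsSelfAdjoint, hD₂, star_smul, star_add, star_star, add_comm]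
    simp
  have hD₂d : diagPart D₂ = D₂ := by
    rw [hD₂, map_smul, map_add, diagPart_star, diagPart_diagPart]
  have hD₂D : ‖D - D₂‖ ≤ 2 * v / y ^ (a + 1) := by
    have e : D - D₂ = (1 / 2 : ℂ) • (diagPart (D - D₁) + star (diagPart (D - D₁))) := by
      rw [map_sub, hDd, star_sub, hDs.star_eq, hD₂]
      have h2 : D = (1 / 2 : ℂ) • (D + D) := by
        rw [← two_smul ℂ, smul_smul]; norm_num
      nth_rw 1 [h2]
      rw [← smul_sub]
      congr 1
      abel
    have h1 : ‖diagPart (D - D₁)‖ ≤ 2 * v / y ^ (a + 1) := by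
      refine (norm_diagPart_le _).trans (hD₁D.trans (div_le_div_of_nonneg_right ?_ (by positivity)))
      exact mul_le_of_le_one_right (by linarith) (by linarith)
    have h2 := norm_add_le (diagPart (D - D₁)) (star (diagPart (D - D₁)))
    rw [norm_star] at h2
    have h3 : ‖(1 / 2 : ℂ)‖ = 1 / 2 := by norm_num
    rw [e, norm_smul, h3]
    linarith
  have hD₂loc : D₂ ∈ locOps G R ((2 * k + 1) * a + k) := by
    have h1 : D₁ ∈ locOps G R ((2 * k + 1) * a + k) := by
      rcases mem_fromOrder hD₁ with rfl | ⟨-, h⟩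
      · exact zero_mem _
      · exact locOps_mono R (by omega) h
    have h2 := diagPart_mem_locOps h1
    exact Submodule.smul_mem _ _ (add_mem h2 (star_mem_locOps h2))
  have hWn : ‖W‖ ≤ v / y ^ (a + 1) := by
    refine (hW.norm_le_of_bot hy (n := a + 1) fun m hm => ?_).trans ?_
    · rw [fromOrder, if_neg (by omega)]
    · exact div_le_div_of_nonneg_right (mul_le_of_le_one_right hv0 hp1) (by positivity)
  -- the local diagonal Hamiltonian
  set Kd : Op Λ := energyOp J R + D₂ - (J ∅ : ℂ) • 1 with hKd
  have hone : ((J ∅ : ℂ) • 1 : Op Λ) ∈ locOps G R 0 :=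
    Submodule.smul_mem _ _ (mem_locOps (Finset.empty_subset R) (by simp [graphDiam])
      (one_mem _))
  have hKdloc : Kd ∈ locOps G R ((2 * k + 1) * a + k) :=
    sub_mem (add_mem (locOps_mono R (by omega) (hM.energyOp_mem_locOps R)) hD₂loc)
      (locOps_mono R (Nat.zero_le _) hone)
  have hKdR : Kd ∈ suppAlg R := locOps_le_suppAlg R _ hKdloc
  have hKds : IsSelfAdjoint Kd := by
    refine ((isSelfAdjoint_energyOp J R).add hD₂s).sub ?_
    rw [IsSelfAdjoint, star_smul, star_one]
    simp
  have hKdd : diagPart Kd = Kd := by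
    have h1 : diagPart (energyOp J R) = energyOp J R := by simp [energyOp, diagPart_apply]
    have h2 : diagPart (1 : Op Λ) = 1 := by simp [diagPart_apply]
    rw [hKd, map_sub, map_add, h1, hD₂d, map_smul, h2]
  -- `Xa` carries, inside `R`, the rotated observable up to order `a`; the set `Nb` below also
  -- contains every piece of `Kd` that touches `Xa`.
  set Xa : Finset Λ := R.filter fun v => ∃ u ∈ X, G.dist u v ≤ (2 * k + 1) * a with hXa
  have hXaR : Xa ⊆ R := Finset.filter_subset _ _
  set Nb : Finset Λ := R.filter fun v => ∃ w ∈ Xa, G.dist w v ≤ (2 * k + 1) * a + k with hNb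
  have hNbR : Nb ⊆ R := Finset.filter_subset _ _
  -- The partial trace over `Xa` splits `Kd` into a part off `Xa` and a part in `Nb`. Both stay
  -- diagonal, hence commute although their supports overlap; this is the use of the
  -- diagonalization.
  obtain ⟨F, hF1, hF2, hF3, hF4, hF5, -⟩ := exists_condExp Xa
  have hKfar : F Kd ∈ suppAlg (R \ Xa) := hF2 _ _ hKdR
  have hKnear : Kd - F Kd ∈ suppAlg Nb := by
    have := map_mem_of_mem_locOps (P := Subalgebra.toSubmodule (suppAlg Nb))
      (ContinuousLinearMap.id ℂ (Op Λ) - F) (fun S hS hq B hB => by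
        have e : (ContinuousLinearMap.id ℂ (Op Λ) - F) B = B - F B := rfl
        rw [e]
        by_cases hd : Disjoint S Xa
        · rw [hF3 B S hd hB, sub_self]; exact zero_mem _
        · obtain ⟨w, hw, hwX⟩ := Finset.not_disjoint_iff.1 hd
          have hSN : S ⊆ Nb := fun v hv => Finset.mem_filter.2
            ⟨hS hv, w, hwX, graphDiam_le_iff.1 hq w hw v hv⟩
          exact sub_mem (suppAlg_mono hSN hB)
            (suppAlg_mono (Finset.sdiff_subset.trans hSN) (hF2 _ _ hB))) hKdloc
    exact this
  -- the observable
  set Oc : Op Λ := star U * O * U with hOc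
  have hOcR : Oc ∈ suppAlg (R ∪ Yᶜ) := by
    have h1 := suppAlg_mono (Finset.subset_union_left (s₂ := Yᶜ)) hUR
    have h2 := suppAlg_mono (Finset.subset_union_left (s₂ := Yᶜ)) hUsR
    exact mul_mem (mul_mem h2 (suppAlg_mono (Finset.union_subset_union_left hXR) hO)) h1
  obtain ⟨F', hF'1, hF'2, hF'3, -, -, -⟩ := exists_condExp (R \ Xa)
  have hO₁ : F' Oc ∈ suppAlg (Xa ∪ Yᶜ) := by
    refine suppAlg_mono (fun w hw => ?_) (hF'2 _ _ hOcR)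
    simp only [Finset.mem_sdiff, Finset.mem_union, not_and, not_not] at hw ⊢
    rcases hw with ⟨h1 | h1, h2⟩
    · exact Or.inl (h2 h1)
    · exact Or.inr h1
  have hO₂ : ‖Oc - F' Oc‖ ≤ 4 * ‖O‖ / y ^ (a + 1) := by
    refine norm_sub_condExp_le hy (hdress _ O hO) (hnormconj O).le hF'1 hF'3 (a + 1) fun _ => ?_
    rw [Nat.add_sub_cancel, Finset.disjoint_left]
    intro w hw hw'
    obtain ⟨hwR, hwX⟩ := Finset.mem_sdiff.1 hw'
    apply hwX
    refine Finset.mem_filter.2 ⟨hwR, ?_⟩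
    have hX : ∀ u, u ∈ X ∪ Yᶜ → u ∈ R → u ∈ X := by
      intro u hu huR
      rcases Finset.mem_union.1 hu with h | h
      · exact h
      · exact absurd (hRY huR) (Finset.mem_compl.1 h)
    rcases mem_spread.1 hw with h | ⟨-, u, hu, huR, hd⟩
    · exact ⟨w, hX w h hwR, by simp⟩
    · exact ⟨u, hX u hu huR, hd⟩
  -- the dressed hopping terms
  set nb : ℕ × Finset Λ → Finset Λ := fun i => R.filter fun v =>
    ∃ u ∈ i.2, u ∈ R ∧ G.dist u v + (2 * k + 1) ≤ (2 * k + 1) * τ i.1 with hnb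
  choose T hT1 hT2 hT3 hT4 _ hT6 using fun i => exists_condExp (Λ := Λ) (R \ nb i)
  set hc : ℕ × Finset Λ → Op Λ := fun i => star U * Φ i.1 i.2 * U with hhc
  have hspread : ∀ (i : ℕ × Finset Λ) (Q : Finset Λ), Q ∩ R ⊆ i.2 → 0 < τ i.1 →
      Disjoint (spread G R Q ((2 * k + 1) * (τ i.1 - 1))) (R \ nb i) := by
    intro i Q hQ hτ
    obtain ⟨j, hj⟩ : ∃ j, τ i.1 = j + 1 := ⟨τ i.1 - 1, by omega⟩
    rw [hj, Nat.add_sub_cancel, Finset.disjoint_left]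
    intro w hw hw'
    obtain ⟨hwR, hwX⟩ := Finset.mem_sdiff.1 hw'
    apply hwX
    refine Finset.mem_filter.2 ⟨hwR, ?_⟩
    rw [hj]
    rcases mem_spread.1 hw with h | ⟨-, u, hu, huR, hd⟩
    · refine ⟨w, hQ (Finset.mem_inter.2 ⟨h, hwR⟩), hwR, ?_⟩
      rw [SimpleGraph.dist_self, mul_add]; omega
    · refine ⟨u, hQ (Finset.mem_inter.2 ⟨hu, huR⟩), huR, ?_⟩
      rw [mul_add]; omega
  have hhn : ∀ i, ‖hc i - T i (hc i)‖ ≤ 4 * ‖Φ i.1 i.2‖ / y ^ τ i.1 := by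
    intro i
    exact norm_sub_condExp_le hy (hdress _ _ (hM.supported i.1 i.2)) (hnormconj _).le (hT1 i)
      (hT3 i) _ (hspread i _ Finset.inter_subset_left)
  have hh1 : ∀ i, T i (hc i) ∈ suppAlg ((i.2 \ R) ∪ nb i) := by
    intro i
    have h1 : hc i ∈ suppAlg (i.2 ∪ R) :=
      mul_mem (mul_mem (suppAlg_mono Finset.subset_union_right hUsR)
        (suppAlg_mono Finset.subset_union_left (hM.supported _ _)))
        (suppAlg_mono Finset.subset_union_right hUR)
    refine suppAlg_mono (fun w hw => ?_) (hT2 i _ _ h1)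
    simp only [Finset.mem_sdiff, Finset.mem_union, not_and, not_not] at hw ⊢
    by_cases hwR : w ∈ R
    · exact Or.inr (hw.2 hwR)
    · exact Or.inl ⟨hw.1.resolve_right hwR, hwR⟩
  have hhs : ∀ i, IsSelfAdjoint (T i (hc i)) := by
    intro i
    rw [IsSelfAdjoint, ← hT4]
    congr 1
    exact (hM.selfAdjoint i.1 i.2).conjugate' U
  have hcommA : ∀ C ∈ suppAlg R, Commute C A := fun C hC => commute_of_disjoint hSR hC hA
  set HY := hamOn N Φ (Y \ R) with hHY
  have hHYm : HY ∈ suppAlg (Y \ R) := hM.hamOn_mem _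
  -- Everything that may act on `A`. It avoids `Xa`, and the remaining part `Kd - F Kd` of `H'`
  -- commutes with it and with `A`.
  set L : Op Λ := F Kd + ∑ i ∈ hops N Y R, T i (hc i) + HY with hL
  set H' : Op Λ := (Kd - F Kd) + L with hH'
  set Er : Op Λ := (D - D₂) + W + ∑ i ∈ hops N Y R, (hc i - T i (hc i)) with hEr
  have htotal : star U * hamOn N Φ Y * U = H' + Er := by
    have e1 : star U * HY * U = HY := by
      have : Commute (star U) HY := commute_of_disjoint Finset.disjoint_sdiff hUsR hHYm
      rw [this.eq, mul_assoc, hUU', mul_one]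
    have e2 : star U * hamOn N Φ R * U = energyOp J R + D + W - (J ∅ : ℂ) • 1 := by
      rw [hM.hamOn_eq, mul_sub, sub_mul, hUH, Algebra.mul_smul_comm, mul_one,
        Algebra.smul_mul_assoc, hUU']
    rw [hamOn_eq_add hRY, mul_add, mul_add, add_mul, add_mul, e1, e2, Finset.mul_sum,
      Finset.sum_mul, hH', hEr, hL, Finset.sum_sub_distrib, hKd]
    abel
  have hFs : IsSelfAdjoint (F Kd) := by rw [IsSelfAdjoint, ← hF4, hKds.star_eq]
  have hH's : IsSelfAdjoint H' :=
    (hKds.sub hFs).add ((hFs.add (isSelfAdjoint_sum _ fun i _ => hhs i)).add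
      (hM.isSelfAdjoint_hamOn _))
  have hErs : IsSelfAdjoint Er := by
    have : Er = star U * hamOn N Φ Y * U - H' := by rw [htotal]; abel
    rw [this]
    exact ((hM.isSelfAdjoint_hamOn Y).conjugate' U).sub hH's
  -- the decoupled dynamics
  have hnbX : ∀ i ∈ hops N Y R, Φ i.1 i.2 ≠ 0 → ∀ w ∈ nb i, ∀ u ∈ X,
      (2 * k + 1) * a + ((2 * k + 1) * a + k) < G.dist u w := by
    intro i hi h0 w hw u hu
    obtain ⟨hwR, z, hz, hzR, hd⟩ := Finset.mem_filter.1 hw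
    have hτ : 0 < τ i.1 := by
      rcases Nat.eq_zero_or_pos (τ i.1) with h | h
      · rw [h] at hd; omega
      · exact h
    have h1 := hfar i hi h0 hτ u hu z hz hzR
    have h2 := hG.dist_triangle (u := u) (v := w) (w := z)
    rw [G.dist_comm (u := w)] at h2
    obtain ⟨j, hj⟩ : ∃ j, τ i.1 = j + 1 := ⟨τ i.1 - 1, by omega⟩
    rw [hj, Nat.add_sub_cancel] at h1
    rw [hj, mul_add] at hd
    omega
  have hhop : ∀ i ∈ hops N Y R, T i (hc i) ∈ suppAlg (Y \ Nb) ∧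
      T i (hc i) ∈ suppAlg (Y \ Xa) := by
    intro i hi
    by_cases h0 : Φ i.1 i.2 = 0
    · have : hc i = 0 := by simp [hhc, h0]
      rw [this, map_zero]
      exact ⟨zero_mem _, zero_mem _⟩
    have hiY := (mem_hops.1 hi).2.1
    constructor
    · refine suppAlg_mono (fun w hw => ?_) (hh1 i)
      rcases Finset.mem_union.1 hw with h | h
      · obtain ⟨h1, h2⟩ := Finset.mem_sdiff.1 h
        exact Finset.mem_sdiff.2 ⟨hiY h1, fun h3 => h2 (hNbR h3)⟩
      · refine Finset.mem_sdiff.2 ⟨hRY (Finset.mem_filter.1 h).1, fun h3 => ?_⟩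
        obtain ⟨-, z, hz, hzw⟩ := Finset.mem_filter.1 h3
        obtain ⟨-, u, hu, huz⟩ := Finset.mem_filter.1 hz
        have h4 := hnbX i hi h0 w h u hu
        have h5 := hG.dist_triangle (u := u) (v := z) (w := w)
        omega
    · refine suppAlg_mono (fun w hw => ?_) (hh1 i)
      rcases Finset.mem_union.1 hw with h | h
      · obtain ⟨h1, h2⟩ := Finset.mem_sdiff.1 h
        exact Finset.mem_sdiff.2 ⟨hiY h1, fun h3 => h2 (hXaR h3)⟩
      · refine Finset.mem_sdiff.2 ⟨hRY (Finset.mem_filter.1 h).1, fun h3 => ?_⟩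
        obtain ⟨-, u, hu, huz⟩ := Finset.mem_filter.1 h3
        have h4 := hnbX i hi h0 w h u hu
        omega
  have hdY : Disjoint (Xa ∪ Yᶜ) (Y \ Xa) := by
    rw [Finset.disjoint_left]
    intro w hw hw'
    obtain ⟨h1, h2⟩ := Finset.mem_sdiff.1 hw'
    rcases Finset.mem_union.1 hw with h | h
    · exact h2 h
    · exact Finset.mem_compl.1 h h1
  have hO₁L : Commute (F' Oc) L := by
    refine ((?_ : Commute _ _).add_right (Commute.sum_right _ _ _ fun i hi => ?_)).add_right ?_
    · exact commute_of_disjoint hdY hO₁ (suppAlg_mono (Finset.sdiff_subset_sdiff hRY le_rfl) hKfar)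
    · exact commute_of_disjoint hdY hO₁ (hhop i hi).2
    · exact commute_of_disjoint hdY hO₁ (suppAlg_mono (Finset.sdiff_subset_sdiff le_rfl hXaR) hHYm)
  have hO₁A : Commute (F' Oc) A := by
    refine commute_of_disjoint hdY hO₁ (suppAlg_mono (fun w hw => ?_) hA)
    exact Finset.mem_sdiff.2 ⟨hSY hw, fun h => Finset.disjoint_left.1 hSR (hXaR h) hw⟩
  have hKL : Commute (Kd - F Kd) L := by
    have hdN : Disjoint Nb (Y \ Nb) := Finset.disjoint_sdiff
    refine ((?_ : Commute _ _).add_right (Commute.sum_right _ _ _ fun i hi => ?_)).add_right ?_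
    · have h1 := hF5 Kd hKdd
      exact commute_of_diagPart (by rw [map_sub, hKdd, h1]) h1
    · exact commute_of_disjoint hdN hKnear (hhop i hi).1
    · exact commute_of_disjoint hdN hKnear
        (suppAlg_mono (Finset.sdiff_subset_sdiff le_rfl hNbR) hHYm)
  have hzero : ∀ u, ⁅F' Oc, heis H' u A⁆ = 0 := by
    intro u
    have h1 : Commute (Kd - F Kd) A := hcommA _ (suppAlg_mono hNbR hKnear)
    rw [hH', add_comm, heis_add_of_commute hKL.symm, heis_of_commute h1]
    exact lie_eq_zero_of_commute (hO₁L.heis_right hO₁A u)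
  -- The rotation lives in `R`, away from `S₁`, so it can be undone without touching `A`.
  have hA' : U * A * star U = A := by
    rw [(hcommA U hUR).eq, mul_assoc, hUU, mul_one]
  have hback : ∀ C : Op Λ, U * (star U * C * U) * star U = C := by
    intro C
    calc U * (star U * C * U) * star U = (U * star U) * C * (U * star U) := by noncomm_ring
      _ = C := by rw [hUU, one_mul, mul_one]
  have hlie : ∀ C B : Op Λ, Commute U B → ⁅U * C * star U, B⁆ = U * ⁅C, B⁆ * star U := by
    intro C B h
    have h' : Commute (star U) B := by
      have e : B = star U * B * U := by rw [mul_assoc, ← h.eq, ← mul_assoc, hUU', one_mul]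
      rw [Commute, SemiconjBy]
      nth_rw 2 [e]
      rw [mul_assoc, mul_assoc, hUU, mul_one]
    rw [Ring.lie_def, Ring.lie_def, mul_sub, sub_mul]
    congr 1
    · rw [mul_assoc _ _ B, h'.eq]; noncomm_ring
    · rw [← mul_assoc U B C, h.eq]; noncomm_ring
  refine ⟨U * H' * star U, U * Er * star U, U * F' Oc * star U, U * (Oc - F' Oc) * star U,
    ?_, ?_, ?_, ?_, ?_, fun u => ?_, ?_, ?_, ?_, fun B hB => ?_⟩
  · rw [← add_mul, ← mul_add, ← htotal, hback]
  · exact hH's.conjugate U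
  · exact hErs.conjugate U
  · rw [← add_mul, ← mul_add, add_sub_cancel, hOc, hback]
  · rw [hnormconj']
    exact (hF'1 Oc).trans (hnormconj O).le
  · have e := heis_conj hU' H' u A
    rw [star_star, hA'] at e
    rw [← e]
    have : ⁅U * F' Oc * star U, U * heis H' u A * star U⁆ =
        U * ⁅F' Oc, heis H' u A⁆ * star U := by
      rw [Ring.lie_def, Ring.lie_def, mul_sub, sub_mul]
      have aux : ∀ C B : Op Λ, U * C * star U * (U * B * star U) = U * (C * B) * star U := by
        intro C B
        calc U * C * star U * (U * B * star U) = U * C * (star U * U) * B * star U := by noncomm_ring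
          _ = _ := by rw [hUU']; noncomm_ring
      rw [aux, aux]
    rw [this, hzero, mul_zero, zero_mul]
  · rw [hnormconj']; exact hO₂
  · have h1 := suppAlg_mono (Finset.subset_union_left (s₂ := Yᶜ)) hUR
    have h2 := suppAlg_mono (Finset.subset_union_left (s₂ := Yᶜ)) hUsR
    have h3 : F' Oc ∈ suppAlg (R ∪ Yᶜ) :=
      suppAlg_mono (Finset.union_subset_union_left hXaR) hO₁
    exact mul_mem (mul_mem h1 (sub_mem hOcR h3)) h2
  · rw [hnormconj', hEr]
    refine (norm_add_le _ _).trans (add_le_add ?_ (norm_sum_le_of_le _ fun i _ => hhn i))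
    refine (norm_add_le _ _).trans ((add_le_add hD₂D hWn).trans (le_of_eq ?_))
    ring
  · rw [hlie _ _ (hB U hUR), hnormconj']
    -- The errors inside `R` commute with `B`, so only the tails of the rotated hops contribute. The
    -- partial trace over a part of `R` commutes with the bracket by `B`, so each tail is small
    -- relative to `[Φ, B]` and not only to `‖Φ‖`.
    have hcomm : Commute (D - D₂ + W) B := by
      exact hB _ (add_mem (sub_mem (hD.mem_suppAlg fun m => fromOrder_hamLoc_le 1 R m)
        (locOps_le_suppAlg R _ hD₂loc)) (hW.mem_suppAlg fun m => fromOrder_hamLoc_le _ R m))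
    have e : ⁅Er, B⁆ = ∑ i ∈ hops N Y R, ⁅hc i - T i (hc i), B⁆ := by
      rw [hEr, Ring.lie_def, add_mul, mul_add, hcomm.eq, add_sub_add_left_eq_sub, Finset.sum_mul,
        Finset.mul_sum, ← Finset.sum_sub_distrib]
      rfl
    rw [e]
    refine norm_sum_le_of_le _ fun i _ => ?_
    have hBs : B ∈ suppAlg Rᶜ := mem_suppAlg_compl hB
    have e1 : ⁅hc i, B⁆ = star U * ⁅Φ i.1 i.2, B⁆ * U := by
      have h' := hB _ hUsR
      have h := hB _ hUR
      rw [Ring.lie_def, Ring.lie_def, mul_sub, sub_mul, hhc]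
      congr 1
      · rw [mul_assoc _ U B, h.eq]; noncomm_ring
      · rw [← mul_assoc (star U) B, h'.eq]; noncomm_ring
    have e2 : ⁅hc i - T i (hc i), B⁆ = ⁅hc i, B⁆ - T i ⁅hc i, B⁆ := by
      rw [hT6 i _ _ fun C hC => hB C (suppAlg_mono Finset.sdiff_subset hC)]
      simp only [Ring.lie_def, sub_mul, mul_sub]
      abel
    have hm : ⁅Φ i.1 i.2, B⁆ ∈ suppAlg (i.2 ∪ Rᶜ) := by
      have h1 := suppAlg_mono (Finset.subset_union_left (s₂ := Rᶜ)) (hM.supported i.1 i.2)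
      have h2 := suppAlg_mono (Finset.subset_union_right (s₁ := i.2)) hBs
      rw [Ring.lie_def]
      exact sub_mem (mul_mem h1 h2) (mul_mem h2 h1)
    rw [e2, e1]
    refine norm_sub_condExp_le hy (hdress _ _ hm) (hnormconj _).le (hT1 i) (hT3 i) _
      (hspread i _ fun w hw => ?_)
    obtain ⟨h1, h2⟩ := Finset.mem_inter.1 hw
    rcases Finset.mem_union.1 h1 with h | h
    · exact h
    · exact absurd h2 (Finset.mem_compl.1 h)

end Decoupling

/-! ### Estimates for one step -/

section Step

variable {Λ : Type*} [Fintype Λ] [LinearOrder Λ] {G : SimpleGraph Λ} {k N : ℕ}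
  {J : Finset Λ → ℝ} {Φ : ℕ → Finset Λ → Op Λ}

open scoped Classical in
/-- The strength of the terms: `c * h` for the classical terms, and `ε ^ p * w p` for the terms
of order `p`, with `∑ w p ≤ h`. -/
structure HasStrength (N : ℕ) (c h ε : ℝ) (w : ℕ → ℝ) (Φ : ℕ → Finset Λ → Op Λ) : Prop where
  c_nonneg : 0 ≤ c
  h_nonneg : 0 ≤ h
  ε_nonneg : 0 ≤ ε
  nonneg : ∀ p, 0 ≤ w p
  zero_le : ∀ v, ∑ Z ∈ Finset.univ.filter (fun Z : Finset Λ => v ∈ Z), ‖Φ 0 Z‖ ≤ c * h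
  order_le : ∀ p, 1 ≤ p → ∀ v,
    ∑ Z ∈ Finset.univ.filter (fun Z : Finset Λ => v ∈ Z), ‖Φ p Z‖ ≤ ε ^ p * w p
  sum_le : ∑ p ∈ Finset.Icc 1 N, w p ≤ h

theorem sum_norm_le_of_touch (Ψ : Finset Λ → Op Λ) (R : Finset Λ) {b : ℝ}
    [DecidablePred fun Z : Finset Λ => ¬ Disjoint Z R]
    (h : ∀ v, ∑ Z ∈ Finset.univ.filter (fun Z : Finset Λ => v ∈ Z), ‖Ψ Z‖ ≤ b) :
    ∑ Z ∈ Finset.univ.filter (fun Z : Finset Λ => ¬ Disjoint Z R), ‖Ψ Z‖ ≤ R.card * b := by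
  classical
  calc ∑ Z ∈ Finset.univ.filter (fun Z : Finset Λ => ¬ Disjoint Z R), ‖Ψ Z‖
      ≤ ∑ Z : Finset Λ, ∑ v ∈ R, if v ∈ Z then ‖Ψ Z‖ else 0 := by
        rw [Finset.sum_filter]
        refine Finset.sum_le_sum fun Z _ => ?_
        by_cases hd : Disjoint Z R
        · rw [if_neg (not_not.2 hd)]
          exact Finset.sum_nonneg fun v _ => by positivity
        · rw [if_pos hd]
          obtain ⟨v, hv, hvR⟩ := Finset.not_disjoint_iff.1 hd
          have h1 := Finset.single_le_sum (f := fun v => if v ∈ Z then ‖Ψ Z‖ else 0)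
            (fun v _ => by positivity) hvR
          simpa only [if_pos hv] using h1
    _ = ∑ v ∈ R, ∑ Z ∈ Finset.univ.filter (fun Z : Finset Λ => v ∈ Z), ‖Ψ Z‖ := by
        rw [Finset.sum_comm]
        refine Finset.sum_congr rfl fun v _ => ?_
        rw [Finset.sum_filter]
    _ ≤ ∑ v ∈ R, b := Finset.sum_le_sum fun v _ => h v
    _ = R.card * b := by simp

namespace HasStrength

variable {c h ε : ℝ} {w : ℕ → ℝ}

/-- A union bound over the vertices of `R p`, separately for each order. Since `∑ w p ≤ h`, a bound
on `f p * ε ^ p * |R p|` uniform in `p ≥ 1` suffices; no summation over orders is lost. -/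
theorem sum_le_of_touch (hS : HasStrength N c h ε w Φ) {I : Finset (ℕ × Finset Λ)}
    {R : ℕ → Finset Λ} (hI : ∀ i ∈ I, i.1 ≤ N ∧ ¬ Disjoint i.2 (R i.1)) {f : ℕ → ℝ}
    (hf : ∀ p, 0 ≤ f p) {F₀ F₁ : ℝ} (h0 : f 0 * (R 0).card ≤ F₀)
    (hF₁ : 0 ≤ F₁)
    (h1 : ∀ p, 1 ≤ p → p ≤ N → f p * ε ^ p * (R p).card ≤ F₁) :
    ∑ i ∈ I, f i.1 * ‖Φ i.1 i.2‖ ≤ c * h * F₀ + h * F₁ := by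
  classical
  have step : ∑ i ∈ I, f i.1 * ‖Φ i.1 i.2‖ ≤ ∑ p ∈ Finset.range (N + 1), f p *
      ∑ Z ∈ Finset.univ.filter (fun Z : Finset Λ => ¬ Disjoint Z (R p)), ‖Φ p Z‖ := by
    have hsub : I ⊆ (Finset.range (N + 1)).biUnion fun p =>
        (Finset.univ.filter (fun Z : Finset Λ => ¬ Disjoint Z (R p))).map
          ⟨fun Z => (p, Z), fun Z Z' h => (Prod.ext_iff.1 h).2⟩ := by
      intro i hi
      obtain ⟨h1, h2⟩ := hI i hi
      simp only [Finset.mem_biUnion, Finset.mem_range, Finset.mem_map, Finset.mem_filter,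
        Finset.mem_univ, true_and]
      exact ⟨i.1, by omega, i.2, h2, rfl⟩
    refine (Finset.sum_le_sum_of_subset_of_nonneg hsub fun i _ _ =>
      mul_nonneg (hf _) (norm_nonneg _)).trans (le_of_eq ?_)
    rw [Finset.sum_biUnion]
    · refine Finset.sum_congr rfl fun p _ => ?_
      rw [Finset.sum_map, Finset.mul_sum]
      rfl
    · intro p _ q _ hpq
      rw [Function.onFun, Finset.disjoint_left]
      intro i hi hj
      simp only [Finset.mem_map] at hi hj
      obtain ⟨Z, -, rfl⟩ := hi
      obtain ⟨Z', -, h⟩ := hj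
      exact hpq (Prod.ext_iff.1 h).1.symm
  refine step.trans ?_
  rw [Finset.sum_range_succ', add_comm]
  refine add_le_add ?_ ?_
  · refine (mul_le_mul_of_nonneg_left (sum_norm_le_of_touch (Φ 0) (R 0) hS.zero_le)
      (hf 0)).trans ?_
    calc f 0 * ((R 0).card * (c * h)) = c * h * (f 0 * (R 0).card) := by ring
      _ ≤ c * h * F₀ := mul_le_mul_of_nonneg_left h0 (mul_nonneg hS.c_nonneg hS.h_nonneg)
  · have e : ∑ p ∈ Finset.Icc 1 N, w p = ∑ p ∈ Finset.range N, w (p + 1) := by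
      rw [Finset.range_eq_Ico, Finset.sum_Ico_add' w 0 N 1]
      rfl
    have h3 := hS.sum_le
    rw [e] at h3
    calc _ ≤ ∑ p ∈ Finset.range N, w (p + 1) * F₁ := by
          refine Finset.sum_le_sum fun p hp => ?_
          have hp' := Finset.mem_range.1 hp
          refine (mul_le_mul_of_nonneg_left (sum_norm_le_of_touch (Φ (p + 1)) (R (p + 1))
            (hS.order_le (p + 1) (by omega))) (hf _)).trans ?_
          calc f (p + 1) * ((R (p + 1)).card * (ε ^ (p + 1) * w (p + 1)))
              = w (p + 1) * (f (p + 1) * ε ^ (p + 1) * (R (p + 1)).card) := by ring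
            _ ≤ w (p + 1) * F₁ :=
              mul_le_mul_of_nonneg_left (h1 _ (by omega) (by omega)) (hS.nonneg _)
      _ = (∑ p ∈ Finset.range N, w (p + 1)) * F₁ := by rw [Finset.sum_mul]
      _ ≤ h * F₁ := mul_le_mul_of_nonneg_right h3 hF₁

end HasStrength

theorem Dec.sum {ι : Type*} {F : ℕ → Submodule ℂ (Op Λ)} {y : ℝ} (s : Finset ι) {a : ι → Op Λ}
    {n : ι → ℝ} (h : ∀ i ∈ s, Dec F y (a i) (n i)) :
    Dec F y (∑ i ∈ s, a i) (∑ i ∈ s, n i) := by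
  classical
  induction s using Finset.induction_on with
  | empty => simpa using Dec.zero le_rfl
  | insert i s hi ih =>
    rw [Finset.sum_insert hi, Finset.sum_insert hi]
    exact (h i (Finset.mem_insert_self _ _)).add
      (ih fun j hj => h j (Finset.mem_insert_of_mem hj))

variable {c h ε : ℝ} {w : ℕ → ℝ}

/-- A term of order `p ≥ 1` has weight `(y ε) ^ p ≤ ρ ^ p ≤ ρ`; so `y` may be as large as `ρ / ε`,
where `ρ` is dictated by the gap. -/
theorem dec_pertOn (hM : IsModel G k J Φ) (hS : HasStrength N c h ε w Φ) (R : Finset Λ) {y ρ : ℝ}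
    (hy : 1 ≤ y) (hρ : y * ε ≤ ρ) (hρ1 : ρ ≤ 1) :
    Dec (fromOrder 1 (hamLoc G k R)) y (pertOn N Φ R) (h * (ρ * R.card)) := by
  have hε := hS.ε_nonneg
  have hρ0 : 0 ≤ ρ := le_trans (by positivity) hρ
  have hy0 : 0 < y := by linarith
  have h1 : Dec (fromOrder 1 (hamLoc G k R)) y (pertOn N Φ R)
      (∑ i ∈ (bonds N R).filter (fun i => i.1 ≠ 0), y ^ i.1 * ‖Φ i.1 i.2‖) := by
    refine Dec.sum _ fun i hi => Dec.of_mem ?_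
    obtain ⟨hi, h0⟩ := Finset.mem_filter.1 hi
    rw [fromOrder, if_pos (by omega)]
    by_cases hz : Φ i.1 i.2 = 0
    · rw [hz]; exact zero_mem _
    · have hq := hM.range_le _ _ hz
      rw [hopRange, if_neg h0] at hq
      refine mem_locOps (mem_bonds.1 hi).2.2 (hq.trans ?_) (hM.supported _ _)
      have : 1 ≤ i.1 := by omega
      have : 2 * k * 1 ≤ 2 * k * i.1 := Nat.mul_le_mul_left _ this
      rw [add_mul]
      omega
  refine h1.mono ?_
  have h2 := hS.sum_le_of_touch (I := (bonds N R).filter (fun i => i.1 ≠ 0)) (R := fun _ => R)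
    (f := fun p => if p = 0 then 0 else y ^ p) (F₀ := 0) (F₁ := ρ * R.card)
    (fun i hi => by
      obtain ⟨h1, h2, h3⟩ := mem_bonds.1 (Finset.mem_filter.1 hi).1
      refine ⟨h1, fun hd => h2 ?_⟩
      exact Finset.disjoint_self_iff_empty _ |>.1 (hd.mono_right h3))
    (fun p => by positivity) (by simp) (by positivity) (fun p hp _ => by
      rw [if_neg (by omega), ← mul_pow]
      refine mul_le_mul_of_nonneg_right ?_ (Nat.cast_nonneg _)
      have : (y * ε) ^ p ≤ ρ ^ p := by gcongr
      refine this.trans (pow_le_of_le_one hρ0 hρ1 (by omega)))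
  rw [mul_zero, zero_add] at h2
  refine le_trans (le_of_eq (Finset.sum_congr rfl fun i hi => ?_)) h2
  rw [if_neg (Finset.mem_filter.1 hi).2]

theorem one_div_pow_le_rpow {θ y x : ℝ} (hθ0 : 0 < θ) (hθ1 : θ ≤ 1) (hy : 0 < y)
    (h : 1 ≤ θ * y) {m : ℕ} (hx : x ≤ m) : 1 / y ^ m ≤ θ ^ x := by
  have h1 : 1 / y ^ m ≤ θ ^ m := by
    rw [div_le_iff₀ (by positivity), ← mul_pow]
    exact one_le_pow₀ h
  refine h1.trans ?_
  rw [← Real.rpow_natCast]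
  exact Real.rpow_le_rpow_of_exponent_ge hθ0 hθ1 hx

theorem sum_hops_le (hS : HasStrength N c h ε w Φ) (Y R : Finset Λ) {f : ℕ → ℝ}
    (hf : ∀ p, 0 ≤ f p) {F : ℝ} (h0 : f 0 ≤ F) (h1 : ∀ p, 1 ≤ p → f p * ε ^ p ≤ F) :
    ∑ i ∈ hops N Y R, f i.1 * ‖Φ i.1 i.2‖ ≤ (c + 1) * h * R.card * F := by
  have hF : 0 ≤ F := (hf 0).trans h0
  refine (hS.sum_le_of_touch (I := hops N Y R) (R := fun _ => R) (F₀ := F * R.card)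
    (F₁ := F * R.card) (fun i hi => ?_) hf ?_ ?_ ?_).trans (le_of_eq (by ring))
  · obtain ⟨h1, -, -, h2⟩ := mem_hops.1 hi
    exact ⟨h1, h2⟩
  · gcongr
  · positivity
  · intro p hp _
    have := h1 p hp
    gcongr

/-- A hop into a resonant region, or a long hop. -/
theorem norm_lie_heis_le_of_commute (hM : IsModel G k J Φ) (hS : HasStrength N c h ε w Φ)
    {Y R S₁ : Finset Λ} (hRY : R ⊆ Y) (hSY : S₁ ⊆ Y) (hSR : Disjoint R S₁) {A O : Op Λ}
    (hA : A ∈ suppAlg S₁) (hO : O ∈ suppAlg (R ∪ Yᶜ)) {θ l κ s : ℝ} (hθ0 : 0 < θ) (hθ1 : θ ≤ 1)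
    (hεθ : ε ≤ θ) (hl : 0 < l) (hs : 0 ≤ s) (hκ0 : 0 ≤ κ)
    (hκ : ∀ i ∈ hops N Y R, ∀ u, 0 ≤ u → ‖⁅Φ i.1 i.2, heis (hamOn N Φ (Y \ R)) u A⁆‖ ≤
      ‖Φ i.1 i.2‖ * (κ * θ ^ (-(i.1 : ℝ) / 2)) * Real.exp (l * u)) :
    ‖⁅O, heis (hamOn N Φ Y) s A⁆‖ ≤
      2 * ‖O‖ * ((c + 1) * h * R.card * κ) * ((Real.exp (l * s) - 1) / l) := by
  have h1 := hM.norm_lie_heis_le hRY hA hSR O hl hs hκ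
  have h2 : ⁅O, heis (hamOn N Φ (Y \ R)) s A⁆ = 0 := by
    refine lie_eq_zero_of_commute (Commute.heis_right ?_ ?_ s)
    · refine commute_of_disjoint ?_ hO (hM.hamOn_mem _)
      rw [Finset.disjoint_left]
      intro v hv hv'
      obtain ⟨h3, h4⟩ := Finset.mem_sdiff.1 hv'
      rcases Finset.mem_union.1 hv with h | h
      · exact h4 h
      · exact Finset.mem_compl.1 h h3
    · refine commute_of_disjoint ?_ hO hA
      rw [Finset.disjoint_union_left]
      exact ⟨hSR, Finset.disjoint_left.2 fun v hv hv' => Finset.mem_compl.1 hv (hSY hv')⟩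
  have h3 : ∑ i ∈ hops N Y R, ‖Φ i.1 i.2‖ * (κ * θ ^ (-(i.1 : ℝ) / 2)) ≤
      (c + 1) * h * R.card * κ := by
    refine le_trans (le_of_eq (Finset.sum_congr rfl fun i _ => mul_comm _ _))
      (sum_hops_le hS Y R (f := fun p => κ * θ ^ (-(p : ℝ) / 2)) (fun p => by positivity)
        (by simp) fun p _ => ?_)
    rw [mul_assoc]
    refine mul_le_of_le_one_right hκ0 ?_
    -- Half of the smallness `θ ^ p` of a hop of order `p` pays for the weaker bound, by `θ ^
    -- (-p/2)`, that is assumed for its commutator.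
    calc θ ^ (-(p : ℝ) / 2) * ε ^ p ≤ θ ^ (-(p : ℝ) / 2) * θ ^ p := by
          have := pow_le_pow_left₀ hS.ε_nonneg hεθ p
          gcongr
      _ = θ ^ ((p : ℝ) / 2) := by
          rw [← Real.rpow_natCast, ← Real.rpow_add hθ0]; congr 1; ring
      _ ≤ 1 := Real.rpow_le_one hθ0.le hθ1 (by positivity)
  rw [h2, norm_zero, zero_add] at h1
  refine h1.trans ?_
  have h4 : 0 ≤ (Real.exp (l * s) - 1) / l := by
    have := Real.add_one_le_exp (l * s)
    have : 0 ≤ l * s := by positivity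
    exact div_nonneg (by linarith) hl.le
  rw [mul_assoc (2 * ‖O‖), mul_div_assoc]
  gcongr

/-- The quantitative form of the decoupling in a non-resonant region. -/
theorem exists_decoupling_bounds (hG : G.Connected) (hM : IsModel G k J Φ)
    (hS : HasStrength N c h ε w Φ) {Y R X S₁ : Finset Λ}
    (hRY : R ⊆ Y) (hXR : X ⊆ R) (hSY : S₁ ⊆ Y) (hSR : Disjoint R S₁) {A O : Op Λ}
    (hA : A ∈ suppAlg S₁) (hO : O ∈ suppAlg (X ∪ Yᶜ)) {g y ρ θ γ : ℝ} (hg : 0 < g)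
    (hgap : HasGap J R g) (hy : 1 ≤ y) (hρ : y * ε ≤ ρ) (hρ1 : ρ ≤ 1)
    (hgρ : 80 * R.card * (h * (ρ * R.card)) ≤ g) (hθ0 : 0 < θ) (hθ1 : θ ≤ 1) (hεθ : ε ≤ θ)
    (hθy : 1 ≤ θ * y) {a : ℕ} {τ : ℕ → ℕ} (ha : γ ≤ a + 1) (hτ : ∀ p : ℕ, γ - p / 2 ≤ τ p)
    (hfar : ∀ i ∈ hops N Y R, Φ i.1 i.2 ≠ 0 → 0 < τ i.1 → ∀ u ∈ X, ∀ w ∈ i.2, w ∈ R →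
      (2 * k + 1) * a + ((2 * k + 1) * a + k) + (2 * k + 1) * (τ i.1 - 1) < G.dist u w) :
    ∃ K E O₁ O₂ : Op Λ, hamOn N Φ Y = K + E ∧ IsSelfAdjoint K ∧ IsSelfAdjoint E ∧
      O = O₁ + O₂ ∧ ‖O₁‖ ≤ ‖O‖ ∧ (∀ u, ⁅O₁, heis K u A⁆ = 0) ∧ ‖O₂‖ ≤ 4 * ‖O‖ * θ ^ γ ∧
      O₂ ∈ suppAlg (R ∪ Yᶜ) ∧ ‖E‖ ≤ 7 * ((c + 1) * h * R.card) * θ ^ γ ∧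
      ∀ B κ, 0 ≤ κ → (∀ C ∈ suppAlg R, Commute C B) →
        (∀ i ∈ hops N Y R, ‖⁅Φ i.1 i.2, B⁆‖ ≤ ‖Φ i.1 i.2‖ * (κ * θ ^ (-(i.1 : ℝ) / 2))) →
        ‖⁅E, B⁆‖ ≤ 4 * κ * ((c + 1) * h * R.card) * θ ^ γ := by
  have hy0 : 0 < y := by linarith
  have hc0 := hS.c_nonneg
  have hh0 := hS.h_nonneg
  have hρ0 : 0 ≤ ρ := le_trans (mul_nonneg hy0.le hS.ε_nonneg) hρ
  obtain ⟨K, E, O₁, O₂, h1, h2, h3, h4, h5, h6, h7, h8, h9, h10⟩ :=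
    exists_decoupling hG hM hRY hXR hSY hSR hA hO hg hgap hy (dec_pertOn hM hS R hy hρ hρ1) hgρ a τ
      hfar
  have ha' : 1 / y ^ (a + 1) ≤ θ ^ γ :=
    one_div_pow_le_rpow hθ0 hθ1 hy0 hθy (by push_cast; exact ha)
  have hτ' : ∀ p : ℕ, 1 / y ^ τ p ≤ θ ^ (γ - p / 2) := fun p =>
    one_div_pow_le_rpow hθ0 hθ1 hy0 hθy (hτ p)
  have hεp : ∀ p : ℕ, ε ^ p ≤ θ ^ (p : ℝ) := fun p => by
    rw [Real.rpow_natCast]; exact pow_le_pow_left₀ hS.ε_nonneg hεθ p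
  refine ⟨K, E, O₁, O₂, h1, h2, h3, h4, h5, h6, h7.trans ?_, h8, h9.trans ?_, ?_⟩
  · rw [← mul_one_div]; gcongr
  · have e1 : ∑ i ∈ hops N Y R, 4 * ‖Φ i.1 i.2‖ / y ^ τ i.1 ≤
        (c + 1) * h * R.card * (4 * θ ^ γ) := by
      refine le_trans (le_of_eq (Finset.sum_congr rfl fun i _ => ?_))
        (sum_hops_le hS Y R (f := fun p => 4 * (1 / y ^ τ p)) (fun p => by positivity) ?_
          fun p _ => ?_)
      · ring
      · have := hτ' 0
        simp only [Nat.cast_zero, zero_div, sub_zero] at this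
        linarith
      · rw [mul_assoc]
        refine mul_le_mul_of_nonneg_left ?_ (by norm_num)
        calc 1 / y ^ τ p * ε ^ p ≤ θ ^ (γ - p / 2) * θ ^ (p : ℝ) :=
              mul_le_mul (hτ' p) (hεp p) (pow_nonneg hS.ε_nonneg _) (by positivity)
          _ = θ ^ (γ + p / 2) := by rw [← Real.rpow_add hθ0]; congr 1; ring
          _ ≤ θ ^ γ := Real.rpow_le_rpow_of_exponent_ge hθ0 hθ1 (by
              have : (0 : ℝ) ≤ (p : ℝ) / 2 := by positivity
              linarith)
    have e2 : 3 * (h * (ρ * R.card)) / y ^ (a + 1) ≤ 3 * ((c + 1) * h * R.card) * θ ^ γ := by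
      rw [← mul_one_div]
      refine mul_le_mul ?_ ha' (by positivity) (by positivity)
      refine mul_le_mul_of_nonneg_left ?_ (by norm_num)
      have : h * (ρ * R.card) ≤ h * (1 * R.card) := by gcongr
      refine this.trans ?_
      have h11 : 0 ≤ h * R.card := by positivity
      nlinarith
    linarith
  · intro B κ hκ hB hΦ
    refine (h10 B hB).trans ?_
    refine le_trans (Finset.sum_le_sum (g := fun i =>
      4 * κ * θ ^ (-(i.1 : ℝ) / 2) * (1 / y ^ τ i.1) * ‖Φ i.1 i.2‖) fun i hi => ?_) ?_
    · have := hΦ i hi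
      calc 4 * ‖⁅Φ i.1 i.2, B⁆‖ / y ^ τ i.1
          ≤ 4 * (‖Φ i.1 i.2‖ * (κ * θ ^ (-(i.1 : ℝ) / 2))) / y ^ τ i.1 := by gcongr
        _ = _ := by ring
    · refine (sum_hops_le hS Y R (f := fun p => 4 * κ * θ ^ (-(p : ℝ) / 2) * (1 / y ^ τ p))
        (F := 4 * κ * θ ^ γ) (fun p => by positivity) ?_ fun p _ => ?_).trans (le_of_eq (by ring))
      · have := hτ' 0
        simp only [Nat.cast_zero, zero_div, sub_zero, neg_zero, Real.rpow_zero, mul_one] at this ⊢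
        gcongr
      · rw [mul_assoc (4 * κ), mul_assoc (4 * κ)]
        refine mul_le_mul_of_nonneg_left ?_ (by positivity)
        -- The exponents `-p/2`, `γ - p/2` and `p` add up to `γ`: this balance is why a hop of order
        -- `p` needs a rotation tail of order only `γ - p/2`.
        calc θ ^ (-(p : ℝ) / 2) * (1 / y ^ τ p) * ε ^ p
            ≤ θ ^ (-(p : ℝ) / 2) * θ ^ (γ - p / 2) * θ ^ (p : ℝ) := by
              refine mul_le_mul (mul_le_mul_of_nonneg_left (hτ' p) (by positivity)) (hεp p)
                (pow_nonneg hS.ε_nonneg _) (by positivity)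
          _ = θ ^ γ := by
              rw [← Real.rpow_add hθ0, ← Real.rpow_add hθ0]; congr 1; ring
set_option maxHeartbeats 1000000 in
/-- A hop into a non-resonant region: without information on the following hops, and with it. -/
theorem norm_lie_heis_le_of_gap (hG : G.Connected) (hM : IsModel G k J Φ)
    (hS : HasStrength N c h ε w Φ) {Y R X S₁ : Finset Λ}
    (hRY : R ⊆ Y) (hXR : X ⊆ R) (hSY : S₁ ⊆ Y) (hSR : Disjoint R S₁) {A O : Op Λ}
    (hA : A ∈ suppAlg S₁) (hO : O ∈ suppAlg (X ∪ Yᶜ)) {g y ρ θ γ : ℝ} (hg : 0 < g)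
    (hgap : HasGap J R g) (hy : 1 ≤ y) (hρ : y * ε ≤ ρ) (hρ1 : ρ ≤ 1)
    (hgρ : 80 * R.card * (h * (ρ * R.card)) ≤ g) (hθ0 : 0 < θ) (hθ1 : θ ≤ 1) (hεθ : ε ≤ θ)
    (hθy : 1 ≤ θ * y) {a : ℕ} {τ : ℕ → ℕ} (ha : γ ≤ a + 1) (hτ : ∀ p : ℕ, γ - p / 2 ≤ τ p)
    (hfar : ∀ i ∈ hops N Y R, Φ i.1 i.2 ≠ 0 → 0 < τ i.1 → ∀ u ∈ X, ∀ w ∈ i.2, w ∈ R →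
      (2 * k + 1) * a + ((2 * k + 1) * a + k) + (2 * k + 1) * (τ i.1 - 1) < G.dist u w)
    {l : ℝ} (hl : 0 < l) {n : ℝ} (hn : (c + 1) * h * R.card ≤ n) :
    (∀ s, 0 ≤ s → ‖⁅O, heis (hamOn N Φ Y) s A⁆‖ ≤
      ‖O‖ * ‖A‖ * θ ^ γ * (28 * (n / l) + 8) * Real.exp (l * s)) ∧
    ∀ κ, 0 ≤ κ → (∀ i ∈ hops N Y R, ∀ u, 0 ≤ u →
      ‖⁅Φ i.1 i.2, heis (hamOn N Φ (Y \ R)) u A⁆‖ ≤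
        ‖Φ i.1 i.2‖ * (κ * θ ^ (-(i.1 : ℝ) / 2)) * Real.exp (l * u)) →
      ∀ s, 0 ≤ s → ‖⁅O, heis (hamOn N Φ Y) s A⁆‖ ≤
        ‖O‖ * κ * θ ^ γ * (16 * (n / l) + 28 * (n / l) ^ 2) * Real.exp (l * s) := by
  have hc0 := hS.c_nonneg
  have hh0 := hS.h_nonneg
  have hn0 : 0 ≤ n := le_trans (by positivity) hn
  obtain ⟨K, E, O₁, O₂, h1, h2, h3, h4, h5, h6, h7, h8, h9, h10⟩ :=
    exists_decoupling_bounds hG hM hS hRY hXR hSY hSR hA hO hg hgap hy hρ hρ1 hgρ hθ0 hθ1 hεθ hθy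
      ha hτ hfar
  have hE : ‖E‖ ≤ 7 * n * θ ^ γ := h9.trans (by gcongr)
  have hHs := hM.isSelfAdjoint_hamOn (N := N) Y
  have hKE : hamOn N Φ Y + -E = K := by rw [h1]; abel
  have hneg : ∀ B : Op Λ, ‖⁅-E, B⁆‖ = ‖⁅E, B⁆‖ := fun B => by
    rw [← norm_neg, Ring.lie_def, Ring.lie_def, neg_mul, mul_neg]; congr 1; abel
  have hq : ∀ s, 0 ≤ s → 0 ≤ (Real.exp (l * s) - 1) / l := fun s hs => by
    have := Real.add_one_le_exp (l * s)
    have : 0 ≤ l * s := by positivity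
    exact div_nonneg (by linarith) hl.le
  -- Since `O₁` commutes with the evolution under `K`, only the difference between the two
  -- evolutions counts, and Duhamel's formula expresses it by the commutator of `E` with the full
  -- evolution.
  have main : ∀ κ, ∀ s, 0 ≤ s → (∀ u, 0 ≤ u → ‖⁅E, heis (hamOn N Φ Y) u A⁆‖ ≤
      κ * Real.exp (l * u)) → 0 ≤ κ → ‖⁅O, heis (hamOn N Φ Y) s A⁆‖ ≤
      2 * ‖O‖ * (κ * (Real.exp (l * s) / l)) + ‖⁅O₂, heis (hamOn N Φ Y) s A⁆‖ := by
    intro κ s hs hκ hκ0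
    have hd := norm_heis_add_sub_heis_le hHs h3.neg A hl hs (κ := κ)
      (fun u hu _ => by rw [hneg]; exact hκ u hu)
    rw [hKE] at hd
    have e : ⁅O, heis (hamOn N Φ Y) s A⁆ =
        -⁅O₁, heis K s A - heis (hamOn N Φ Y) s A⁆ + ⁅O₂, heis (hamOn N Φ Y) s A⁆ := by
      have e1 : ⁅O₁, heis K s A - heis (hamOn N Φ Y) s A⁆ =
          ⁅O₁, heis K s A⁆ - ⁅O₁, heis (hamOn N Φ Y) s A⁆ := by
        simp only [Ring.lie_def, mul_sub, sub_mul]; abel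
      rw [e1, h6, h4]
      simp only [Ring.lie_def, add_mul, mul_add]
      abel
    rw [e]
    refine (norm_add_le _ _).trans (add_le_add ?_ le_rfl)
    rw [norm_neg]
    refine (norm_lie_le' _ _).trans ?_
    have h11 := exp_sub_one_div_le (l := l) (s := s) hl
    rw [mul_div_assoc] at hd
    have h12 : ‖heis K s A - heis (hamOn N Φ Y) s A‖ ≤ κ * (Real.exp (l * s) / l) :=
      hd.trans (by gcongr)
    gcongr
  constructor
  · intro s hs
    have hA2 : ∀ u, ‖heis (hamOn N Φ Y) u A‖ = ‖A‖ := fun u => norm_heis hHs u A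
    refine (main (14 * n * θ ^ γ * ‖A‖) s hs (fun u hu => ?_) (by positivity)).trans ?_
    · refine (norm_lie_le' _ _).trans ?_
      rw [hA2]
      have h11 : 1 ≤ Real.exp (l * u) := Real.one_le_exp (by positivity)
      calc 2 * ‖E‖ * ‖A‖ ≤ 2 * (7 * n * θ ^ γ) * ‖A‖ := by gcongr
        _ = 14 * n * θ ^ γ * ‖A‖ * 1 := by ring
        _ ≤ _ := by gcongr
    · have h12 := norm_lie_le' O₂ (heis (hamOn N Φ Y) s A)
      rw [hA2] at h12
      have h11 : 1 ≤ Real.exp (l * s) := Real.one_le_exp (by positivity)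
      have h13 : 2 * ‖O₂‖ * ‖A‖ ≤ 8 * ‖O‖ * θ ^ γ * ‖A‖ * Real.exp (l * s) := by
        calc 2 * ‖O₂‖ * ‖A‖ ≤ 2 * (4 * ‖O‖ * θ ^ γ) * ‖A‖ := by gcongr
          _ = 8 * ‖O‖ * θ ^ γ * ‖A‖ * 1 := by ring
          _ ≤ _ := by gcongr
      refine (add_le_add le_rfl (h12.trans h13)).trans (le_of_eq ?_)
      field_simp
      ring
  · intro κ hκ0 hκ s hs
    have hRc : R ⊆ R ∪ Yᶜ := Finset.subset_union_left
    have hΦsum : ∑ i ∈ hops N Y R, ‖Φ i.1 i.2‖ * (κ * θ ^ (-(i.1 : ℝ) / 2)) ≤ n * κ := by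
      refine le_trans (le_of_eq (Finset.sum_congr rfl fun i _ => mul_comm _ _))
        ((sum_hops_le hS Y R (f := fun p => κ * θ ^ (-(p : ℝ) / 2)) (fun p => by positivity)
          (by simp) (F := κ) fun p _ => ?_).trans (by gcongr))
      rw [mul_assoc]
      refine mul_le_of_le_one_right hκ0 ?_
      calc θ ^ (-(p : ℝ) / 2) * ε ^ p ≤ θ ^ (-(p : ℝ) / 2) * θ ^ p := by
            have := pow_le_pow_left₀ hS.ε_nonneg hεθ p
            gcongr
        _ = θ ^ ((p : ℝ) / 2) := by
            rw [← Real.rpow_natCast, ← Real.rpow_add hθ0]; congr 1; ring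
        _ ≤ 1 := Real.rpow_le_one hθ0.le hθ1 (by positivity)
    have hcross : ∀ (Q : Op Λ) (u : ℝ), 0 ≤ u → ‖⁅Q, heis (hamOn N Φ Y) u A⁆‖ ≤
        ‖⁅Q, heis (hamOn N Φ (Y \ R)) u A⁆‖ + 2 * ‖Q‖ * (n * κ * (Real.exp (l * u) / l)) := by
      intro Q u hu
      refine (hM.norm_lie_heis_le hRY hA hSR Q hl hu hκ).trans (add_le_add le_rfl ?_)
      have h11 := exp_sub_one_div_le (l := l) (s := u) hl
      have h12 := hq u hu
      rw [mul_div_assoc]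
      gcongr
    have hB : ∀ u, ∀ C ∈ suppAlg R, Commute C (heis (hamOn N Φ (Y \ R)) u A) := fun u C hC =>
      Commute.heis_right (commute_of_disjoint Finset.disjoint_sdiff hC (hM.hamOn_mem _))
        (commute_of_disjoint hSR hC hA) u
    -- A second Duhamel step, now removing the hops. The first summand uses that `E` is small
    -- relative to the commutators of the hops. The second carries another `n / l`, whence the
    -- square in the conclusion.
    have hEu : ∀ u, 0 ≤ u → ‖⁅E, heis (hamOn N Φ Y) u A⁆‖ ≤
        (4 * κ * n * θ ^ γ + 14 * n * θ ^ γ * (n * κ) / l) * Real.exp (l * u) := by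
      intro u hu
      have h11 := h10 _ (κ * Real.exp (l * u)) (by positivity) (hB u) (fun i hi => by
        refine (hκ i hi u hu).trans (le_of_eq (by ring)))
      refine (hcross E u hu).trans ?_
      calc _ ≤ 4 * (κ * Real.exp (l * u)) * n * θ ^ γ +
            2 * (7 * n * θ ^ γ) * (n * κ * (Real.exp (l * u) / l)) := by
            refine add_le_add (h11.trans ?_) ?_ <;> gcongr
        _ = _ := by ring
    refine (main _ s hs hEu (by positivity)).trans ?_
    have h12 := hcross O₂ s hs
    have h13 : ⁅O₂, heis (hamOn N Φ (Y \ R)) s A⁆ = 0 := by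
      refine lie_eq_zero_of_commute (Commute.heis_right ?_ ?_ s)
      · refine commute_of_disjoint ?_ h8 (hM.hamOn_mem _)
        rw [Finset.disjoint_left]
        intro v hv hv'
        obtain ⟨h3, h4⟩ := Finset.mem_sdiff.1 hv'
        rcases Finset.mem_union.1 hv with h | h
        · exact h4 h
        · exact Finset.mem_compl.1 h h3
      · refine commute_of_disjoint ?_ h8 hA
        rw [Finset.disjoint_union_left]
        exact ⟨hSR, Finset.disjoint_left.2 fun v hv hv' => Finset.mem_compl.1 hv (hSY hv')⟩
    rw [h13, norm_zero, zero_add] at h12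
    calc _ ≤ 2 * ‖O‖ * ((4 * κ * n * θ ^ γ + 14 * n * θ ^ γ * (n * κ) / l) *
          (Real.exp (l * s) / l)) + 2 * (4 * ‖O‖ * θ ^ γ) * (n * κ * (Real.exp (l * s) / l)) := by
          refine add_le_add le_rfl (h12.trans ?_)
          gcongr
      _ = _ := by field_simp; ring

end Step

/-! ### Paths -/

section Paths

variable {Λ : Type*} [Fintype Λ] [LinearOrder Λ] {G : SimpleGraph Λ}

theorem mem_ball {x y : Λ} {r : ℕ} : y ∈ ball G x r ↔ G.dist x y ≤ r := by simp [ball]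

/-- A geodesic from `w ∈ T` to `v ∉ T` leaves `T` along some edge `z, y`. -/
theorem exists_adj_dist_lt (hG : G.Connected) {T : Finset Λ} {v : Λ} (hv : v ∉ T) (m : ℕ) :
    ∀ w ∈ T, G.dist w v ≤ m → ∃ y ∉ T, ∃ z ∈ T, G.Adj y z ∧ G.dist y v + 1 ≤ m ∧
      G.dist w z + 1 + G.dist y v ≤ m := by
  induction m with
  | zero =>
    intro w hw h
    have : w = v := hG.dist_eq_zero_iff.1 (by omega)
    exact absurd (this ▸ hw) hv
  | succ m ih =>
    intro w hw h
    obtain ⟨p, hp⟩ := hG.exists_walk_length_eq_dist w v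
    cases p with
    | nil => exact absurd hw hv
    | @cons _ u _ had p' =>
      rw [SimpleGraph.Walk.length_cons] at hp
      have hd : G.dist u v ≤ m := (SimpleGraph.dist_le p').trans (by omega)
      by_cases hu : u ∈ T
      · obtain ⟨y, hy, z, hz, h1, h2, h3⟩ := ih u hu hd
        refine ⟨y, hy, z, hz, h1, by omega, ?_⟩
        have h4 := hG.dist_triangle (u := w) (v := u) (w := z)
        have h5 : G.dist w u = 1 := SimpleGraph.dist_eq_one_iff_adj.2 had
        omega
      · refine ⟨u, hu, w, hw, had.symm, by omega, ?_⟩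
        rw [SimpleGraph.dist_self]; omega

theorem mem_boundary_compl {T : Finset Λ} {y : Λ} :
    y ∈ boundary G Tᶜ ↔ y ∉ T ∧ ∃ z ∈ T, G.Adj y z := by
  simp [boundary]

theorem mem_boundary {T : Finset Λ} {y : Λ} :
    y ∈ boundary G T ↔ y ∈ T ∧ ∃ z, z ∉ T ∧ G.Adj y z := by
  simp [boundary]

theorem mem_centers {rs : ℕ} {T Γ : Finset Λ} {y : Λ} :
    y ∈ centers G rs T Γ ↔ y ∈ boundary G Tᶜ ∧ Γ \ T ⊆ ball G y rs := by
  simp [centers]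

/-- A set that grows the interior by itself. -/
theorem exists_saturated_step (rs : ℕ) {T W : Finset Λ} {a : Λ} (ha : a ∈ T)
    (hW : Disjoint W T) : ∃ S : Finset Λ, a ∈ S ∧ W ⊆ S ∧ (∀ v ∈ S, v ∈ T → v = a) ∧
      grow G rs T S = T ∪ S ∧
      ((∃ hc : (centers G rs T S).Nonempty,
        T ∪ S = T ∪ ball G ((centers G rs T S).min' hc) rs ∧
        W ⊆ ball G ((centers G rs T S).min' hc) rs) ∨
      (¬ (centers G rs T S).Nonempty ∧ S = insert a W)) := by
  classical
  have hsd : (insert a W) \ T = W := by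
    rw [Finset.insert_sdiff_of_mem _ ha, Finset.sdiff_eq_self_of_disjoint hW]
  by_cases hc : (centers G rs T (insert a W)).Nonempty
  · set y := (centers G rs T (insert a W)).min' hc with hy
    have hyc : y ∈ centers G rs T (insert a W) := Finset.min'_mem _ _
    obtain ⟨hyb, hyW⟩ := mem_centers.1 hyc
    rw [hsd] at hyW
    -- Filling up with the ball makes the new interior exactly `T ∪ S`. It does not change the least
    -- center: a center for `S` is also one for the smaller set `insert a W`, and `y` remains a
    -- center.
    set S := insert a W ∪ (ball G y rs \ T) with hS
    have hST : S \ T = ball G y rs \ T := by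
      rw [hS, Finset.union_sdiff_distrib, hsd, sdiff_idem]
      exact Finset.union_eq_right.2 (Finset.subset_sdiff.2 ⟨hyW, hW⟩)
    have hyS : y ∈ centers G rs T S := mem_centers.2 ⟨hyb, by rw [hST]; exact Finset.sdiff_subset⟩
    have hcS : (centers G rs T S).Nonempty := ⟨y, hyS⟩
    have hmin : (centers G rs T S).min' hcS = y := by
      refine le_antisymm (Finset.min'_le _ _ hyS) ?_
      refine Finset.min'_le _ _ ?_
      obtain ⟨h1, h2⟩ := mem_centers.1 (Finset.min'_mem _ hcS)
      refine mem_centers.2 ⟨h1, (Finset.sdiff_subset_sdiff ?_ le_rfl).trans h2⟩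
      exact Finset.subset_union_left
    have hTS : T ∪ S = T ∪ ball G y rs := by
      rw [← Finset.union_sdiff_self_eq_union, hST, Finset.union_sdiff_self_eq_union]
    refine ⟨S, ?_, ?_, ?_, ?_, Or.inl ⟨hcS, by rw [hmin, hTS], by rw [hmin]; exact hyW⟩⟩
    · exact Finset.mem_union_left _ (Finset.mem_insert_self _ _)
    · exact (Finset.subset_insert _ _).trans Finset.subset_union_left
    · intro v hv hvT
      rcases Finset.mem_union.1 hv with h | h
      · rcases Finset.mem_insert.1 h with h | h
        · exact h
        · exact absurd hvT (Finset.disjoint_left.1 hW h)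
      · exact absurd hvT (Finset.mem_sdiff.1 h).2
    · rw [grow, dif_pos hcS, hmin, hTS]
  · refine ⟨insert a W, Finset.mem_insert_self _ _, Finset.subset_insert _ _, ?_, ?_,
      Or.inr ⟨hc, rfl⟩⟩
    · intro v hv hvT
      rcases Finset.mem_insert.1 hv with h | h
      · exact h
      · exact absurd hvT (Finset.disjoint_left.1 hW h)
    · rw [grow, dif_neg hc]

theorem sdiff_subset_grow (rs : ℕ) (T S : Finset Λ) : T ∪ S ⊆ grow G rs T S := by
  classical
  unfold grow
  split_ifs with hc
  · have := (mem_centers.1 (Finset.min'_mem _ hc)).2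
    rw [← Finset.union_sdiff_self_eq_union]
    exact Finset.union_subset_union_right this
  · exact le_rfl

theorem pathInterior_congr {rs : ℕ} {S₀ : Finset Λ} {Γ Γ' : ℕ → Finset Λ} (i : ℕ)
    (h : ∀ j < i, Γ j = Γ' j) : pathInterior G rs S₀ Γ i = pathInterior G rs S₀ Γ' i := by
  induction i with
  | zero => rfl
  | succ i ih =>
    rw [pathInterior, pathInterior, ih fun j hj => h j (by omega), h i (by omega)]

theorem pathInterior_mono {rs : ℕ} {S₀ : Finset Λ} {Γ : ℕ → Finset Λ} :
    Monotone (pathInterior G rs S₀ Γ) := by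
  refine monotone_nat_of_le_succ fun i => ?_
  rw [pathInterior]
  exact Finset.subset_union_left.trans (sdiff_subset_grow rs _ _)

/-- The first `i` steps of a path that has not reached the distance `n_* (r_* + 1)` yet. -/
structure IsPrefix (G : SimpleGraph Λ) (rs ns : ℕ) (S₀ : Finset Λ) (Γ : ℕ → Finset Λ) (i : ℕ) :
    Prop where
  avoids : ∀ j, j + 1 < i → Disjoint (Γ (j + 1)) (pathInterior G rs S₀ Γ j)
  meets_interior : ∀ j < i, (Γ j ∩ pathInterior G rs S₀ Γ j).Nonempty
  meets_exterior : ∀ j < i, (Γ j \ pathInterior G rs S₀ Γ j).Nonempty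
  not_far : ∀ j < i, ¬ IsFar G rs ns S₀ (Γ j)

theorem resonantSteps_mono {J : Finset Λ → ℝ} {h Δ : ℝ} {rs : ℕ} {S₀ : Finset Λ}
    {Γ : ℕ → Finset Λ} {i j : ℕ} (hij : i ≤ j) :
    resonantSteps G J h Δ rs S₀ Γ i ⊆ resonantSteps G J h Δ rs S₀ Γ j := by
  intro a ha
  simp only [resonantSteps, Finset.mem_filter, Finset.mem_range] at ha ⊢
  exact ⟨by omega, ha.2⟩

theorem resonantSteps_congr {J : Finset Λ → ℝ} {h Δ : ℝ} {rs : ℕ} {S₀ : Finset Λ}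
    {Γ Γ' : ℕ → Finset Λ} {i : ℕ} (hΓ : ∀ j < i, Γ j = Γ' j) :
    resonantSteps G J h Δ rs S₀ Γ i = resonantSteps G J h Δ rs S₀ Γ' i := by
  ext a
  simp only [resonantSteps, Finset.mem_filter, Finset.mem_range]
  refine and_congr_right fun ha => ?_
  rw [pathInterior_congr a fun j hj => hΓ j (by omega), hΓ a ha]

theorem card_resonantSteps_succ {J : Finset Λ → ℝ} {h Δ : ℝ} {rs : ℕ} {S₀ : Finset Λ}
    {Γ : ℕ → Finset Λ} {i : ℕ}
    (hc : (centers G rs (pathInterior G rs S₀ Γ i) (Γ i)).Nonempty)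
    (hr : ¬ NonResonantBall G J h Δ rs
      ((centers G rs (pathInterior G rs S₀ Γ i) (Γ i)).min' hc)) :
    (resonantSteps G J h Δ rs S₀ Γ i).card + 1 ≤
      (resonantSteps G J h Δ rs S₀ Γ (i + 1)).card := by
  classical
  have h1 : i ∉ resonantSteps G J h Δ rs S₀ Γ i := by simp [resonantSteps]
  rw [← Finset.card_insert_of_notMem h1]
  refine Finset.card_le_card (Finset.insert_subset ?_ (resonantSteps_mono (Nat.le_succ i)))
  simp only [resonantSteps, Finset.mem_filter, Finset.mem_range]
  exact ⟨Nat.lt_succ_self i, hc, hr⟩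

namespace IsPrefix

variable {rs ns : ℕ} {S₀ : Finset Λ} {Γ Γ' : ℕ → Finset Λ} {i : ℕ}

theorem congr (h : IsPrefix G rs ns S₀ Γ i) (hΓ : ∀ j < i, Γ j = Γ' j) :
    IsPrefix G rs ns S₀ Γ' i := by
  have e : ∀ j < i, pathInterior G rs S₀ Γ' j = pathInterior G rs S₀ Γ j := fun j hj =>
    (pathInterior_congr j fun a ha => hΓ a (by omega)).symm
  refine ⟨fun j hj => ?_, fun j hj => ?_, fun j hj => ?_, fun j hj => ?_⟩
  · rw [e j (by omega), ← hΓ _ hj]; exact h.avoids j hj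
  · rw [e j hj, ← hΓ j hj]; exact h.meets_interior j hj
  · rw [e j hj, ← hΓ j hj]; exact h.meets_exterior j hj
  · rw [← hΓ j hj]; exact h.not_far j hj

theorem succ (h : IsPrefix G rs ns S₀ Γ i)
    (h1 : ∀ j, j + 1 = i → Disjoint (Γ i) (pathInterior G rs S₀ Γ j))
    (h2 : (Γ i ∩ pathInterior G rs S₀ Γ i).Nonempty)
    (h3 : (Γ i \ pathInterior G rs S₀ Γ i).Nonempty) (h4 : ¬ IsFar G rs ns S₀ (Γ i)) :
    IsPrefix G rs ns S₀ Γ (i + 1) := by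
  refine ⟨fun j hj => ?_, fun j hj => ?_, fun j hj => ?_, fun j hj => ?_⟩
  · rcases Nat.lt_or_ge (j + 1) i with h5 | h5
    · exact h.avoids j h5
    · have : j + 1 = i := by omega
      rw [this]; exact h1 j this
  all_goals rcases Nat.lt_or_ge j i with h5 | h5
  · exact h.meets_interior j h5
  · rw [show j = i by omega]; exact h2
  · exact h.meets_exterior j h5
  · rw [show j = i by omega]; exact h3
  · exact h.not_far j h5
  · rw [show j = i by omega]; exact h4

theorem isPath (h : IsPrefix G rs ns S₀ Γ i)
    (h1 : ∀ j, j + 1 = i → Disjoint (Γ i) (pathInterior G rs S₀ Γ j))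
    (h2 : (Γ i ∩ pathInterior G rs S₀ Γ i).Nonempty)
    (h3 : (Γ i \ pathInterior G rs S₀ Γ i).Nonempty) (hi : i ≤ ns)
    (h4 : i = ns ∨ IsFar G rs ns S₀ (Γ i)) : IsPath G rs ns S₀ Γ (i + 1) := by
  refine ⟨by omega, by omega, fun j hj => ?_, fun j hj => ?_, fun j hj => ?_,
    fun j hj => h.not_far j (by omega), fun j hj => ?_⟩
  · rcases Nat.lt_or_ge (j + 1) i with h5 | h5
    · exact h.avoids j h5
    · have : j + 1 = i := by omega
      rw [this]; exact h1 j this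
  · rcases Nat.lt_or_ge j i with h5 | h5
    · exact h.meets_interior j h5
    · rw [show j = i by omega]; exact h2
  · rcases Nat.lt_or_ge j i with h5 | h5
    · exact h.meets_exterior j h5
    · rw [show j = i by omega]; exact h3
  · rw [show j = i by omega]; exact h4

/-- The number of resonant steps at the end of a path. -/
theorem card_resonantSteps_le {J : Finset Λ → ℝ} {h Δ ζ : ℝ} {x : Λ}
    (hP : ∀ (Γ : ℕ → Finset Λ) (l : ℕ), IsPath G rs ns {x} Γ l →
      ((resonantSteps G J h Δ rs {x} Γ l).card : ℝ) ≤ (1 - ζ) * ns)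
    (hp : IsPrefix G rs ns {x} Γ i)
    (h1 : ∀ j, j + 1 = i → Disjoint (Γ i) (pathInterior G rs {x} Γ j))
    (h2 : (Γ i ∩ pathInterior G rs {x} Γ i).Nonempty)
    (h3 : (Γ i \ pathInterior G rs {x} Γ i).Nonempty) (hi : i ≤ ns)
    (h4 : IsFar G rs ns {x} (Γ i) ∨ i + 1 = ns ∧ ∃ v, v ∉ pathInterior G rs {x} Γ (i + 1)) :
    ((resonantSteps G J h Δ rs {x} Γ (i + 1)).card : ℝ) ≤ (1 - ζ) * ns := by
  classical
  by_cases hf : IsFar G rs ns {x} (Γ i)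
  · exact hP Γ _ (hp.isPath h1 h2 h3 hi (Or.inr hf))
  · obtain ⟨hin, v, hv⟩ := h4.resolve_left hf
    obtain ⟨u, hu⟩ := h3
    obtain ⟨huΓ, hui⟩ := Finset.mem_sdiff.1 hu
    have huI : u ∈ pathInterior G rs {x} Γ (i + 1) := by
      rw [pathInterior]
      exact sdiff_subset_grow rs _ _ (Finset.mem_union_right _ huΓ)
    -- A path that has not become far must make `n_* + 1` steps. An arbitrary last one is appended,
    -- joining the newest part of the interior to an outside vertex; it can only increase the number
    -- of resonant steps.
    set Γ' : ℕ → Finset Λ := Function.update Γ (i + 1) {u, v} with hΓ'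
    have hagree : ∀ j < i + 1, Γ j = Γ' j := fun j hj => by
      rw [hΓ', Function.update_of_ne (by omega)]
    have hp' : IsPrefix G rs ns {x} Γ' (i + 1) :=
      (hp.succ h1 h2 ⟨u, hu⟩ hf).congr hagree
    have e1 := pathInterior_congr (G := G) (rs := rs) (S₀ := {x}) (i + 1) hagree
    have e2 := pathInterior_congr (G := G) (rs := rs) (S₀ := {x}) i
      fun j hj => hagree j (by omega)
    have e3 : Γ' (i + 1) = {u, v} := by simp [hΓ']
    have hvi : v ∉ pathInterior G rs {x} Γ i := fun h => hv (pathInterior_mono (Nat.le_succ i) h)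
    have := hP Γ' _ (hp'.isPath (fun j hj => ?_) ?_ ?_ (by omega) (Or.inl hin))
    · refine le_trans ?_ this
      rw [resonantSteps_congr hagree]
      exact_mod_cast Finset.card_le_card (resonantSteps_mono (Nat.le_succ _))
    · obtain rfl : j = i := by omega
      rw [e3, ← e2]
      simp [hui, hvi]
    · refine ⟨u, ?_⟩
      rw [e3, ← e1]
      simp [huI]
    · refine ⟨v, ?_⟩
      rw [e3, ← e1]
      simp [hv]

end IsPrefix

end Paths

/-! ### Decay along the paths -/

/-- The ranges of the rotated observable, of the truncated diagonal Hamiltonian and of a rotated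
hop, plus those of the hops at both ends, must fit into the length `r`. This is the origin of the
condition `μ(5k+1) ≤ 1`. For `k = 0` and `g = μr/4` the sum is below `3g + p/2 + p'/2 < 4g ≤ r`. -/
theorem decoupling_range_le {k p p' r a τ : ℕ} {μ γ : ℝ} (hμ0 : 0 < μ)
    (hμ : μ * (5 * k + 1) ≤ 1) (hr : 8 * k < r) (hγ : γ = μ * (r / 4 - k) - p / 2)
    (ha : (a : ℝ) < γ) (hτ0 : 0 < τ) (hτ : (τ : ℝ) - 1 < γ - p' / 2) :
    (2 * k + 1) * a + ((2 * k + 1) * a + k) + (2 * k + 1) * (τ - 1) + 2 * hopRange k p +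
      hopRange k p' ≤ r := by
  have hr' : 8 * (k : ℝ) < r := by exact_mod_cast hr
  obtain ⟨j, rfl⟩ : ∃ j, τ = j + 1 := ⟨τ - 1, by omega⟩
  rw [Nat.add_sub_cancel]
  push_cast at hτ
  set K : ℝ := (k : ℝ) with hK
  have hk0 : 0 ≤ K := Nat.cast_nonneg k
  have hp0 : (0 : ℝ) ≤ p := Nat.cast_nonneg p
  have hp0' : (0 : ℝ) ≤ p' := Nat.cast_nonneg p'
  set g : ℝ := μ * (r / 4 - K) with hg
  have hg0 : 0 ≤ g := mul_nonneg hμ0.le (by linarith)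
  have hgb : (5 * K + 1) * g ≤ r / 4 - K := by
    have : 0 ≤ (1 - μ * (5 * K + 1)) * (r / 4 - K) := mul_nonneg (by linarith) (by linarith)
    rw [hg]; nlinarith
  have key : (2 * K + 1) * (2 * a + j) ≤ (2 * K + 1) * (3 * γ - p' / 2) :=
    mul_le_mul_of_nonneg_left (by linarith) (by linarith)
  have goal : (2 * K + 1) * (2 * a + j) + K + 2 * (hopRange k p : ℝ) + (hopRange k p' : ℝ) ≤ r := by
    rcases Nat.eq_zero_or_pos k with hk | hk
    · have hK0 : K = 0 := by rw [hK, hk]; simp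
      have e : ∀ p : ℕ, (hopRange k p : ℝ) = p := by
        intro p; unfold hopRange; split_ifs with h <;> simp [hk, h]
      rw [e, e]
      rw [hK0] at key hgb ⊢
      linarith
    · have hk1 : (1 : ℝ) ≤ K := by rw [hK]; exact_mod_cast hk
      have e : ∀ p : ℕ, (hopRange k p : ℝ) ≤ K + p ∧ (hopRange k p : ℝ) ≤ K + 3 / 2 * p ∧
          2 * (hopRange k p : ℝ) ≤ 2 * K + 3 * p := by
        intro p
        have : (0 : ℝ) ≤ p := Nat.cast_nonneg p
        have h1 : (hopRange k p : ℝ) ≤ K + p := by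
          unfold hopRange; split_ifs with h
          · linarith
          · linarith
        exact ⟨h1, by linarith, by linarith⟩
      have h1 := (e p).2.2
      have h2 := (e p').2.1
      have h3 : 0 ≤ (K - 1) * p := mul_nonneg (by linarith) hp0
      have h4 : 0 ≤ (K - 1) * p' := mul_nonneg (by linarith) hp0'
      have h5 : 0 ≤ (K - 1) * g := mul_nonneg (by linarith) hg0
      rw [hγ] at key
      nlinarith
  have : (((2 * k + 1) * a + ((2 * k + 1) * a + k) + (2 * k + 1) * j + 2 * hopRange k p +
      hopRange k p' : ℕ) : ℝ) ≤ r := by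
    push_cast
    rw [← hK]
    linarith
  exact_mod_cast this

/-- The data of the estimate along the paths from a point `x` of the boundary of `S₀`. -/
structure DecaySetup (Λ : Type*) [Fintype Λ] [LinearOrder Λ] where
  (G : SimpleGraph Λ) (J : Finset Λ → ℝ) (Φ : ℕ → Finset Λ → Op Λ) (w : ℕ → ℝ) (A : Op Λ)
  (S₀ S₁ : Finset Λ) (x : Λ) (k N rs n r d : ℕ) (c h ε Δ ζ μ θ y ρ M l δ q E : ℝ)
  conn : G.Connected
  model : IsModel G k J Φ
  strength : HasStrength N c h ε w Φ
  mem_A : A ∈ suppAlg S₁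
  nonempty : S₁.Nonempty
  mem_x : x ∈ S₀
  le_dist : ∀ u ∈ S₀, ∀ v ∈ S₁, r ≤ G.dist u v
  lt_dist : ∀ u ∈ S₀, ∀ v ∈ S₁, n * r < G.dist u v
  r_le : r ≤ rs + 1
  r_eq : 1 ≤ n → r = rs + 1
  k_lt : 8 * k < r
  h_pos : 0 < h
  Δ_pos : 0 < Δ
  one_le_y : 1 ≤ y
  y_mul_ε : y * ε ≤ ρ
  ρ_le : ρ ≤ 1
  gap_le : ∀ z, ∀ R ⊆ ball G z rs, 80 * R.card * (h * (ρ * R.card)) ≤ h * Δ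
  θ_pos : 0 < θ
  θ_le : θ ≤ 1
  ε_le : ε ≤ θ
  one_le_θy : 1 ≤ θ * y
  μ_pos : 0 < μ
  μ_le : μ * (5 * k + 1) ≤ 1
  M_nonneg : 0 ≤ M
  dim : ∀ z j, 1 ≤ j → ((ball G z j).card : ℝ) ≤ M * (j : ℝ) ^ d
  l_pos : 0 < l
  δ_pos : 0 < δ
  δ_le : δ ≤ 1
  one_le_q : 1 ≤ q
  -- One Duhamel integral over a region of size `r` costs at most `q / (20 δ)`: `q` absorbs the
  -- volume, and `1/δ` is the price of the slow rate `l`.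
  rate : (c + 1) * h * (M * (r : ℝ) ^ d) ≤ l * (q / (20 * δ))
  rate_far : ∀ p : ℕ, 1 ≤ p →
    (c + 1) * h * (M * (p : ℝ) ^ d) * θ ^ ((1 - μ) / 2 * p) ≤ l * (q / (20 * δ))
  resonant_le : ∀ (Γ : ℕ → Finset Λ) (l : ℕ), IsPath G rs n {x} Γ l →
      ((resonantSteps G J h Δ rs {x} Γ l).card : ℝ) ≤ (1 - ζ) * n
  E_nonneg : 0 ≤ E
  -- The condition that closes the induction: at the end of every path the claimed bound is at least
  -- `10`, more than the trivial one.
  total : ∀ (b e m : ℕ) (v : ℝ), m + 1 ≤ b + 2 * e → (e : ℝ) ≤ v → (n : ℝ) ≤ v + b →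
    1 ≤ v + b → (b : ℝ) ≤ (1 - ζ) * n →
    10 * (q ^ 2) ^ (b + e) * θ ^ (μ * (r / 4 * v - k * e)) ≤ E * δ ^ m

namespace DecaySetup

variable {Λ : Type*} [Fintype Λ] [LinearOrder Λ] (D : DecaySetup Λ)

/-- The size of a commutator after `b` resonant and `e` other steps, which cover the length `v`. -/
noncomputable def size (i e m : ℕ) (v : ℝ) : ℝ :=
  D.E * D.δ ^ m / (D.q ^ 2) ^ i * D.θ ^ (-(D.μ * (D.r / 4 * v - D.k * e)))

theorem size_nonneg (i e m : ℕ) (v : ℝ) : 0 ≤ D.size i e m v := by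
  have := D.E_nonneg
  have := D.δ_pos
  have := D.θ_pos
  have := D.one_le_q
  unfold size
  positivity

/-- The first `i` steps of a path. -/
structure IsState (Γ : ℕ → Finset Λ) (i b e m : ℕ) (v : ℝ) : Prop where
  isPrefix : IsPrefix D.G D.rs D.n {D.x} Γ i
  res : b ≤ (resonantSteps D.G D.J D.h D.Δ D.rs {D.x} Γ i).card
  reach : ∀ u ∈ pathInterior D.G D.rs {D.x} Γ i, (D.G.dist D.x u : ℝ) ≤ D.r * (v + b)
  disj : Disjoint (pathInterior D.G D.rs {D.x} Γ i) D.S₁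
  steps : i = b + e
  le_cover : (e : ℝ) ≤ v
  m_le : m ≤ b + 2 * e
  -- Either no long step has occurred, or there is a reserve of one factor `δ` and of one length
  -- `r`. This is needed only when the region of the last hop touches `S₁`.
  alt : v = e ∨ m + 1 ≤ b + 2 * e ∧
    ∀ u ∈ pathInterior D.G D.rs {D.x} Γ i, (D.G.dist D.x u : ℝ) + D.r ≤ D.r * (v + b)

/-- A term of the Hamiltonian that leaves the interior. -/
structure IsHop (Γ : ℕ → Finset Λ) (i p : ℕ) (Z : Finset Λ) (φ : ℝ) (ℓ : ℕ) : Prop where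
  anchor : ∃ a ∈ pathInterior D.G D.rs {D.x} Γ i, ∀ j, j + 1 = i → a ∉ pathInterior D.G D.rs {D.x} Γ j
  exit : ∃ u ∈ pathInterior D.G D.rs {D.x} Γ i, ∃ v ∈ Z, v ∉ D.S₀ ∪ pathInterior D.G D.rs {D.x} Γ i ∧
    D.G.dist u v ≤ hopRange D.k p
  touch : ∃ u ∈ Z, u ∈ D.S₀ ∪ pathInterior D.G D.rs {D.x} Γ i
  near : ∀ v ∈ Z, v ∉ D.S₀ ∪ pathInterior D.G D.rs {D.x} Γ i → ∃ u ∈ pathInterior D.G D.rs {D.x} Γ i, D.G.dist u v ≤ ℓ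
  le_ℓ : hopRange D.k p ≤ ℓ
  le_φ : (p : ℝ) / 2 ≤ φ
  -- A hop of reach `ℓ > r` pays for the length `r + ℓ` at once, and keeps `θ ^ ((1-μ)p/2)` for the
  -- volume of its large support.
  long : D.r < ℓ → D.μ * ((D.r + ℓ) / 4 - D.k) + (1 - D.μ) / 2 * p ≤ φ

theorem n_mul_lt : ∀ v ∈ D.S₁, D.n * D.r < D.G.dist D.x v := fun v hv => D.lt_dist _ D.mem_x v hv

theorem r_pos : 0 < D.r := by have := D.k_lt; omega

theorem μ_le_one : D.μ ≤ 1 := by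
  have h1 := D.μ_le
  have h2 := D.μ_pos
  have h3 : (0 : ℝ) ≤ D.k := Nat.cast_nonneg _
  nlinarith [mul_nonneg h2.le h3]

theorem isFar_of_mem {S : Finset Λ} {v : Λ} (hv : v ∈ D.S₁) (hvS : v ∈ S) :
    IsFar D.G D.rs D.n {D.x} S := by
  intro y hy
  rw [Finset.mem_singleton] at hy
  subst hy
  refine ⟨v, hvS, ?_⟩
  rw [D.G.dist_comm]
  rcases Nat.eq_zero_or_pos D.n with h | h
  · rw [h]; simp
  · rw [← D.r_eq h]; exact (D.n_mul_lt v hv).le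

theorem isFar_of_n_eq_zero {S : Finset Λ} (h : D.n = 0) (hS : S.Nonempty) :
    IsFar D.G D.rs D.n {D.x} S := by
  obtain ⟨v, hv⟩ := hS
  intro y _
  exact ⟨v, hv, by rw [h]; simp⟩

end DecaySetup

/-! ### Extending a path by one step -/

namespace DecaySetup

variable {Λ : Type*} [Fintype Λ] [LinearOrder Λ] (D : DecaySetup Λ)

/-- The estimate for the hops that leave the interior. -/
def Bound (Γ : ℕ → Finset Λ) (i e m : ℕ) (v : ℝ) : Prop :=
  ∀ p Z φ ℓ, D.IsHop Γ i p Z φ ℓ → ∀ s, 0 ≤ s →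
    ‖⁅D.Φ p Z, heis (hamOn D.N D.Φ (D.S₀ ∪ pathInterior D.G D.rs {D.x} Γ i)ᶜ) s D.A⁆‖ ≤
      ‖D.Φ p Z‖ * (‖D.A‖ * D.size i e m v * D.θ ^ (-φ)) * Real.exp (D.l * s)

/-- A set that continues a path. -/
structure IsStep (Γ : ℕ → Finset Λ) (i : ℕ) (S : Finset Λ) : Prop where
  avoids : ∀ j, j + 1 = i → Disjoint S (pathInterior D.G D.rs {D.x} Γ j)
  meets : (S ∩ pathInterior D.G D.rs {D.x} Γ i).Nonempty
  exits : (S \ pathInterior D.G D.rs {D.x} Γ i).Nonempty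
  grow_eq : grow D.G D.rs (pathInterior D.G D.rs {D.x} Γ i) S = pathInterior D.G D.rs {D.x} Γ i ∪ S

variable {D} {Γ : ℕ → Finset Λ} {i b e m : ℕ} {v : ℝ} {S : Finset Λ}

theorem agree (Γ : ℕ → Finset Λ) (i : ℕ) (S : Finset Λ) :
    ∀ j < i, Γ j = Function.update Γ i S j := fun j hj => by
  rw [Function.update_of_ne (by omega)]

theorem interior_update (D : DecaySetup Λ) (Γ : ℕ → Finset Λ) {j i : ℕ} (hj : j ≤ i)
    (S : Finset Λ) : pathInterior D.G D.rs {D.x} (Function.update Γ i S) j = pathInterior D.G D.rs {D.x} Γ j :=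
  (pathInterior_congr j fun a ha => agree Γ i S a (by omega)).symm

theorem IsStep.interior_succ (h : D.IsStep Γ i S) :
    pathInterior D.G D.rs {D.x} (Function.update Γ i S) (i + 1) = pathInterior D.G D.rs {D.x} Γ i ∪ S := by
  rw [pathInterior, interior_update D Γ le_rfl, Function.update_self]
  exact h.grow_eq

/-- When the path ends at a far set or at its last index, partial non-resonance applies. In the
second case the outside vertex needed to complete the path is taken from `S₁`. -/
theorem IsState.card_le (h : D.IsState Γ i b e m v) (hS : D.IsStep Γ i S)
    (hi : i < max D.n 1)
    (hfin : IsFar D.G D.rs D.n {D.x} S ∨ i + 1 = max D.n 1) :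
    ((resonantSteps D.G D.J D.h D.Δ D.rs {D.x} (Function.update Γ i S) (i + 1)).card : ℝ) ≤
      (1 - D.ζ) * D.n := by
  have hp := h.isPrefix.congr (agree Γ i S)
  refine IsPrefix.card_resonantSteps_le D.resonant_le hp (fun j hj => ?_) ?_ ?_ (by omega) ?_
  · rw [Function.update_self, interior_update D Γ (by omega)]; exact hS.avoids j hj
  · rw [Function.update_self, interior_update D Γ le_rfl]; exact hS.meets
  · rw [Function.update_self, interior_update D Γ le_rfl]; exact hS.exits
  · rw [Function.update_self]
    by_cases hf : IsFar D.G D.rs D.n {D.x} S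
    · exact Or.inl hf
    · refine Or.inr ⟨?_, ?_⟩
      · have hn : D.n ≠ 0 := fun h0 => hf (D.isFar_of_n_eq_zero h0 (hS.exits.mono
          Finset.sdiff_subset))
        have := hfin.resolve_left hf
        omega
      · obtain ⟨u, hu⟩ := D.nonempty
        refine ⟨u, fun hc => ?_⟩
        rw [hS.interior_succ] at hc
        rcases Finset.mem_union.1 hc with h1 | h1
        · exact Finset.disjoint_left.1 h.disj h1 hu
        · exact hf (D.isFar_of_mem hu h1)

/-- At the end of a path the covered length has reached `n`: a far set forces the distance `n r`,
and otherwise `n` steps of length at least one have been counted. -/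
theorem cover_ge
    (hfin : IsFar D.G D.rs D.n {D.x} S ∨ i + 1 = max D.n 1) {v : ℝ} {b : ℕ}
    (hv : (i : ℝ) + 1 ≤ v + b)
    (hreach : 1 ≤ D.n → ∀ u ∈ S, (D.G.dist D.x u : ℝ) ≤ D.r * (v + b)) :
    (D.n : ℝ) ≤ v + b ∧ 1 ≤ v + b := by
  have hi0 : (0 : ℝ) ≤ i := Nat.cast_nonneg i
  refine ⟨?_, by linarith⟩
  rcases Nat.eq_zero_or_pos D.n with hn | hn
  · rw [hn]; push_cast; linarith
  rcases hfin with hf | hf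
  · obtain ⟨u, hu, hd⟩ := hf D.x (by simp)
    rw [← D.r_eq hn, D.G.dist_comm] at hd
    have h1 := hreach hn u hu
    have h2 : ((D.n * D.r : ℕ) : ℝ) ≤ D.G.dist D.x u := by exact_mod_cast hd
    push_cast at h2
    have h3 : (0 : ℝ) < D.r := by exact_mod_cast D.r_pos
    have h4 : (D.r : ℝ) * D.n ≤ D.r * (v + b) := by linarith
    exact le_of_mul_le_mul_left h4 h3
  · have h1 : D.n ≤ i + 1 := by omega
    have h2 : (D.n : ℝ) ≤ i + 1 := by exact_mod_cast h1
    linarith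

theorem IsState.next (h : D.IsState Γ i b e m v) (hS : D.IsStep Γ i S)
    (hfar : ¬ IsFar D.G D.rs D.n {D.x} S) {b' e' m' : ℕ} {v' : ℝ}
    (hres : b' ≤ (resonantSteps D.G D.J D.h D.Δ D.rs {D.x} (Function.update Γ i S) (i + 1)).card)
    (hreach : ∀ u ∈ pathInterior D.G D.rs {D.x} Γ i ∪ S, (D.G.dist D.x u : ℝ) ≤ D.r * (v' + b'))
    (hs : i + 1 = b' + e') (hc : (e' : ℝ) ≤ v') (hm : m' ≤ b' + 2 * e')
    (halt : v' = e' ∨ m' + 1 ≤ b' + 2 * e' ∧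
      ∀ u ∈ pathInterior D.G D.rs {D.x} Γ i ∪ S, (D.G.dist D.x u : ℝ) + D.r ≤ D.r * (v' + b')) :
    D.IsState (Function.update Γ i S) (i + 1) b' e' m' v' := by
  have hp := h.isPrefix.congr (agree Γ i S)
  refine ⟨hp.succ (fun j hj => ?_) ?_ ?_ ?_, hres, ?_, ?_, hs, hc, hm, ?_⟩
  · rw [Function.update_self, interior_update D Γ (by omega)]; exact hS.avoids j hj
  · rw [Function.update_self, interior_update D Γ le_rfl]; exact hS.meets
  · rw [Function.update_self, interior_update D Γ le_rfl]; exact hS.exits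
  · rw [Function.update_self]; exact hfar
  · rw [hS.interior_succ]; exact hreach
  · rw [hS.interior_succ, Finset.disjoint_union_left]
    exact ⟨h.disj, Finset.disjoint_left.2 fun u hu hu' => hfar (D.isFar_of_mem hu' hu)⟩
  · rw [hS.interior_succ]; exact halt

/-- Turns the induction hypothesis into the input of the Duhamel steps: a term across the boundary
of `R` is a hop out of the extended interior, anchored in the part just added, with `φ = p/2`. -/
theorem Bound.hops_le {e' m' : ℕ} {v' : ℝ} (hS : D.IsStep Γ i S)
    (hB : D.Bound (Function.update Γ i S) (i + 1) e' m' v') {R : Finset Λ}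
    (hR : Disjoint R (D.S₀ ∪ pathInterior D.G D.rs {D.x} Γ i))
    (hRS : D.S₀ ∪ pathInterior D.G D.rs {D.x} Γ i ∪ R = D.S₀ ∪ (pathInterior D.G D.rs {D.x} Γ i ∪ S)) :
    ∀ t ∈ hops D.N (D.S₀ ∪ pathInterior D.G D.rs {D.x} Γ i)ᶜ R, ∀ u, 0 ≤ u →
      ‖⁅D.Φ t.1 t.2, heis (hamOn D.N D.Φ ((D.S₀ ∪ pathInterior D.G D.rs {D.x} Γ i)ᶜ \ R)) u D.A⁆‖ ≤
        ‖D.Φ t.1 t.2‖ * (‖D.A‖ * D.size (i + 1) e' m' v' * D.θ ^ (-(t.1 : ℝ) / 2)) *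
          Real.exp (D.l * u) := by
  intro t ht u hu
  by_cases h0 : D.Φ t.1 t.2 = 0
  · have : ⁅D.Φ t.1 t.2, heis (hamOn D.N D.Φ ((D.S₀ ∪ pathInterior D.G D.rs {D.x} Γ i)ᶜ \ R)) u D.A⁆ = 0 := by
      rw [h0, op_zero_lie]
    rw [this, h0]; simp
  obtain ⟨-, hZY, hZR, hZd⟩ := mem_hops.1 ht
  have hq := graphDiam_le_iff.1 (D.model.range_le _ _ h0)
  obtain ⟨a, haZ, haR⟩ := Finset.not_disjoint_iff.1 hZd
  obtain ⟨z, hzZ, hzR⟩ := Finset.not_subset.1 hZR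
  have hsucc := hS.interior_succ
  have haT : a ∉ D.S₀ ∪ pathInterior D.G D.rs {D.x} Γ i := Finset.disjoint_left.1 hR haR
  have haI : a ∈ pathInterior D.G D.rs {D.x} Γ i ∪ S := by
    have : a ∈ D.S₀ ∪ (pathInterior D.G D.rs {D.x} Γ i ∪ S) := hRS ▸ Finset.mem_union_right _ haR
    rcases Finset.mem_union.1 this with h | h
    · exact absurd (Finset.mem_union_left _ h) haT
    · exact h
  have hout : ∀ z ∈ t.2, z ∉ R → z ∉ D.S₀ ∪ (pathInterior D.G D.rs {D.x} Γ i ∪ S) := by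
    intro z hz hzR h
    rw [← hRS] at h
    rcases Finset.mem_union.1 h with h | h
    · exact Finset.mem_compl.1 (hZY hz) h
    · exact hzR h
  have hY : (D.S₀ ∪ pathInterior D.G D.rs {D.x} Γ i)ᶜ \ R =
      (D.S₀ ∪ pathInterior D.G D.rs {D.x} (Function.update Γ i S) (i + 1))ᶜ := by
    rw [hsucc, ← hRS]
    ext v
    simp only [Finset.mem_sdiff, Finset.mem_compl, Finset.mem_union]
    tauto
  have hhop : D.IsHop (Function.update Γ i S) (i + 1) t.1 t.2 ((t.1 : ℝ) / 2)
      (hopRange D.k t.1) := by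
    refine ⟨⟨a, by rw [hsucc]; exact haI, fun j hj => ?_⟩,
      ⟨a, by rw [hsucc]; exact haI, z, hzZ, by rw [hsucc]; exact hout z hzZ hzR, hq a haZ z hzZ⟩,
      ⟨a, haZ, by rw [hsucc]; exact Finset.mem_union_right _ haI⟩,
      fun v hv _ => ⟨a, by rw [hsucc]; exact haI, hq a haZ v hv⟩, le_rfl, le_rfl, fun hlong => ?_⟩
    · obtain rfl : j = i := by omega
      rw [interior_update D Γ le_rfl]
      exact fun h => haT (Finset.mem_union_right _ h)
    · have hk := D.k_lt
      have hp : t.1 ≠ 0 := by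
        intro h
        rw [hopRange, if_pos h] at hlong
        omega
      rw [hopRange, if_neg hp] at hlong ⊢
      have h1 : (D.r : ℝ) < t.1 := by exact_mod_cast hlong
      have h2 := D.μ_pos
      have h3 : (0 : ℝ) ≤ D.k := Nat.cast_nonneg _
      have h4 := mul_nonneg h2.le h3
      nlinarith
  have := hB _ _ _ _ hhop u hu
  rw [hY]
  rwa [neg_div]

end DecaySetup

/-! ### The region around a hop -/

namespace DecaySetup

variable {Λ : Type*} [Fintype Λ] [LinearOrder Λ] (D : DecaySetup Λ)

open scoped Classical in
/-- The vertices outside the interior at distance at most `r - 2 q` from a hop of range `q`. -/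
noncomputable def hopRegion (Γ : ℕ → Finset Λ) (i p : ℕ) (Z : Finset Λ) : Finset Λ :=
  Finset.univ.filter fun v => v ∉ D.S₀ ∪ pathInterior D.G D.rs {D.x} Γ i ∧
    ∃ u ∈ Z, u ∉ D.S₀ ∪ pathInterior D.G D.rs {D.x} Γ i ∧
      D.G.dist u v ≤ D.r - 2 * hopRange D.k p

variable {D} {Γ : ℕ → Finset Λ} {i b e m p : ℕ} {v φ : ℝ} {ℓ : ℕ} {Z : Finset Λ}

theorem mem_hopRegion {z : Λ} : z ∈ D.hopRegion Γ i p Z ↔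
    z ∉ D.S₀ ∪ pathInterior D.G D.rs {D.x} Γ i ∧
    ∃ u ∈ Z, u ∉ D.S₀ ∪ pathInterior D.G D.rs {D.x} Γ i ∧
      D.G.dist u z ≤ D.r - 2 * hopRange D.k p := by
  simp [hopRegion]

theorem subset_hopRegion :
    Z \ (D.S₀ ∪ pathInterior D.G D.rs {D.x} Γ i) ⊆ D.hopRegion Γ i p Z := by
  intro z hz
  obtain ⟨h1, h2⟩ := Finset.mem_sdiff.1 hz
  exact mem_hopRegion.2 ⟨h2, z, h1, h2, by simp⟩

theorem disjoint_hopRegion :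
    Disjoint (D.hopRegion Γ i p Z) (D.S₀ ∪ pathInterior D.G D.rs {D.x} Γ i) :=
  Finset.disjoint_left.2 fun _ hz => (mem_hopRegion.1 hz).1

/-- For a hop of range `q ≤ r/2` the radius is `r - q`. This leaves `q - 1` for the distance to a
center, since `r - 1 ≤ r_*`; for `q > r/2` the natural subtraction leaves the radius `q`. -/
theorem hopRegion_subset_ball (h0 : D.Φ p Z ≠ 0) {y : Λ} (hy : y ∈ Z) :
    D.hopRegion Γ i p Z ⊆ ball D.G y (hopRange D.k p + (D.r - 2 * hopRange D.k p)) := by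
  intro z hz
  obtain ⟨-, u, hu, -, hd⟩ := mem_hopRegion.1 hz
  have h1 := graphDiam_le_iff.1 (D.model.range_le _ _ h0) y hy u hu
  have h2 := D.conn.dist_triangle (u := y) (v := u) (w := z)
  exact mem_ball.2 (by omega)

theorem hopRange_pos (hop : D.IsHop Γ i p Z φ ℓ) : 1 ≤ hopRange D.k p := by
  obtain ⟨u, hu, z, hz, hzT, hd⟩ := hop.exit
  rcases Nat.eq_zero_or_pos (D.G.dist u z) with h | h
  · rw [D.conn.dist_eq_zero_iff] at h
    exact absurd (Finset.mem_union_right _ (h ▸ hu)) hzT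
  · omega

theorem card_ball_le {z : Λ} {j : ℕ} (hj : j ≤ D.r) :
    ((ball D.G z j).card : ℝ) ≤ D.M * (D.r : ℝ) ^ D.d := by
  refine le_trans ?_ (D.dim z D.r D.r_pos)
  have h : ball D.G z j ⊆ ball D.G z D.r := fun u hu => mem_ball.2 ((mem_ball.1 hu).trans hj)
  exact_mod_cast Finset.card_le_card h

/-- The next set of a path, for a given hop. -/
theorem exists_isStep (hop : D.IsHop Γ i p Z φ ℓ)
    (h0 : D.Φ p Z ≠ 0) : ∃ S, D.IsStep Γ i S ∧ D.hopRegion Γ i p Z ⊆ S ∧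
      ((∃ hc : (centers D.G D.rs (pathInterior D.G D.rs {D.x} Γ i) S).Nonempty,
        pathInterior D.G D.rs {D.x} Γ i ∪ S = pathInterior D.G D.rs {D.x} Γ i ∪
          ball D.G ((centers D.G D.rs (pathInterior D.G D.rs {D.x} Γ i) S).min' hc) D.rs ∧
        D.hopRegion Γ i p Z ⊆
          ball D.G ((centers D.G D.rs (pathInterior D.G D.rs {D.x} Γ i) S).min' hc) D.rs ∧
        (1 ≤ D.n → ∀ u ∈ pathInterior D.G D.rs {D.x} Γ i ∪ S,
          ∃ u' ∈ pathInterior D.G D.rs {D.x} Γ i, D.G.dist D.x u ≤ D.G.dist D.x u' + D.r)) ∨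
      (D.r < 2 * hopRange D.k p ∧
        pathInterior D.G D.rs {D.x} Γ i ∪ S =
          pathInterior D.G D.rs {D.x} Γ i ∪ D.hopRegion Γ i p Z ∧
        ∀ u ∈ pathInterior D.G D.rs {D.x} Γ i ∪ S,
          ∃ u' ∈ pathInterior D.G D.rs {D.x} Γ i, D.G.dist D.x u ≤ D.G.dist D.x u' + ℓ)) := by
  set T := pathInterior D.G D.rs {D.x} Γ i with hT
  set W := D.hopRegion Γ i p Z with hW
  obtain ⟨a, haT, ha⟩ := hop.anchor
  have hWT : Disjoint W T :=
    (disjoint_hopRegion (D := D)).mono_right Finset.subset_union_right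
  obtain ⟨S, haS, hWS, hST, hgrow, hcase⟩ := exists_saturated_step (G := D.G) D.rs haT hWT
  obtain ⟨u, hu, z, hz, hzT, hd⟩ := hop.exit
  have hzW : z ∈ W := subset_hopRegion (Finset.mem_sdiff.2 ⟨hz, hzT⟩)
  refine ⟨S, ⟨fun j hj => ?_, ⟨a, Finset.mem_inter.2 ⟨haS, haT⟩⟩,
    ⟨z, Finset.mem_sdiff.2 ⟨hWS hzW, Finset.disjoint_left.1 hWT hzW⟩⟩, hgrow⟩, hWS, ?_⟩
  · rw [Finset.disjoint_left]
    intro w hw hwj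
    have : w = a := hST w hw (pathInterior_mono (by omega) hwj)
    exact ha j hj (this ▸ hwj)
  rcases hcase with ⟨hc, h1, h2⟩ | ⟨hc, h1⟩
  · refine Or.inl ⟨hc, h1, h2, fun hn w hw => ?_⟩
    rw [h1] at hw
    rcases Finset.mem_union.1 hw with hw | hw
    · exact ⟨w, hw, Nat.le_add_right _ _⟩
    · have hy := (mem_centers.1 (Finset.min'_mem _ hc)).1
      obtain ⟨-, y', hy', hadj⟩ := mem_boundary_compl.1 hy
      set y := (centers D.G D.rs T S).min' hc
      have h4 : D.G.dist y' y = 1 := SimpleGraph.dist_eq_one_iff_adj.2 hadj.symm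
      have h5 := D.conn.dist_triangle (u := D.x) (v := y') (w := w)
      have h6 := D.conn.dist_triangle (u := y') (v := y) (w := w)
      have h7 := mem_ball.1 hw
      have h8 := D.r_eq hn
      exact ⟨y', hy', by omega⟩
  -- If `2q ≤ r`, the exit vertex `y` of a geodesic to the hop is at distance at most `q - 1` from
  -- it, so the ball of radius `r_*` around `y` contains the region and the set is small. Hence big
  -- sets come only from terms of range above `r/2`.
  · have hlt : D.r < 2 * hopRange D.k p := by
      by_contra hcon
      push Not at hcon
      apply hc
      obtain ⟨y, hyT, y', hy', hadj, h3, -⟩ := exists_adj_dist_lt D.conn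
        (Finset.disjoint_left.1 hWT hzW) _ u hu hd
      refine ⟨y, mem_centers.2 ⟨mem_boundary_compl.2 ⟨hyT, y', hy', hadj⟩, ?_⟩⟩
      rw [h1, Finset.insert_sdiff_of_mem _ haT, Finset.sdiff_eq_self_of_disjoint hWT]
      intro w hw
      have h4 := mem_ball.1 (hopRegion_subset_ball h0 hz hw)
      have h5 := D.conn.dist_triangle (u := y) (v := z) (w := w)
      have h6 := D.r_le
      exact mem_ball.2 (by omega)
    have hTS : T ∪ S = T ∪ W := by
      rw [h1, Finset.union_insert, Finset.insert_eq_of_mem (Finset.mem_union_left _ haT)]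
    refine Or.inr ⟨hlt, hTS, fun w hw => ?_⟩
    rw [hTS] at hw
    rcases Finset.mem_union.1 hw with hw | hw
    · exact ⟨w, hw, Nat.le_add_right _ _⟩
    · obtain ⟨hwT, w', hw', -, hd'⟩ := mem_hopRegion.1 hw
      -- Here `r - 2q = 0`, so the region is just the part of `Z` outside the interior.
      rw [Nat.sub_eq_zero_of_le hlt.le, Nat.le_zero, D.conn.dist_eq_zero_iff] at hd'
      subst hd'
      obtain ⟨u', hu', hd''⟩ := hop.near w' hw' hwT
      have h4 := D.conn.dist_triangle (u := D.x) (v := u') (w := w')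
      exact ⟨u', hu', by omega⟩

/-- The distance of a hop to the hops out of its region. -/
theorem hop_far (hsmall : 2 * hopRange D.k p ≤ D.r) {R : Finset Λ}
    (hR : D.hopRegion Γ i p Z ⊆ R) {γ : ℝ} (hγ : γ = D.μ * (D.r / 4 - D.k) - p / 2)
    {a : ℕ} (ha : (a : ℝ) < γ) {τ : ℕ → ℕ}
    (hτ : ∀ p : ℕ, 0 < τ p → (τ p : ℝ) - 1 < γ - p / 2) :
    ∀ t ∈ hops D.N (D.S₀ ∪ pathInterior D.G D.rs {D.x} Γ i)ᶜ R, D.Φ t.1 t.2 ≠ 0 → 0 < τ t.1 →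
      ∀ u ∈ Z \ (D.S₀ ∪ pathInterior D.G D.rs {D.x} Γ i), ∀ w ∈ t.2, w ∈ R →
        (2 * D.k + 1) * a + ((2 * D.k + 1) * a + D.k) + (2 * D.k + 1) * (τ t.1 - 1) <
          D.G.dist u w := by
  intro t ht ht0 hτ0 u hu w hw _
  obtain ⟨-, hZY, hZR, -⟩ := mem_hops.1 ht
  obtain ⟨z, hz, hzR⟩ := Finset.not_subset.1 hZR
  have h1 := graphDiam_le_iff.1 (D.model.range_le _ _ ht0) w hw z hz
  have h2 : ¬ D.G.dist u z ≤ D.r - 2 * hopRange D.k p := fun h =>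
    hzR (hR (mem_hopRegion.2 ⟨Finset.mem_compl.1 (hZY hz), u, (Finset.mem_sdiff.1 hu).1,
      (Finset.mem_sdiff.1 hu).2, h⟩))
  have h3 := D.conn.dist_triangle (u := u) (v := w) (w := z)
  have h4 := decoupling_range_le D.μ_pos D.μ_le D.k_lt hγ ha hτ0 (hτ _ hτ0)
  omega

/-- A region that reaches `S₁` needs an interior that is far from `x` already. -/
theorem dist_of_mem_hopRegion (h0 : D.Φ p Z ≠ 0) (hsmall : 2 * hopRange D.k p ≤ D.r)
    (hop : D.IsHop Γ i p Z φ ℓ) {z : Λ} (hz : z ∈ D.hopRegion Γ i p Z) (hz1 : z ∈ D.S₁) :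
    ∃ u ∈ pathInterior D.G D.rs {D.x} Γ i, u ∉ D.S₀ ∧ D.n * D.r + 1 < D.G.dist D.x u + D.r := by
  obtain ⟨u, hu, huT⟩ := hop.touch
  have hq := hopRange_pos hop
  have h1 := mem_ball.1 (hopRegion_subset_ball h0 hu hz)
  have h0' : u ∉ D.S₀ := fun h => by
    have := D.le_dist u h z hz1
    omega
  rcases Finset.mem_union.1 huT with h | h
  · exact absurd h h0'
  · refine ⟨u, h, h0', ?_⟩
    have h2 := D.n_mul_lt z hz1
    have h3 := D.conn.dist_triangle (u := D.x) (v := u) (w := z)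
    omega

end DecaySetup

/-! ### Steps without help from a gap -/

namespace DecaySetup

variable {Λ : Type*} [Fintype Λ] [LinearOrder Λ] {D : DecaySetup Λ}
variable {Γ : ℕ → Finset Λ} {i b e m p : ℕ} {v φ : ℝ} {ℓ : ℕ} {Z S : Finset Λ}

/-- The accounting of one step: the budget `q ^ 2` and `a` powers of `δ` pay for the Duhamel factor
`F`. The change of the covered length is paid by the order of the hop (`φ`) and by the gap (`ψ`). -/
theorem size_step_le (D : DecaySetup Λ) {i e e' m a : ℕ} {v v' φ ψ F : ℝ} (hF : F * D.δ ^ a ≤ D.q ^ 2)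
    (h : D.μ * (D.r / 4 * v' - D.k * e') ≤ D.μ * (D.r / 4 * v - D.k * e) + φ + ψ) :
    F * D.θ ^ ψ * D.size (i + 1) e' (m + a) v' ≤ D.size i e m v * D.θ ^ (-φ) := by
  have hE := D.E_nonneg
  have hδ := D.δ_pos
  have hθ := D.θ_pos
  have hq := D.one_le_q
  have hq0 : 0 < D.q := by linarith
  have h1 : D.θ ^ ψ * D.θ ^ (-(D.μ * (D.r / 4 * v' - D.k * e'))) ≤
      D.θ ^ (-(D.μ * (D.r / 4 * v - D.k * e))) * D.θ ^ (-φ) := by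
    rw [← Real.rpow_add hθ, ← Real.rpow_add hθ]
    exact Real.rpow_le_rpow_of_exponent_ge hθ D.θ_le (by linarith)
  have h2 : F * D.δ ^ a / D.q ^ 2 ≤ 1 := (div_le_one (by positivity)).2 hF
  unfold size
  calc F * D.θ ^ ψ * (D.E * D.δ ^ (m + a) / (D.q ^ 2) ^ (i + 1) *
        D.θ ^ (-(D.μ * (D.r / 4 * v' - D.k * e'))))
      = (F * D.δ ^ a / D.q ^ 2) * (D.E * D.δ ^ m / (D.q ^ 2) ^ i *
        (D.θ ^ ψ * D.θ ^ (-(D.μ * (D.r / 4 * v' - D.k * e'))))) := by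
        field_simp
        ring
    _ ≤ 1 * (D.E * D.δ ^ m / (D.q ^ 2) ^ i *
        (D.θ ^ (-(D.μ * (D.r / 4 * v - D.k * e))) * D.θ ^ (-φ))) := by
        gcongr
    _ = _ := by ring

/-- The trivial commutator bound only needs `2`; the value `10` covers `28/20 + 8` in the last
non-resonant step. -/
theorem ten_le_size (D : DecaySetup Λ) {b e m : ℕ} {v : ℝ} (h1 : m + 1 ≤ b + 2 * e)
    (h2 : (e : ℝ) ≤ v) (h3 : (D.n : ℝ) ≤ v + b) (h4 : 1 ≤ v + b) (h5 : (b : ℝ) ≤ (1 - D.ζ) * D.n) :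
    10 ≤ D.size (b + e) e m v := by
  have h := D.total b e m v h1 h2 h3 h4 h5
  have hθ := D.θ_pos
  have hq : 0 < D.q := by linarith [D.one_le_q]
  unfold size
  rw [Real.rpow_neg hθ.le, ← div_eq_mul_inv, div_div, le_div_iff₀ (by positivity)]
  linarith

theorem IsHop.φ_nonneg (hop : D.IsHop Γ i p Z φ ℓ) : 0 ≤ φ :=
  le_trans (by positivity) hop.le_φ

theorem le_neg_rpow (D : DecaySetup Λ) {i e m : ℕ} {v : ℝ} (hφ : 0 ≤ φ) :
    D.size i e m v ≤ D.size i e m v * D.θ ^ (-φ) :=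
  le_mul_of_one_le_right (D.size_nonneg _ _ _ _)
    (Real.one_le_rpow_of_pos_of_le_one_of_nonpos D.θ_pos D.θ_le (by linarith))

/-- The bound without any cancellation. -/
theorem norm_lie_le_of_two_le (D : DecaySetup Λ) {Y : Finset Λ} {t s : ℝ} (hs : 0 ≤ s)
    (h : 2 ≤ t) :
    ‖⁅D.Φ p Z, heis (hamOn D.N D.Φ Y) s D.A⁆‖ ≤ ‖D.Φ p Z‖ * (‖D.A‖ * t) * Real.exp (D.l * s) := by
  refine (norm_lie_le' _ _).trans ?_
  rw [norm_heis (D.model.isSelfAdjoint_hamOn _)]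
  have h1 : 1 ≤ Real.exp (D.l * s) := Real.one_le_exp (mul_nonneg D.l_pos.le hs)
  calc 2 * ‖D.Φ p Z‖ * ‖D.A‖ = ‖D.Φ p Z‖ * (‖D.A‖ * 2) * 1 := by ring
    _ ≤ _ := by gcongr

theorem disjoint_S₀ (D : DecaySetup Λ) : Disjoint D.S₀ D.S₁ := by
  rw [Finset.disjoint_left]
  intro u h1 h2
  have := D.le_dist u h1 u h2
  have := D.r_pos
  simp at *
  omega

theorem IsState.subset_compl (h : D.IsState Γ i b e m v) :
    D.S₁ ⊆ (D.S₀ ∪ pathInterior D.G D.rs {D.x} Γ i)ᶜ := by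
  intro u hu
  rw [Finset.mem_compl, Finset.mem_union]
  rintro (h1 | h1)
  · exact Finset.disjoint_left.1 D.disjoint_S₀ h1 hu
  · exact Finset.disjoint_left.1 h.disj h1 hu

/-- The next state, after a step of length at most `r`. -/
theorem IsState.next_near (h : D.IsState Γ i b e m v) (hS : D.IsStep Γ i S)
    (hfar : ¬ IsFar D.G D.rs D.n {D.x} S) {b' e' m' : ℕ} {v' : ℝ}
    (hres : b' ≤ (resonantSteps D.G D.J D.h D.Δ D.rs {D.x} (Function.update Γ i S) (i + 1)).card)
    (hnear : ∀ u ∈ pathInterior D.G D.rs {D.x} Γ i ∪ S,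
      ∃ u' ∈ pathInterior D.G D.rs {D.x} Γ i, D.G.dist D.x u ≤ D.G.dist D.x u' + D.r)
    (hs : i + 1 = b' + e') (hv : v' + b' = v + b + 1) (hve : v' - e' = v - e)
    (hm : m' + b + 2 * e ≤ m + b' + 2 * e') :
    D.IsState (Function.update Γ i S) (i + 1) b' e' m' v' := by
  have hstep := h.steps
  have hml := h.m_le
  have hcov := h.le_cover
  refine h.next hS hfar hres (fun u hu => ?_) hs (by linarith) (by omega) ?_
  · obtain ⟨u', hu', hd⟩ := hnear u hu
    have h1 := h.reach u' hu'
    have h2 : (D.G.dist D.x u : ℝ) ≤ D.G.dist D.x u' + D.r := by exact_mod_cast hd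
    rw [hv]; linarith
  · rcases h.alt with h1 | ⟨h1, h2⟩
    · exact Or.inl (by linarith)
    · refine Or.inr ⟨by omega, fun u hu => ?_⟩
      obtain ⟨u', hu', hd⟩ := hnear u hu
      have h1 := h2 u' hu'
      have h2 : (D.G.dist D.x u : ℝ) ≤ D.G.dist D.x u' + D.r := by exact_mod_cast hd
      rw [hv]; linarith

/-- A hop that is not suppressed by the gap, in terms of the next hops. -/
theorem Bound.of_commute (h : D.IsState Γ i b e m v)
    (hS : D.IsStep Γ i S) (hfar : ¬ IsFar D.G D.rs D.n {D.x} S) {e' : ℕ} {v' : ℝ}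
    (hB : D.Bound (Function.update Γ i S) (i + 1) e' (m + 1) v') {R : Finset Λ}
    (hR : Disjoint R (D.S₀ ∪ pathInterior D.G D.rs {D.x} Γ i))
    (hRS : D.S₀ ∪ pathInterior D.G D.rs {D.x} Γ i ∪ R =
      D.S₀ ∪ (pathInterior D.G D.rs {D.x} Γ i ∪ S))
    (hZR : D.hopRegion Γ i p Z ⊆ R) {ψ : ℝ}
    (hcard : (D.c + 1) * D.h * R.card ≤ D.l * (D.q / (20 * D.δ)) * D.θ ^ (-ψ))
    (hψ : D.μ * (D.r / 4 * v' - D.k * e') + ψ ≤ D.μ * (D.r / 4 * v - D.k * e) + φ)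
    {s : ℝ} (hs : 0 ≤ s) :
    ‖⁅D.Φ p Z, heis (hamOn D.N D.Φ (D.S₀ ∪ pathInterior D.G D.rs {D.x} Γ i)ᶜ) s D.A⁆‖ ≤
      ‖D.Φ p Z‖ * (‖D.A‖ * D.size i e m v * D.θ ^ (-φ)) * Real.exp (D.l * s) := by
  have hl := D.l_pos
  have hδ := D.δ_pos
  have hq := D.one_le_q
  have hRY : R ⊆ (D.S₀ ∪ pathInterior D.G D.rs {D.x} Γ i)ᶜ := fun u hu =>
    Finset.mem_compl.2 (Finset.disjoint_left.1 hR hu)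
  have hRS₁ : Disjoint R D.S₁ := by
    rw [Finset.disjoint_left]
    intro u hu hu1
    have h1 : u ∈ D.S₀ ∪ (pathInterior D.G D.rs {D.x} Γ i ∪ S) := hRS ▸ Finset.mem_union_right _ hu
    rcases Finset.mem_union.1 h1 with h2 | h2
    · exact Finset.disjoint_left.1 D.disjoint_S₀ h2 hu1
    · rcases Finset.mem_union.1 h2 with h2 | h2
      · exact Finset.disjoint_left.1 h.disj h2 hu1
      · exact hfar (D.isFar_of_mem hu1 h2)
  have hO : D.Φ p Z ∈ suppAlg (R ∪ ((D.S₀ ∪ pathInterior D.G D.rs {D.x} Γ i)ᶜ)ᶜ) := by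
    refine suppAlg_mono (fun u hu => ?_) (D.model.supported p Z)
    rw [compl_compl]
    by_cases hT : u ∈ D.S₀ ∪ pathInterior D.G D.rs {D.x} Γ i
    · exact Finset.mem_union_right _ hT
    · exact Finset.mem_union_left _ (hZR (subset_hopRegion (Finset.mem_sdiff.2 ⟨hu, hT⟩)))
  have hsz := D.size_nonneg (i + 1) e' (m + 1) v'
  have key := norm_lie_heis_le_of_commute D.model D.strength hRY h.subset_compl hRS₁ D.mem_A hO
    D.θ_pos D.θ_le D.ε_le hl hs (by positivity) (hB.hops_le hS hR hRS)
  refine key.trans ?_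
  have h1 := exp_sub_one_div_le (l := D.l) (s := s) hl
  have h0 : 0 ≤ (Real.exp (D.l * s) - 1) / D.l :=
    div_nonneg (by linarith [Real.one_le_exp (mul_nonneg hl.le hs)]) hl.le
  have h2 := D.size_step_le (i := i) (e := e) (m := m) (a := 1) (v := v) (v' := v') (e' := e')
    (φ := φ) (ψ := -ψ) (F := D.q / (10 * D.δ)) (by
      rw [pow_one]; field_simp; nlinarith) (by linarith)
  have h3 : 0 ≤ D.θ ^ (-ψ) := Real.rpow_nonneg D.θ_pos.le _
  calc 2 * ‖D.Φ p Z‖ * ((D.c + 1) * D.h * R.card * (‖D.A‖ * D.size (i + 1) e' (m + 1) v')) *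
        ((Real.exp (D.l * s) - 1) / D.l)
      ≤ 2 * ‖D.Φ p Z‖ * (D.l * (D.q / (20 * D.δ)) * D.θ ^ (-ψ) *
        (‖D.A‖ * D.size (i + 1) e' (m + 1) v')) * (Real.exp (D.l * s) / D.l) := by gcongr
    _ = ‖D.Φ p Z‖ * (‖D.A‖ * (D.q / (10 * D.δ) * D.θ ^ (-ψ) * D.size (i + 1) e' (m + 1) v')) *
        Real.exp (D.l * s) := by field_simp; ring
    _ ≤ ‖D.Φ p Z‖ * (‖D.A‖ * (D.size i e m v * D.θ ^ (-φ))) * Real.exp (D.l * s) := by gcongr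
    _ = _ := by ring

end DecaySetup

namespace DecaySetup

variable {Λ : Type*} [Fintype Λ] [LinearOrder Λ] {D : DecaySetup Λ}
variable {Γ : ℕ → Finset Λ} {i b e m p : ℕ} {v φ : ℝ} {ℓ : ℕ} {Z S : Finset Λ}

theorem one_le_n_of_not_isFar (hS : D.IsStep Γ i S) (hfar : ¬ IsFar D.G D.rs D.n {D.x} S) :
    1 ≤ D.n := by
  by_contra hn
  exact hfar (D.isFar_of_n_eq_zero (by omega) (hS.exits.mono Finset.sdiff_subset))

theorem rate_rpow_zero (D : DecaySetup Λ) {R : Finset Λ} (hR : (R.card : ℝ) ≤ D.M * (D.r : ℝ) ^ D.d) :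
    (D.c + 1) * D.h * R.card ≤ D.l * (D.q / (20 * D.δ)) := by
  have := D.strength.c_nonneg
  have := D.h_pos
  exact le_trans (by gcongr) D.rate

/-- A step of length at most `r` that is not suppressed by a gap. -/
theorem norm_lie_le_of_near (h : D.IsState Γ i b e m v)
    (hi : i < max D.n 1) (hS : D.IsStep Γ i S) {b' e' : ℕ} {v' : ℝ}
    (hres : b' ≤ (resonantSteps D.G D.J D.h D.Δ D.rs {D.x} (Function.update Γ i S) (i + 1)).card)
    (hs' : i + 1 = b' + e') (hv : v' + b' = v + b + 1) (hve : v' - e' = v - e)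
    (hbe : 1 + b + 2 * e ≤ b' + 2 * e')
    (htot : D.μ * (D.r / 4 * v' - D.k * e') ≤ D.μ * (D.r / 4 * v - D.k * e) + φ)
    (hnear : 1 ≤ D.n → ∀ u ∈ pathInterior D.G D.rs {D.x} Γ i ∪ S,
      ∃ u' ∈ pathInterior D.G D.rs {D.x} Γ i, D.G.dist D.x u ≤ D.G.dist D.x u' + D.r)
    (hR : 1 ≤ D.n → ∃ R : Finset Λ, Disjoint R (D.S₀ ∪ pathInterior D.G D.rs {D.x} Γ i) ∧
      D.S₀ ∪ pathInterior D.G D.rs {D.x} Γ i ∪ R =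
        D.S₀ ∪ (pathInterior D.G D.rs {D.x} Γ i ∪ S) ∧
      D.hopRegion Γ i p Z ⊆ R ∧ (R.card : ℝ) ≤ D.M * (D.r : ℝ) ^ D.d)
    (IH : i + 1 < max D.n 1 →
      D.IsState (Function.update Γ i S) (i + 1) b' e' (m + 1) v' →
      D.Bound (Function.update Γ i S) (i + 1) e' (m + 1) v') {s : ℝ} (hs : 0 ≤ s) :
    ‖⁅D.Φ p Z, heis (hamOn D.N D.Φ (D.S₀ ∪ pathInterior D.G D.rs {D.x} Γ i)ᶜ) s D.A⁆‖ ≤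
      ‖D.Φ p Z‖ * (‖D.A‖ * D.size i e m v * D.θ ^ (-φ)) * Real.exp (D.l * s) := by
  by_cases hfin : IsFar D.G D.rs D.n {D.x} S ∨ i + 1 = max D.n 1
  · have hcard := h.card_le hS hi hfin
    have hcov := h.le_cover
    have hml := h.m_le
    have hstep : (i : ℝ) = b + e := by exact_mod_cast h.steps
    obtain ⟨h3, h4⟩ := cover_ge (D := D) (S := S) (i := i) hfin (v := v') (b := b') (by linarith)
      (fun hn u hu => by
        obtain ⟨u', hu', hd⟩ := hnear hn u (Finset.mem_union_right _ hu)
        have h1 := h.reach u' hu'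
        have h2 : (D.G.dist D.x u : ℝ) ≤ D.G.dist D.x u' + D.r := by exact_mod_cast hd
        rw [hv]; linarith)
    have h5 := D.ten_le_size (b := b') (e := e') (m := m) (v := v') (by omega) (by linarith) h3 h4
      (le_trans (by exact_mod_cast hres) hcard)
    have h6 := D.size_step_le (i := i) (e := e) (m := m) (a := 0) (v := v) (v' := v') (e' := e')
      (φ := φ) (ψ := 0) (F := 1) (by nlinarith [D.one_le_q]) (by linarith)
    rw [Real.rpow_zero, one_mul, one_mul, add_zero, hs'] at h6
    rw [mul_assoc ‖D.A‖]
    exact D.norm_lie_le_of_two_le hs (by linarith)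
  · push Not at hfin
    obtain ⟨hfar, hlast⟩ := hfin
    have hn := one_le_n_of_not_isFar hS hfar
    obtain ⟨R, h1, h2, h3, h4⟩ := hR hn
    have hst := h.next_near hS hfar hres (hnear hn) hs' hv hve (m' := m + 1) (by omega)
    refine Bound.of_commute (ψ := 0) h hS hfar (IH (by omega) hst) h1 h2 h3 ?_ (by linarith) hs
    rw [neg_zero, Real.rpow_zero, mul_one]
    exact D.rate_rpow_zero h4

/-- A long step. -/
theorem norm_lie_le_of_long (h : D.IsState Γ i b e m v) (hop : D.IsHop Γ i p Z φ ℓ)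
    (hi : i < max D.n 1) (hS : D.IsStep Γ i S) (h0 : D.Φ p Z ≠ 0) (hℓ : D.r < ℓ)
    (hq : D.r < 2 * hopRange D.k p)
    (hTS : pathInterior D.G D.rs {D.x} Γ i ∪ S =
      pathInterior D.G D.rs {D.x} Γ i ∪ D.hopRegion Γ i p Z)
    (hnear : ∀ u ∈ pathInterior D.G D.rs {D.x} Γ i ∪ S,
      ∃ u' ∈ pathInterior D.G D.rs {D.x} Γ i, D.G.dist D.x u ≤ D.G.dist D.x u' + ℓ)
    (IH : ∀ v', i + 1 < max D.n 1 →
      D.IsState (Function.update Γ i S) (i + 1) b (e + 1) (m + 1) v' →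
      D.Bound (Function.update Γ i S) (i + 1) (e + 1) (m + 1) v') {s : ℝ} (hs : 0 ≤ s) :
    ‖⁅D.Φ p Z, heis (hamOn D.N D.Φ (D.S₀ ∪ pathInterior D.G D.rs {D.x} Γ i)ᶜ) s D.A⁆‖ ≤
      ‖D.Φ p Z‖ * (‖D.A‖ * D.size i e m v * D.θ ^ (-φ)) * Real.exp (D.l * s) := by
  have hr0 : (0 : ℝ) < D.r := by exact_mod_cast D.r_pos
  -- The reach `ℓ`, and one more unit as the reserve required by `alt`; both are paid by the
  -- condition `long`.
  set v' : ℝ := v + 1 + ℓ / D.r with hv'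
  have hrv : (D.r : ℝ) * v' = D.r * v + D.r + ℓ := by rw [hv']; field_simp
  have hℓ0 : (0 : ℝ) ≤ ℓ / D.r := by positivity
  have hcov := h.le_cover
  have hml := h.m_le
  have hstep : (i : ℝ) = b + e := by exact_mod_cast h.steps
  have hlong := hop.long hℓ
  have hμ := D.μ_le_one
  have hp0 : (0 : ℝ) ≤ (1 - D.μ) / 2 * p := by
    have : (0 : ℝ) ≤ p := Nat.cast_nonneg p
    exact mul_nonneg (by linarith) this
  have htot : D.μ * (D.r / 4 * v' - D.k * (e + 1 : ℕ)) + (1 - D.μ) / 2 * p ≤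
      D.μ * (D.r / 4 * v - D.k * e) + φ := by
    have : (D.r : ℝ) / 4 * v' = D.r / 4 * v + (D.r + ℓ) / 4 := by linarith
    rw [this]; push_cast; linarith
  have hreach : ∀ u ∈ pathInterior D.G D.rs {D.x} Γ i ∪ S,
      (D.G.dist D.x u : ℝ) + D.r ≤ D.r * (v' + b) := fun u hu => by
    obtain ⟨u', hu', hd⟩ := hnear u hu
    have h1 := h.reach u' hu'
    have h2 : (D.G.dist D.x u : ℝ) ≤ D.G.dist D.x u' + ℓ := by exact_mod_cast hd
    nlinarith
  have hres : b ≤ (resonantSteps D.G D.J D.h D.Δ D.rs {D.x} (Function.update Γ i S) (i + 1)).card := by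
    refine h.res.trans (Finset.card_le_card ?_)
    rw [resonantSteps_congr (agree Γ i S)]
    exact resonantSteps_mono (Nat.le_succ i)
  by_cases hfin : IsFar D.G D.rs D.n {D.x} S ∨ i + 1 = max D.n 1
  · have hcard := h.card_le hS hi hfin
    obtain ⟨h3, h4⟩ := cover_ge (D := D) (S := S) (i := i) hfin (v := v') (b := b)
      (by rw [hv']; linarith)
      (fun hn u hu => by linarith [hreach u (Finset.mem_union_right _ hu)])
    have h5 := D.ten_le_size (b := b) (e := e + 1) (m := m) (v := v') (by omega)
      (by push_cast; linarith) h3 h4 (le_trans (by exact_mod_cast hres) hcard)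
    have h6 := D.size_step_le (i := i) (e := e) (m := m) (a := 0) (v := v) (v' := v') (e' := e + 1)
      (φ := φ) (ψ := 0) (F := 1) (by nlinarith [D.one_le_q]) (by linarith)
    rw [Real.rpow_zero, one_mul, one_mul, add_zero, h.steps, add_assoc] at h6
    rw [mul_assoc ‖D.A‖, h.steps]
    exact D.norm_lie_le_of_two_le hs (by linarith)
  · push Not at hfin
    obtain ⟨hfar, hlast⟩ := hfin
    have hst : D.IsState (Function.update Γ i S) (i + 1) b (e + 1) (m + 1) v' := by
      refine h.next hS hfar hres (fun u hu => ?_) (by have := h.steps; omega)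
        (by push_cast; linarith) (by omega) (Or.inr ⟨by omega, hreach⟩)
      linarith [hreach u hu]
    refine Bound.of_commute (R := D.hopRegion Γ i p Z) (ψ := (1 - D.μ) / 2 * p) h hS hfar
      (IH v' (by omega) hst) disjoint_hopRegion ?_ subset_rfl ?_ htot hs
    · rw [hTS, Finset.union_assoc]
    · have hp : 1 ≤ p := by
        by_contra hp
        rw [hopRange, if_pos (by omega)] at hq
        have := D.k_lt
        omega
      obtain ⟨u, hu, -⟩ := hop.touch
      have hcard : ((D.hopRegion Γ i p Z).card : ℝ) ≤ D.M * (p : ℝ) ^ D.d := by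
        refine le_trans ?_ (D.dim u p hp)
        have h1 := hopRegion_subset_ball (D := D) (Γ := Γ) (i := i) h0 hu
        rw [Nat.sub_eq_zero_of_le hq.le, add_zero, hopRange, if_neg (by omega)] at h1
        exact_mod_cast Finset.card_le_card h1
      have h1 := D.rate_far p hp
      have hθ := D.θ_pos
      have := D.strength.c_nonneg
      have := D.h_pos
      rw [Real.rpow_neg hθ.le, ← div_eq_mul_inv, le_div_iff₀ (by positivity)]
      refine le_trans ?_ h1
      gcongr

end DecaySetup

/-! ### Steps with a gap, and the backward induction -/

namespace DecaySetup

variable {Λ : Type*} [Fintype Λ] [LinearOrder Λ] {D : DecaySetup Λ}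
variable {Γ : ℕ → Finset Λ} {i b e m p : ℕ} {v φ : ℝ} {ℓ : ℕ} {Z S : Finset Λ}

/-- The two estimates for a hop into a non-resonant region. -/
theorem norm_lie_le_of_gap {y₀ : Λ} (hsmall : 2 * hopRange D.k p ≤ D.r)
    (hp : (p : ℝ) / 2 < D.μ * (D.r / 4 - D.k)) (hnon : NonResonantBall D.G D.J D.h D.Δ D.rs y₀)
    (hsub : D.S₁ ⊆ (D.S₀ ∪ pathInterior D.G D.rs {D.x} Γ i)ᶜ)
    {R : Finset Λ} (hR : Disjoint R (D.S₀ ∪ pathInterior D.G D.rs {D.x} Γ i))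
    (hRy : R ⊆ ball D.G y₀ D.rs) (hZR : D.hopRegion Γ i p Z ⊆ R) (hRS : Disjoint R D.S₁)
    (hcard : (R.card : ℝ) ≤ D.M * (D.r : ℝ) ^ D.d) :
    (∀ s, 0 ≤ s →
      ‖⁅D.Φ p Z, heis (hamOn D.N D.Φ (D.S₀ ∪ pathInterior D.G D.rs {D.x} Γ i)ᶜ) s D.A⁆‖ ≤
        ‖D.Φ p Z‖ * ‖D.A‖ * D.θ ^ (D.μ * (D.r / 4 - D.k) - p / 2) *
          (28 * (D.q / (20 * D.δ)) + 8) * Real.exp (D.l * s)) ∧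
    ∀ κ, 0 ≤ κ → (∀ t ∈ hops D.N (D.S₀ ∪ pathInterior D.G D.rs {D.x} Γ i)ᶜ R, ∀ u, 0 ≤ u →
      ‖⁅D.Φ t.1 t.2, heis (hamOn D.N D.Φ ((D.S₀ ∪ pathInterior D.G D.rs {D.x} Γ i)ᶜ \ R)) u D.A⁆‖ ≤
        ‖D.Φ t.1 t.2‖ * (κ * D.θ ^ (-(t.1 : ℝ) / 2)) * Real.exp (D.l * u)) →
      ∀ s, 0 ≤ s →
      ‖⁅D.Φ p Z, heis (hamOn D.N D.Φ (D.S₀ ∪ pathInterior D.G D.rs {D.x} Γ i)ᶜ) s D.A⁆‖ ≤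
        ‖D.Φ p Z‖ * κ * D.θ ^ (D.μ * (D.r / 4 - D.k) - p / 2) *
          (16 * (D.q / (20 * D.δ)) + 28 * (D.q / (20 * D.δ)) ^ 2) * Real.exp (D.l * s) := by
  set γ : ℝ := D.μ * (D.r / 4 - D.k) - p / 2 with hγ
  have hγ0 : 0 < γ := by linarith
  have hl := D.l_pos
  have hRY : R ⊆ (D.S₀ ∪ pathInterior D.G D.rs {D.x} Γ i)ᶜ := fun u hu =>
    Finset.mem_compl.2 (Finset.disjoint_left.1 hR hu)
  have hO : D.Φ p Z ∈ suppAlg (Z \ (D.S₀ ∪ pathInterior D.G D.rs {D.x} Γ i) ∪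
      ((D.S₀ ∪ pathInterior D.G D.rs {D.x} Γ i)ᶜ)ᶜ) := by
    refine suppAlg_mono (fun u hu => ?_) (D.model.supported p Z)
    rw [compl_compl, Finset.sdiff_union_self_eq_union]
    exact Finset.mem_union_left _ hu
  -- The number of rotations is `⌈γ⌉₊ - 1`, the least that gives `θ ^ γ`. The tail order of a hop of
  -- order `p'` is `⌈γ - p'/2⌉₊`, which is `0` when that difference is not positive.
  have hceil : 0 < ⌈γ⌉₊ := Nat.ceil_pos.2 hγ0
  have hcast : ((⌈γ⌉₊ - 1 : ℕ) : ℝ) = (⌈γ⌉₊ : ℝ) - 1 := by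
    rw [Nat.cast_sub hceil, Nat.cast_one]
  have ha : γ ≤ ((⌈γ⌉₊ - 1 : ℕ) : ℝ) + 1 := by rw [hcast]; linarith [Nat.le_ceil γ]
  have ha' : ((⌈γ⌉₊ - 1 : ℕ) : ℝ) < γ := by rw [hcast]; linarith [Nat.ceil_lt_add_one hγ0.le]
  have key := norm_lie_heis_le_of_gap D.conn D.model D.strength hRY (subset_hopRegion.trans hZR)
    hsub hRS D.mem_A hO (mul_pos D.h_pos D.Δ_pos) (hnon R hRy) D.one_le_y D.y_mul_ε D.ρ_le
    (D.gap_le y₀ R hRy) D.θ_pos D.θ_le D.ε_le D.one_le_θy ha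
    (τ := fun p' => ⌈γ - (p' : ℝ) / 2⌉₊) (fun p' => Nat.le_ceil _)
    (hop_far (τ := fun p' => ⌈γ - (p' : ℝ) / 2⌉₊) hsmall hZR hγ ha' fun p' hp' => by
      linarith [Nat.ceil_lt_add_one (Nat.ceil_pos.1 hp').le])
    hl (D.rate_rpow_zero hcard)
  rwa [mul_div_cancel_left₀ _ hl.ne'] at key

/-- A hop into a non-resonant ball. -/
theorem norm_lie_le_of_nonresonant (h : D.IsState Γ i b e m v) (hop : D.IsHop Γ i p Z φ ℓ)
    (hi : i < max D.n 1) (hS : D.IsStep Γ i S) (h0 : D.Φ p Z ≠ 0) {y₀ : Λ}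
    (hTS : pathInterior D.G D.rs {D.x} Γ i ∪ S =
      pathInterior D.G D.rs {D.x} Γ i ∪ ball D.G y₀ D.rs)
    (hWy : D.hopRegion Γ i p Z ⊆ ball D.G y₀ D.rs)
    (hnear : 1 ≤ D.n → ∀ u ∈ pathInterior D.G D.rs {D.x} Γ i ∪ S,
      ∃ u' ∈ pathInterior D.G D.rs {D.x} Γ i, D.G.dist D.x u ≤ D.G.dist D.x u' + D.r)
    (hsmall : 2 * hopRange D.k p ≤ D.r)
    (hp : (p : ℝ) / 2 < D.μ * (D.r / 4 - D.k)) (hnon : NonResonantBall D.G D.J D.h D.Δ D.rs y₀)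
    (IH : i + 1 < max D.n 1 →
      D.IsState (Function.update Γ i S) (i + 1) b (e + 1) (m + 2) (v + 1) →
      D.Bound (Function.update Γ i S) (i + 1) (e + 1) (m + 2) (v + 1)) {s : ℝ} (hs : 0 ≤ s) :
    ‖⁅D.Φ p Z, heis (hamOn D.N D.Φ (D.S₀ ∪ pathInterior D.G D.rs {D.x} Γ i)ᶜ) s D.A⁆‖ ≤
      ‖D.Φ p Z‖ * (‖D.A‖ * D.size i e m v * D.θ ^ (-φ)) * Real.exp (D.l * s) := by
  have hδ := D.δ_pos
  have hδ1 := D.δ_le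
  have hq := D.one_le_q
  have hθ := D.θ_pos
  have hml := h.m_le
  have hcov := h.le_cover
  have hφ := hop.le_φ
  have hstep : (i : ℝ) = b + e := by exact_mod_cast h.steps
  have hres : b ≤ (resonantSteps D.G D.J D.h D.Δ D.rs {D.x} (Function.update Γ i S) (i + 1)).card := by
    refine h.res.trans (Finset.card_le_card ?_)
    rw [resonantSteps_congr (agree Γ i S)]
    exact resonantSteps_mono (Nat.le_succ i)
  set γ : ℝ := D.μ * (D.r / 4 - D.k) - p / 2 with hγ
  have hγ1 : 0 ≤ D.θ ^ γ := Real.rpow_nonneg hθ.le _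
  have htot : D.μ * (D.r / 4 * (v + 1) - D.k * (e + 1 : ℕ)) ≤
      D.μ * (D.r / 4 * v - D.k * e) + φ + γ := by
    push_cast; linarith
  have hqδ : 1 ≤ D.q / D.δ := (one_le_div hδ).2 (hδ1.trans hq)
  have hz : D.q / (20 * D.δ) = D.q / D.δ / 20 := by field_simp
  by_cases hfin : IsFar D.G D.rs D.n {D.x} S ∨ i + 1 = max D.n 1
  · have hcard := le_trans (Nat.cast_le.2 hres) (h.card_le hS hi hfin)
    -- In the last step the ball itself may reach `S₁`. The decoupling is then done in the smaller
    -- region of the hop, which is also non-resonant, as a subset of the ball.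
    by_cases hd : Disjoint (D.hopRegion Γ i p Z) D.S₁
    · obtain ⟨h3, h4⟩ := cover_ge (D := D) (S := S) (i := i) hfin (v := v + 1) (b := b)
        (by linarith)
        (fun hn u hu => by
          obtain ⟨u', hu', hd⟩ := hnear hn u (Finset.mem_union_right _ hu)
          have h1 := h.reach u' hu'
          have h2 : (D.G.dist D.x u : ℝ) ≤ D.G.dist D.x u' + D.r := by exact_mod_cast hd
          linarith)
      have h5 := D.ten_le_size (b := b) (e := e + 1) (m := m + 1) (v := v + 1) (by omega)
        (by push_cast; linarith) h3 h4 hcard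
      rw [← add_assoc, ← h.steps] at h5
      have h6 := D.size_step_le (i := i) (e := e) (m := m) (a := 1) (v := v) (v' := v + 1)
        (e' := e + 1) (φ := φ) (ψ := γ) (F := D.q / D.δ) (by
          rw [pow_one, div_mul_cancel₀ _ hδ.ne']; nlinarith) htot
      obtain ⟨u₀, hu₀, -⟩ := hop.touch
      have hcardR : ((D.hopRegion Γ i p Z).card : ℝ) ≤ D.M * (D.r : ℝ) ^ D.d := by
        refine le_trans ?_ (card_ball_le (z := u₀) le_rfl)
        have h1 := hopRegion_subset_ball (D := D) (Γ := Γ) (i := i) h0 hu₀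
        refine Nat.cast_le.2 (Finset.card_le_card (h1.trans fun u hu => ?_))
        have := mem_ball.1 hu
        exact mem_ball.2 (by omega)
      have key := (norm_lie_le_of_gap hsmall hp hnon h.subset_compl disjoint_hopRegion hWy subset_rfl
        hd hcardR).1 s hs
      refine key.trans ?_
      rw [← hγ, hz]
      calc ‖D.Φ p Z‖ * ‖D.A‖ * D.θ ^ γ * (28 * (D.q / D.δ / 20) + 8) * Real.exp (D.l * s)
          ≤ ‖D.Φ p Z‖ * ‖D.A‖ * D.θ ^ γ * (D.q / D.δ * 10) * Real.exp (D.l * s) := by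
            gcongr; linarith
        _ ≤ ‖D.Φ p Z‖ * ‖D.A‖ * D.θ ^ γ * (D.q / D.δ * D.size (i + 1) (e + 1) (m + 1) (v + 1)) *
            Real.exp (D.l * s) := by gcongr
        _ = ‖D.Φ p Z‖ * (‖D.A‖ * (D.q / D.δ * D.θ ^ γ * D.size (i + 1) (e + 1) (m + 1) (v + 1))) *
            Real.exp (D.l * s) := by ring
        _ ≤ ‖D.Φ p Z‖ * (‖D.A‖ * (D.size i e m v * D.θ ^ (-φ))) * Real.exp (D.l * s) := by gcongr
        _ = _ := by ring
    · obtain ⟨z, hz, hz1⟩ := Finset.not_disjoint_iff.1 hd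
      obtain ⟨u, hu, huS, hlt⟩ := dist_of_mem_hopRegion h0 hsmall hop hz hz1
      have hi0 : i ≠ 0 := by
        rintro rfl
        rw [pathInterior, Finset.mem_singleton] at hu
        exact huS (hu ▸ D.mem_x)
      have hi1 : (1 : ℝ) ≤ i := by exact_mod_cast Nat.one_le_iff_ne_zero.2 hi0
      have hr0 : (0 : ℝ) < D.r := by exact_mod_cast D.r_pos
      have hlt' : (D.n : ℝ) * D.r + 1 < D.G.dist D.x u + D.r := by exact_mod_cast hlt
      rw [mul_assoc ‖D.A‖]
      refine D.norm_lie_le_of_two_le hs (le_trans ?_ (D.le_neg_rpow hop.φ_nonneg))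
      -- If even the region of the hop meets `S₁`, the interior already extends beyond `(n-1)r`.
      -- Without long steps this contradicts `i < max n 1`; with one, the reserve in `alt` makes the
      -- trivial bound sufficient already.
      rcases h.alt with h1 | ⟨h1, h2⟩
      · exfalso
        have h3 := h.reach u hu
        rw [h1, add_comm (e : ℝ), ← hstep] at h3
        have h4 : (D.n : ℝ) * D.r < ((i + 1 : ℕ) : ℝ) * D.r := by push_cast; linarith
        have h5 : D.n < i + 1 := by exact_mod_cast lt_of_mul_lt_mul_right h4 hr0.le
        omega
      · have h3 := h2 u hu
        have h4 : (D.n : ℝ) * D.r ≤ (v + b) * D.r := by linarith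
        have h5 := D.ten_le_size h1 hcov (le_of_mul_le_mul_right h4 hr0) (by linarith) hcard
        rw [← h.steps] at h5
        linarith
  · push Not at hfin
    obtain ⟨hfar, hlast⟩ := hfin
    have hn := one_le_n_of_not_isFar hS hfar
    have hst := h.next_near hS hfar (b' := b) (e' := e + 1) (m' := m + 2) (v' := v + 1) hres
      (hnear hn) (by have := h.steps; omega) (by ring) (by push_cast; ring) (by omega)
    set T := D.S₀ ∪ pathInterior D.G D.rs {D.x} Γ i with hT
    have hR : Disjoint (ball D.G y₀ D.rs \ T) T := Finset.sdiff_disjoint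
    have hRS : T ∪ ball D.G y₀ D.rs \ T = D.S₀ ∪ (pathInterior D.G D.rs {D.x} Γ i ∪ S) := by
      rw [Finset.union_sdiff_self_eq_union, hTS, hT, Finset.union_assoc]
    have hB := (IH (by omega) hst).hops_le hS hR hRS
    have hsz := D.size_nonneg (i + 1) (e + 1) (m + 2) (v + 1)
    have hZR : D.hopRegion Γ i p Z ⊆ ball D.G y₀ D.rs \ T :=
      Finset.subset_sdiff.2 ⟨hWy, disjoint_hopRegion⟩
    have hR1 : Disjoint (ball D.G y₀ D.rs \ T) D.S₁ := by
      have h1 : ball D.G y₀ D.rs \ T ⊆ pathInterior D.G D.rs {D.x} Γ i ∪ S := by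
        rw [hTS]; exact Finset.sdiff_subset.trans Finset.subset_union_right
      refine Disjoint.mono_left h1 ?_
      have := hst.disj
      rwa [hS.interior_succ] at this
    have hcardR : ((ball D.G y₀ D.rs \ T).card : ℝ) ≤ D.M * (D.r : ℝ) ^ D.d := by
      refine le_trans ?_ (card_ball_le (z := y₀) (j := D.rs) (by have := D.r_eq hn; omega))
      exact Nat.cast_le.2 (Finset.card_le_card Finset.sdiff_subset)
    have key := (norm_lie_le_of_gap hsmall hp hnon h.subset_compl hR Finset.sdiff_subset hZR hR1
      hcardR).2 (‖D.A‖ * D.size (i + 1) (e + 1) (m + 2) (v + 1)) (by positivity) hB s hs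
    refine key.trans ?_
    have h6 := D.size_step_le (i := i) (e := e) (m := m) (a := 2) (v := v) (v' := v + 1)
      (e' := e + 1) (φ := φ) (ψ := γ) (F := (D.q / D.δ) ^ 2) (by
        rw [← mul_pow, div_mul_cancel₀ _ hδ.ne']) htot
    rw [← hγ, hz]
    -- Two Duhamel factors: with `z = q/(20δ)` and `q/δ ≥ 1`, one has `16z + 28z² ≤ (0.8 +
    -- 0.07)(q/δ)²`.
    calc ‖D.Φ p Z‖ * (‖D.A‖ * D.size (i + 1) (e + 1) (m + 2) (v + 1)) * D.θ ^ γ *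
          (16 * (D.q / D.δ / 20) + 28 * (D.q / D.δ / 20) ^ 2) * Real.exp (D.l * s)
        ≤ ‖D.Φ p Z‖ * (‖D.A‖ * D.size (i + 1) (e + 1) (m + 2) (v + 1)) * D.θ ^ γ *
          ((D.q / D.δ) ^ 2) * Real.exp (D.l * s) := by
          gcongr; nlinarith
      _ = ‖D.Φ p Z‖ * (‖D.A‖ * ((D.q / D.δ) ^ 2 * D.θ ^ γ *
          D.size (i + 1) (e + 1) (m + 2) (v + 1))) * Real.exp (D.l * s) := by ring
      _ ≤ ‖D.Φ p Z‖ * (‖D.A‖ * (D.size i e m v * D.θ ^ (-φ))) * Real.exp (D.l * s) := by gcongr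
      _ = _ := by ring

/-- The estimate after `i` steps follows from the estimate after `i + 1` steps. -/
theorem IsState.bound_of_succ (h : D.IsState Γ i b e m v) (hi : i < max D.n 1)
    (IH : ∀ S b' e' m' v', i + 1 < max D.n 1 →
      D.IsState (Function.update Γ i S) (i + 1) b' e' m' v' →
      D.Bound (Function.update Γ i S) (i + 1) e' m' v') : D.Bound Γ i e m v := by
  intro p Z φ ℓ hop s hs
  by_cases h0 : D.Φ p Z = 0
  · rw [h0, op_zero_lie]; simp
  obtain ⟨S, hS, hWS, hcase⟩ := exists_isStep hop h0
  have hres : b ≤ (resonantSteps D.G D.J D.h D.Δ D.rs {D.x} (Function.update Γ i S) (i + 1)).card := by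
    refine h.res.trans (Finset.card_le_card ?_)
    rw [resonantSteps_congr (agree Γ i S)]
    exact resonantSteps_mono (Nat.le_succ i)
  have hr : 8 * (D.k : ℝ) < D.r := by exact_mod_cast D.k_lt
  have hμ := D.μ_le_one
  have hμ0 := D.μ_pos
  have hφ := hop.le_φ
  have hk : (0 : ℝ) ≤ D.k := Nat.cast_nonneg _
  have hsteps := h.steps
  rcases hcase with ⟨hc, hTS, hWy, hnear⟩ | ⟨hq, hTS, hnear⟩
  · have hR : 1 ≤ D.n → ∃ R : Finset Λ, Disjoint R (D.S₀ ∪ pathInterior D.G D.rs {D.x} Γ i) ∧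
        D.S₀ ∪ pathInterior D.G D.rs {D.x} Γ i ∪ R =
          D.S₀ ∪ (pathInterior D.G D.rs {D.x} Γ i ∪ S) ∧
        D.hopRegion Γ i p Z ⊆ R ∧ (R.card : ℝ) ≤ D.M * (D.r : ℝ) ^ D.d := by
      intro hn
      refine ⟨_, Finset.sdiff_disjoint, ?_, Finset.subset_sdiff.2 ⟨hWy, disjoint_hopRegion⟩, ?_⟩
      · rw [Finset.union_sdiff_self_eq_union, hTS, Finset.union_assoc]
      · refine le_trans ?_ (card_ball_le
          (z := (centers D.G D.rs (pathInterior D.G D.rs {D.x} Γ i) S).min' hc) (j := D.rs)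
          (by have := D.r_eq hn; omega))
        exact Nat.cast_le.2 (Finset.card_le_card Finset.sdiff_subset)
    -- A hop of high order brings `θ ^ (p/2)`, which alone pays for a step of length `r`; the gap is
    -- only needed for low orders.
    by_cases hp : (p : ℝ) / 2 < D.μ * (D.r / 4 - D.k)
    · by_cases hnon : NonResonantBall D.G D.J D.h D.Δ D.rs
        ((centers D.G D.rs (pathInterior D.G D.rs {D.x} Γ i) S).min' hc)
      · have hsmall : 2 * hopRange D.k p ≤ D.r := by
          have h1 : D.μ * (D.r / 4 - D.k) ≤ D.r / 4 - D.k :=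
            mul_le_of_le_one_left (by linarith) hμ
          unfold hopRange
          split_ifs with hp0
          · have := D.k_lt; omega
          · have : (2 : ℝ) * p ≤ D.r := by linarith
            exact_mod_cast this
        exact norm_lie_le_of_nonresonant h hop hi hS h0 hTS hWy hnear hsmall hp hnon
          (IH S _ _ _ _) hs
      -- A resonant step gains no power of `θ`; it increases `b`, which partial non-resonance
      -- limits.
      · refine norm_lie_le_of_near (b' := b + 1) (e' := e) (v' := v) h hi hS ?_ (by omega)
          (by push_cast; ring) rfl (by omega) (by linarith [hop.φ_nonneg]) hnear hR (IH S _ _ _ _) hs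
        have hci : (centers D.G D.rs (pathInterior D.G D.rs {D.x} (Function.update Γ i S) i)
            (Function.update Γ i S i)).Nonempty := by
          rwa [Function.update_self, interior_update D Γ le_rfl]
        refine le_trans ?_ (card_resonantSteps_succ hci ?_)
        · rw [← resonantSteps_congr (agree Γ i S)]
          exact Nat.succ_le_succ h.res
        · have : ∀ (T S' : Finset Λ) (hc' : (centers D.G D.rs T S').Nonempty),
              T = pathInterior D.G D.rs {D.x} Γ i → S' = S →
              ¬ NonResonantBall D.G D.J D.h D.Δ D.rs ((centers D.G D.rs T S').min' hc') := by
            rintro _ _ hc' rfl rfl; exact hnon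
          exact this _ _ hci (interior_update D Γ le_rfl S) (Function.update_self ..)
    · push Not at hp
      exact norm_lie_le_of_near (b' := b) (e' := e + 1) (v' := v + 1) h hi hS hres (by omega)
        (by ring) (by push_cast; ring) (by omega) (by push_cast; linarith) hnear hR
        (IH S _ _ _ _) hs
  · rcases Nat.lt_or_ge D.r ℓ with hℓ | hℓ
    · exact norm_lie_le_of_long h hop hi hS h0 hℓ hq hTS hnear (fun v' => IH S _ _ _ _) hs
    · have hp : D.μ * (D.r / 4 - D.k) ≤ p / 2 := by
        have h1 : D.μ * (D.r / 4 - D.k) ≤ D.r / 4 - D.k :=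
          mul_le_of_le_one_left (by linarith) hμ
        rw [hopRange] at hq
        split_ifs at hq with hp0
        · have := D.k_lt; omega
        · have : (D.r : ℝ) < 2 * p := by exact_mod_cast hq
          linarith
      refine norm_lie_le_of_near (b' := b) (e' := e + 1) (v' := v + 1) h hi hS hres (by omega)
        (by ring) (by push_cast; ring) (by omega) (by push_cast; linarith)
        (fun _ u hu => ?_) (fun _ => ⟨D.hopRegion Γ i p Z, disjoint_hopRegion, ?_, subset_rfl, ?_⟩)
        (IH S _ _ _ _) hs
      · obtain ⟨u', hu', hd⟩ := hnear u hu
        exact ⟨u', hu', by omega⟩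
      · rw [hTS, Finset.union_assoc]
      · obtain ⟨u₀, hu₀, -⟩ := hop.touch
        refine le_trans ?_ (card_ball_le (z := u₀) (j := hopRange D.k p) (hop.le_ℓ.trans hℓ))
        have h1 := hopRegion_subset_ball (D := D) (Γ := Γ) (i := i) h0 hu₀
        rw [Nat.sub_eq_zero_of_le hq.le, add_zero] at h1
        exact Nat.cast_le.2 (Finset.card_le_card h1)

/-- Backward induction on the number `j` of remaining steps. The base case needs no separate
estimate: when `i + 1 = max n 1` the next step is final. The maximum accounts for `n = 0`, where one
step is still made. -/
theorem IsState.bound : ∀ (j : ℕ) {Γ : ℕ → Finset Λ} {i b e m : ℕ} {v : ℝ},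
    D.IsState Γ i b e m v → i + j + 1 = max D.n 1 → D.Bound Γ i e m v
  | 0, _, _, _, _, _, _, h, hi => h.bound_of_succ (by omega) fun _ _ _ _ _ hlt _ => by omega
  | j + 1, _, _, _, _, _, _, h, hi => h.bound_of_succ (by omega) fun _ _ _ _ _ _ h' => h'.bound j (by omega)

/-- The estimate for the hops out of `x`. -/
theorem bound_zero (D : DecaySetup Λ) (Γ : ℕ → Finset Λ) : D.Bound Γ 0 0 0 0 := by
  have h : D.IsState Γ 0 0 0 0 0 := by
    refine ⟨⟨?_, ?_, ?_, ?_⟩, Nat.zero_le _, ?_, ?_, rfl, by simp, le_rfl, Or.inl (by simp)⟩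
    · intro j hj; omega
    · intro j hj; omega
    · intro j hj; omega
    · intro j hj; omega
    · intro u hu
      rw [pathInterior, Finset.mem_singleton] at hu
      simp [hu]
    · rw [pathInterior, Finset.disjoint_singleton_left]
      exact Finset.disjoint_left.1 D.disjoint_S₀ D.mem_x
  exact h.bound (max D.n 1 - 1) (by omega)

end DecaySetup

/-! ### The first crossing of `∂S₀` -/

namespace DecaySetup

variable {Λ : Type*} [Fintype Λ] [LinearOrder Λ] (D : DecaySetup Λ)

/-- The same data with a different starting point of the paths. -/
def moveTo (x : Λ) (hx : x ∈ D.S₀)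
    (hr : ∀ (Γ : ℕ → Finset Λ) (l : ℕ), IsPath D.G D.rs D.n {x} Γ l →
      ((resonantSteps D.G D.J D.h D.Δ D.rs {x} Γ l).card : ℝ) ≤ (1 - D.ζ) * D.n) :
    DecaySetup Λ :=
  { D with x := x, mem_x := hx, resonant_le := hr }

/-- A term that crosses `∂S₀` need not contain a boundary vertex. The vertex `x` lies on a geodesic
between two of its points, so the whole term is only known to be within twice its range from `x`. -/
theorem exists_boundary_of_mem_hops {t : ℕ × Finset Λ} (ht : t ∈ hops D.N Finset.univ D.S₀)
    (h0 : D.Φ t.1 t.2 ≠ 0) : ∃ x ∈ boundary D.G D.S₀,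
      (∃ z ∈ t.2, z ∉ D.S₀ ∧ D.G.dist x z ≤ hopRange D.k t.1) ∧
      ¬ Disjoint t.2 (ball D.G x (hopRange D.k t.1)) := by
  obtain ⟨-, -, h1, h2⟩ := mem_hops.1 ht
  obtain ⟨z, hz, hzS⟩ := Finset.not_subset.1 h1
  obtain ⟨a, ha, haS⟩ := Finset.not_disjoint_iff.1 h2
  have hd := graphDiam_le_iff.1 (D.model.range_le _ _ h0) a ha z hz
  obtain ⟨y, hy, x, hx, hadj, h3, h4⟩ := exists_adj_dist_lt D.conn hzS _ a haS hd
  have h5 : D.G.dist x y = 1 := SimpleGraph.dist_eq_one_iff_adj.2 hadj.symm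
  have h6 := D.conn.dist_triangle (u := x) (v := y) (w := z)
  refine ⟨x, mem_boundary.2 ⟨hx, y, hy, hadj.symm⟩, ⟨z, hz, hzS, by omega⟩,
    Finset.not_disjoint_iff.2 ⟨a, ha, mem_ball.2 ?_⟩⟩
  rw [D.G.dist_comm]
  omega

theorem norm_lie_le_of_mem_hops
    (hr : ∀ x ∈ boundary D.G D.S₀, ∀ (Γ : ℕ → Finset Λ) (l : ℕ), IsPath D.G D.rs D.n {x} Γ l →
      ((resonantSteps D.G D.J D.h D.Δ D.rs {x} Γ l).card : ℝ) ≤ (1 - D.ζ) * D.n)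
    {t : ℕ × Finset Λ} (ht : t ∈ hops D.N Finset.univ D.S₀) {s : ℝ} (hs : 0 ≤ s) :
    ‖⁅D.Φ t.1 t.2, heis (hamOn D.N D.Φ (Finset.univ \ D.S₀)) s D.A⁆‖ ≤
      ‖D.Φ t.1 t.2‖ * (‖D.A‖ * D.E * D.θ ^ (-((1 + D.μ) / 2 * t.1))) * Real.exp (D.l * s) := by
  by_cases h0 : D.Φ t.1 t.2 = 0
  · rw [h0, op_zero_lie]; simp
  obtain ⟨x, hx, ⟨z, hz, hzS, hd⟩, -⟩ := D.exists_boundary_of_mem_hops ht h0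
  obtain ⟨-, -, -, h2⟩ := mem_hops.1 ht
  obtain ⟨a, ha, haS⟩ := Finset.not_disjoint_iff.1 h2
  have hxS := (mem_boundary.1 hx).1
  have hq := graphDiam_le_iff.1 (D.model.range_le _ _ h0)
  set D' := D.moveTo x hxS (hr x hx) with hD'
  have hint : pathInterior D'.G D'.rs {D'.x} (fun _ => ∅) 0 = {x} := rfl
  have hunion : D'.S₀ ∪ ({x} : Finset Λ) = D.S₀ :=
    Finset.union_eq_left.2 (Finset.singleton_subset_iff.2 hxS)
  -- With reach `2p > r`, the condition `long` asks for at most `μp + (1-μ)p/2 = (1+μ)p/2`. Of the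
  -- factor `θ ^ p` of the term there remains `θ ^ ((1-μ)p/2)`, which pays for the volume `p ^ d`.
  have hhop : D'.IsHop (fun _ => ∅) 0 t.1 t.2 ((1 + D.μ) / 2 * t.1) (2 * hopRange D.k t.1) := by
    have hp0 : (0 : ℝ) ≤ t.1 := Nat.cast_nonneg _
    have hμ := D.μ_pos
    refine ⟨⟨x, by simp [hint], fun j hj => by omega⟩,
      ⟨x, by simp [hint], z, hz, by rwa [hint, hunion], hd⟩,
      ⟨a, ha, by rwa [hint, hunion]⟩, fun v hv _ => ⟨x, by simp [hint], ?_⟩, ?_, by nlinarith,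
      fun hlong => ?_⟩
    · have h3 := D.conn.dist_triangle (u := x) (v := z) (w := v)
      have h4 := hq z hz v hv
      change D.G.dist x v ≤ _
      omega
    · change hopRange D.k t.1 ≤ _
      omega
    · change D.r < 2 * hopRange D.k t.1 at hlong
      change D.μ * ((D.r + (2 * hopRange D.k t.1 : ℕ)) / 4 - D.k) + (1 - D.μ) / 2 * t.1 ≤
        (1 + D.μ) / 2 * t.1
      have hk := D.k_lt
      have hp : t.1 ≠ 0 := by
        intro h
        rw [hopRange, if_pos h] at hlong
        omega
      rw [hopRange, if_neg hp] at hlong ⊢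
      have h1 : (D.r : ℝ) < 2 * t.1 := by exact_mod_cast hlong
      have h3 := mul_nonneg hμ.le (Nat.cast_nonneg (α := ℝ) D.k)
      push_cast
      nlinarith
  have key := D'.bound_zero (fun _ => ∅) _ _ _ _ hhop s hs
  have hsize : D'.size 0 0 0 0 = D.E := by
    simp only [size]
    simp only [hD', moveTo]
    simp
  rw [hsize, hint, hunion] at key
  rw [← Finset.compl_eq_univ_sdiff]
  exact key

/-- The estimate of the commutator, in terms of the strength of the first crossing. -/
theorem norm_lie_heis_le
    (hr : ∀ x ∈ boundary D.G D.S₀, ∀ (Γ : ℕ → Finset Λ) (l : ℕ), IsPath D.G D.rs D.n {x} Γ l →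
      ((resonantSteps D.G D.J D.h D.Δ D.rs {x} Γ l).card : ℝ) ≤ (1 - D.ζ) * D.n)
    {K : ℝ} (hK0 : D.M * (max D.k 1 : ℕ) ^ D.d ≤ K)
    (hK : ∀ p : ℕ, 1 ≤ p → D.M * (p : ℝ) ^ D.d * D.θ ^ ((1 - D.μ) / 2 * p) ≤ K)
    {B : Op Λ} (hB : B ∈ suppAlg D.S₀) {s : ℝ} (hs : 0 ≤ s) :
    ‖⁅B, heis (hamOn D.N D.Φ Finset.univ) s D.A⁆‖ ≤
      2 * ‖B‖ * ((boundary D.G D.S₀).card * ((D.c + 1) * D.h * K * ‖D.A‖ * D.E) *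
        (Real.exp (D.l * s) - 1) / D.l) := by
  classical
  have hE := D.E_nonneg
  have hθ := D.θ_pos
  have hθ1 := D.θ_le
  have hl := D.l_pos
  have hM := D.M_nonneg
  have hε := D.strength.ε_nonneg
  have hK' : 0 ≤ K := le_trans (by positivity) hK0
  have hh := D.h_pos
  have hc := D.strength.c_nonneg
  set f : ℕ → ℝ := fun p => ‖D.A‖ * D.E * D.θ ^ (-((1 + D.μ) / 2 * p)) with hf
  have hf0 : ∀ p, 0 ≤ f p := fun p => by positivity
  -- The removed region is all of `S₀`. Without its hops `B` and the evolved `A` commute, and each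
  -- hop is then charged to a boundary vertex.
  have key := D.model.norm_lie_heis_le (N := D.N) (Finset.subset_univ D.S₀) D.mem_A D.disjoint_S₀ B
    (κ := fun t => if D.Φ t.1 t.2 = 0 then 0 else ‖D.Φ t.1 t.2‖ * f t.1) hl hs (fun t ht u hu => by
      split_ifs with h0
      · rw [h0, op_zero_lie]; simp
      · exact D.norm_lie_le_of_mem_hops hr ht hu)
  have h0 : ⁅B, heis (hamOn D.N D.Φ (Finset.univ \ D.S₀)) s D.A⁆ = 0 :=
    lie_eq_zero_of_commute (Commute.heis_right
      (commute_of_disjoint Finset.disjoint_sdiff hB (D.model.hamOn_mem _))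
      (commute_of_disjoint D.disjoint_S₀ hB D.mem_A) s)
  rw [h0, norm_zero, zero_add] at key
  refine key.trans ?_
  have hsum : ∑ t ∈ hops D.N Finset.univ D.S₀,
      (if D.Φ t.1 t.2 = 0 then 0 else ‖D.Φ t.1 t.2‖ * f t.1) ≤
      (boundary D.G D.S₀).card * ((D.c + 1) * D.h * K * ‖D.A‖ * D.E) := by
    calc ∑ t ∈ hops D.N Finset.univ D.S₀,
          (if D.Φ t.1 t.2 = 0 then 0 else ‖D.Φ t.1 t.2‖ * f t.1)
        ≤ ∑ t ∈ hops D.N Finset.univ D.S₀, ∑ x ∈ boundary D.G D.S₀,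
          if ¬ Disjoint t.2 (ball D.G x (hopRange D.k t.1)) then f t.1 * ‖D.Φ t.1 t.2‖ else 0 := by
          refine Finset.sum_le_sum fun t ht => ?_
          have hnn : ∀ x ∈ boundary D.G D.S₀, 0 ≤
              if ¬ Disjoint t.2 (ball D.G x (hopRange D.k t.1)) then f t.1 * ‖D.Φ t.1 t.2‖
              else 0 := fun x _ => by
            have := hf0 t.1
            split_ifs <;> positivity
          split_ifs with h1
          · exact Finset.sum_nonneg hnn
          · obtain ⟨x, hx, -, hd⟩ := D.exists_boundary_of_mem_hops ht h1
            refine le_trans ?_ (Finset.single_le_sum hnn hx)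
            rw [if_pos hd, mul_comm]
      _ = ∑ x ∈ boundary D.G D.S₀, ∑ t ∈ (hops D.N Finset.univ D.S₀).filter
            (fun t => ¬ Disjoint t.2 (ball D.G x (hopRange D.k t.1))), f t.1 * ‖D.Φ t.1 t.2‖ := by
          rw [Finset.sum_comm]
          exact Finset.sum_congr rfl fun x _ => (Finset.sum_filter _ _).symm
      _ ≤ ∑ x ∈ boundary D.G D.S₀, (D.c + 1) * D.h * K * ‖D.A‖ * D.E := by
          refine Finset.sum_le_sum fun x _ => ?_
          refine (D.strength.sum_le_of_touch (R := fun p => ball D.G x (hopRange D.k p))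
            (F₀ := ‖D.A‖ * D.E * K) (F₁ := ‖D.A‖ * D.E * K) (fun t ht => ?_) hf0 ?_ (by positivity)
            fun p hp _ => ?_).trans (le_of_eq (by ring))
          · obtain ⟨h1, h2⟩ := Finset.mem_filter.1 ht
            exact ⟨(mem_hops.1 h1).1, h2⟩
          · have h1 : ((ball D.G x (hopRange D.k 0)).card : ℝ) ≤ K := by
              refine le_trans (le_trans ?_ (D.dim x (max D.k 1) (le_max_right _ _))) hK0
              refine Nat.cast_le.2 (Finset.card_le_card fun u hu => ?_)
              have := mem_ball.1 hu
              rw [hopRange, if_pos rfl] at this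
              exact mem_ball.2 (this.trans (le_max_left _ _))
            rw [hf]
            simp only [Nat.cast_zero, mul_zero, neg_zero, Real.rpow_zero, mul_one]
            gcongr
          · rw [hopRange, if_neg (by omega)]
            have h1 := D.dim x p hp
            have h2 : D.ε ^ p ≤ D.θ ^ (p : ℝ) := by
              rw [Real.rpow_natCast]
              exact pow_le_pow_left₀ hε D.ε_le p
            calc f p * D.ε ^ p * (ball D.G x p).card
                ≤ f p * D.θ ^ (p : ℝ) * (D.M * (p : ℝ) ^ D.d) := by
                  have := hf0 p
                  gcongr
              _ = ‖D.A‖ * D.E * (D.M * (p : ℝ) ^ D.d *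
                  (D.θ ^ (-((1 + D.μ) / 2 * p)) * D.θ ^ (p : ℝ))) := by rw [hf]; ring
              _ = ‖D.A‖ * D.E * (D.M * (p : ℝ) ^ D.d * D.θ ^ ((1 - D.μ) / 2 * p)) := by
                  rw [← Real.rpow_add hθ]; ring_nf
              _ ≤ ‖D.A‖ * D.E * K := by
                  have := hK p hp
                  gcongr
      _ = _ := by rw [Finset.sum_const, nsmul_eq_mul]
  have h1 : 0 ≤ Real.exp (D.l * s) - 1 := by
    linarith [Real.one_le_exp (mul_nonneg hl.le hs)]
  gcongr

end DecaySetup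

/-! ### Choice of the constants -/

theorem exists_pow_le_exp (d : ℕ) {a : ℝ} (ha : 0 < a) :
    ∃ b : ℝ, 0 < b ∧ ∀ r : ℕ, (r : ℝ) ^ d ≤ b * Real.exp (a * r) := by
  refine ⟨d.factorial / a ^ d, by positivity, fun r => ?_⟩
  have h := Real.pow_div_factorial_le_exp (a * r) (by positivity) d
  rw [div_le_iff₀ (by positivity), mul_pow] at h
  rw [div_mul_eq_mul_div, le_div_iff₀ (by positivity)]
  linarith

/-- From `b ≤ (1-ζ)n ≤ (1-ζ)(v+b)` follows `ζb ≤ (1-ζ)v`: the steps that gain are a fixed fraction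
of all. With `T = rv/4 - ke` and `g = ζr/8 - k` this gives `(b+2e)g ≤ T`, `(b+e)ζr/8 ≤ T` and `ζD/8
≤ T + k`. The exponent `μT` is divided among these three. -/
theorem path_total_le {k r n D b e m : ℕ} {ζ α μ θ v : ℝ} (hζ0 : 0 < ζ) (hζ1 : ζ ≤ 1)
    (hα0 : 0 < α) (hαμ : α ≤ μ) (hr : 8 * (k : ℝ) / ζ < r) (hD : D ≤ (n + 1) * r) (hθ0 : 0 < θ)
    (hθ : θ ≤ Real.exp (-1)) (hm : m + 1 ≤ b + 2 * e) (hev : (e : ℝ) ≤ v) (hn : (n : ℝ) ≤ v + b)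
    (h1 : 1 ≤ v + b) (hb : (b : ℝ) ≤ (1 - ζ) * n) :
    10 * (Real.exp (ζ * (μ - α) * r / 16) ^ 2) ^ (b + e) * θ ^ (μ * (r / 4 * v - k * e)) ≤
      10 * Real.exp (α * k) * (Real.exp 1 * θ) ^ (α * (ζ * r / 8 - k)) *
        Real.exp (-(α * ζ / 8) * D) * ((Real.exp 1 * θ) ^ (α * (ζ * r / 8 - k))) ^ m := by
  obtain ⟨x, rfl⟩ : ∃ x, θ = Real.exp (-x) := ⟨-Real.log θ, by rw [neg_neg, Real.exp_log hθ0]⟩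
  have hx : 1 ≤ x := by
    have := Real.exp_le_exp.1 hθ
    linarith
  have hk : (0 : ℝ) ≤ k := Nat.cast_nonneg k
  have hr8 : 8 * (k : ℝ) < ζ * r := by rwa [div_lt_iff₀ hζ0, mul_comm (r : ℝ)] at hr
  have hr0 : (0 : ℝ) ≤ r := Nat.cast_nonneg r
  have hrr : ζ * r ≤ r := mul_le_of_le_one_left hr0 hζ1
  have he0 : (0 : ℝ) ≤ e := Nat.cast_nonneg e
  have hb0 : (0 : ℝ) ≤ b := Nat.cast_nonneg b
  have hv0 : 0 ≤ v := he0.trans hev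
  have hD' : (D : ℝ) ≤ (n + 1) * r := by exact_mod_cast hD
  have hm' : (m : ℝ) + 1 ≤ b + 2 * e := by exact_mod_cast hm
  have hζn : ζ * n ≤ v := by linarith
  have hζb : ζ * b ≤ (1 - ζ) * v := by
    have : 0 ≤ (1 - ζ) * (v - ζ * n) := mul_nonneg (by linarith) (by linarith)
    nlinarith
  have hke : k * e ≤ k * v := mul_le_mul_of_nonneg_left hev hk
  have hkv : 8 * (k : ℝ) * v ≤ r * v := mul_le_mul_of_nonneg_right (by linarith) hv0
  have hζe : ζ * e ≤ ζ * v := mul_le_mul_of_nonneg_left hev hζ0.le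
  set T : ℝ := r / 4 * v - k * e with hT
  set g : ℝ := ζ * r / 8 - k with hg
  have hg0 : 0 ≤ g := by linarith
  have b1 : (b + 2 * e) * g ≤ T := by
    have e1 : (ζ * b + 2 * (ζ * e)) * r ≤ ((1 - ζ) * v + 2 * (ζ * v)) * r := by gcongr
    have e2 : ((1 - ζ) * v + 2 * (ζ * v)) * r ≤ 2 * v * r := by
      have : 0 ≤ (1 - ζ) * (v * r) := mul_nonneg (by linarith) (mul_nonneg hv0 hr0)
      linarith
    have e3 : (0 : ℝ) ≤ k * b + k * e := by positivity
    rw [hT, hg]; linarith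
  have b3 : (b + e) * (ζ * r / 8) ≤ T := by
    have e1 : (ζ * b + ζ * e) * r ≤ ((1 - ζ) * v + ζ * v) * r := by gcongr
    rw [hT]; linarith
  have b2 : ζ * D / 8 ≤ T + k := by
    have e1 : ζ * D ≤ ζ * ((n + 1) * r) := mul_le_mul_of_nonneg_left hD' hζ0.le
    have e2 : ζ * n * r ≤ v * r := mul_le_mul_of_nonneg_right hζn hr0
    rcases Nat.eq_zero_or_pos e with h0 | h0
    · rcases Nat.eq_zero_or_pos n with h2 | h2
      · rw [h2] at e1 hb
        simp only [Nat.cast_zero, mul_zero, zero_add, one_mul] at e1 hb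
        have : 1 * (r : ℝ) ≤ v * r := mul_le_mul_of_nonneg_right (by linarith) hr0
        rw [hT, h0]; push_cast; linarith
      · have h3 : (1 : ℝ) ≤ n := by exact_mod_cast h2
        have h4 : ζ * 1 * r ≤ ζ * n * r := by gcongr
        rw [hT, h0]; push_cast; linarith
    · have h3 : (1 : ℝ) ≤ e := by exact_mod_cast h0
      have h4 : 1 * (r / 8 - (k : ℝ)) ≤ v * (r / 8 - k) :=
        mul_le_mul_of_nonneg_right (by linarith) (by linarith)
      rw [hT]; linarith
  have hT0 : 0 ≤ T := le_trans (by positivity) b3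
  rw [← Real.exp_add, ← Real.exp_mul, ← Real.exp_mul, ← pow_mul, ← Real.exp_nat_mul,
    ← Real.exp_nat_mul]
  simp only [mul_assoc (10 : ℝ), ← Real.exp_add]
  refine mul_le_mul_of_nonneg_left (Real.exp_le_exp.2 ?_) (by norm_num)
  -- Here `θ = e^{-x}` with `x ≥ 1`. The part `(μ-α)T` pays for the powers of `q`. Of `xαT`, the
  -- part `(x-1)αT` gives `(eθ)^{αg(m+1)} = δ^{m+1}`, and the remaining `αT` gives the decay in `D`;
  -- this division is the reason for `eθ` in place of `θ`.
  have c1 : (μ - α) * ((b + e) * (ζ * r / 8)) ≤ (μ - α) * T :=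
    mul_le_mul_of_nonneg_left b3 (by linarith)
  have c2 : (μ - α) * T * 1 ≤ (μ - α) * T * x :=
    mul_le_mul_of_nonneg_left hx (mul_nonneg (by linarith) hT0)
  have c3 : ((m : ℝ) + 1) * g ≤ T := (mul_le_mul_of_nonneg_right hm' hg0).trans b1
  have c4 : (x - 1) * α * (((m : ℝ) + 1) * g) ≤ (x - 1) * α * T :=
    mul_le_mul_of_nonneg_left c3 (mul_nonneg (by linarith) hα0.le)
  have c5 : α * (ζ * D / 8) ≤ α * (T + k) := mul_le_mul_of_nonneg_left b2 hα0.le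
  push_cast
  linarith

/-- The estimate for a local Hamiltonian whose terms are self-adjoint and have bounded order. -/
theorem exists_norm_lie_heis_le (d k : ℕ) {M c ζ α : ℝ} (hM : 1 ≤ M) (hc : 0 ≤ c) (hζ0 : 0 < ζ)
    (hζ1 : ζ ≤ 1) (hα0 : 0 < α) (hα1 : α < 1 / (5 * (k : ℝ) + 1)) :
    ∃ C C' : ℝ, 0 < C ∧ 0 < C' ∧
      ∀ (Λ : Type*) [Fintype Λ] [LinearOrder Λ] (G : SimpleGraph Λ) (J : Finset Λ → ℝ)
        (Φ : ℕ → Finset Λ → Op Λ) (w : ℕ → ℝ) (S₀ S₁ : Finset Λ) (N rs n r D : ℕ) (h ε Δ θ : ℝ),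
      G.Connected → HasDimension G d M → IsModel G k J Φ → HasStrength N c h ε w Φ →
      0 < h → 0 < Δ → Δ ≤ 2 → 0 < θ → θ ≤ Real.exp (-1) → epsTilde G rs Δ ε ≤ θ →
      S₁.Nonempty → (boundary G S₀).Nonempty → (∀ u ∈ S₀, ∀ v ∈ S₁, D ≤ G.dist u v) →
      n = (D - 1) / (rs + 1) → r = min (rs + 1) D → 8 * (k : ℝ) / ζ < r →
      (∀ x ∈ boundary G S₀, ∀ (Γ : ℕ → Finset Λ) (l : ℕ), IsPath G rs n {x} Γ l →
        ((resonantSteps G J h Δ rs {x} Γ l).card : ℝ) ≤ (1 - ζ) * n) →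
      ∀ (A B : Op Λ), A ∈ suppAlg S₁ → B ∈ suppAlg S₀ → ∀ t : ℝ, 0 ≤ t →
        ‖⁅B, heis (hamOn N Φ Finset.univ) t A⁆‖ ≤
          C * (boundary G S₀).card * ‖A‖ * ‖B‖ *
            (Real.exp (C' * h * (Real.exp 1 * θ) ^ (α * (ζ * r / 8 - k)) * t) - 1) *
            Real.exp (-(α * ζ / 8) * D) := by
  have hk0 : (0 : ℝ) ≤ k := Nat.cast_nonneg k
  -- The room between `α` and `μ` absorbs the polynomial volume factors; `C` and `C'` depend on this
  -- choice.
  obtain ⟨μ, hαμ, hμ1⟩ := exists_between hα1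
  have hμ0 : 0 < μ := hα0.trans hαμ
  have hμ5 : μ * (5 * k + 1) < 1 := (lt_div_iff₀ (by positivity)).1 hμ1
  have hμ1 : μ < 1 := by nlinarith
  have ha : 0 < ζ * (μ - α) / 16 := by
    have := sub_pos.2 hαμ
    positivity
  obtain ⟨b₁, hb₁, hb₁'⟩ := exists_pow_le_exp d ha
  obtain ⟨b₂, hb₂, hb₂'⟩ := exists_pow_le_exp d (a := (1 - μ) / 2) (by linarith)
  set C' : ℝ := 20 * ((c + 1) * M * (b₁ + b₂)) with hC'
  have hC'0 : 0 < C' := by positivity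
  set K : ℝ := M * ((max k 1 : ℕ) ^ d + b₂) with hK
  have hK0 : 0 < K := by positivity
  refine ⟨2 * ((c + 1) * K * (10 * Real.exp (α * k))) / C', C', by positivity, hC'0, ?_⟩
  intro Λ _ _ G J Φ w S₀ S₁ N rs n r D h ε Δ θ hG hdim hmod hstr hh hΔ hΔ2 hθ0 hθ1 hεθ hS₁ hbd hdist
    hn hr hkr hres A B hA hB t ht
  obtain ⟨x, hx⟩ := hbd
  have hr0 : (0 : ℝ) < r := lt_of_le_of_lt (by positivity) hkr
  have hr1 : 1 ≤ r := by exact_mod_cast hr0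
  have hrD : r ≤ D := by omega
  have hg0 : 0 < ζ * r / 8 - k := by
    have := (div_lt_iff₀ hζ0).1 hkr
    linarith
  have heθ0 : 0 < Real.exp 1 * θ := by positivity
  have heθ1 : Real.exp 1 * θ ≤ 1 := by
    calc Real.exp 1 * θ ≤ Real.exp 1 * Real.exp (-1) := by gcongr
      _ = 1 := by rw [← Real.exp_add]; simp
  set δ : ℝ := (Real.exp 1 * θ) ^ (α * (ζ * r / 8 - k)) with hδ
  have hδ0 : 0 < δ := Real.rpow_pos_of_pos heθ0 _
  have hδ1 : δ ≤ 1 := Real.rpow_le_one heθ0.le heθ1 (by positivity)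
  set q : ℝ := Real.exp (ζ * (μ - α) * r / 16) with hq
  have hq1 : 1 ≤ q := Real.one_le_exp (by
    have := sub_pos.2 hαμ
    positivity)
  have hθ1' : θ ≤ 1 := hθ1.trans (by simp)
  have hV : (1 : ℝ) ≤ maxBallCard G rs := by
    have h1 : (ball G x rs).card ≤ maxBallCard G rs :=
      Finset.le_sup (f := fun x => (ball G x rs).card) (Finset.mem_univ x)
    have h2 : 1 ≤ (ball G x rs).card := Finset.card_pos.2 ⟨x, mem_ball.2 (by simp)⟩
    exact_mod_cast h2.trans h1
  have hball : ∀ z, ∀ R ⊆ ball G z rs, (R.card : ℝ) ≤ maxBallCard G rs := fun z R hR => by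
    have h1 : (ball G z rs).card ≤ maxBallCard G rs :=
      Finset.le_sup (f := fun x => (ball G x rs).card) (Finset.mem_univ z)
    exact_mod_cast (Finset.card_le_card hR).trans h1
  have hε0 := hstr.ε_nonneg
  have hπ : 9 ≤ Real.pi ^ 2 := by nlinarith [Real.pi_gt_three]
  set W : ℝ := (maxBallCard G rs : ℝ) with hW
  have hεθ' : 32 * Real.pi ^ 2 * W ^ 2 * ε ≤ θ * Δ ^ 2 := by
    unfold epsTilde at hεθ
    rw [div_pow, ← hW] at hεθ
    have : 32 * Real.pi ^ 2 * (W ^ 2 / Δ ^ 2) * ε = 32 * Real.pi ^ 2 * W ^ 2 * ε / Δ ^ 2 := by ring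
    rwa [this, div_le_iff₀ (by positivity)] at hεθ
  -- With `ρ = Δ/(80W²)` and `y = 1/θ` this is `y ε ≤ ρ`. It follows from the definition of `ε̃`
  -- because `32π² ≥ 288` and `Δ ≤ 2`.
  have hεW : 80 * W ^ 2 * ε ≤ θ * Δ := by
    have h1 : 288 * (W ^ 2 * ε) ≤ θ * Δ * 2 := by
      calc 288 * (W ^ 2 * ε) ≤ 32 * Real.pi ^ 2 * (W ^ 2 * ε) := by gcongr; linarith
        _ ≤ θ * Δ * Δ := by linarith
        _ ≤ θ * Δ * 2 := by gcongr
    have h2 : 0 ≤ W ^ 2 * ε := by positivity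
    linarith
  have hW2 : 1 ≤ W ^ 2 := one_le_pow₀ hV
  have hl0 : 0 < C' * h * δ := by positivity
  have hrate1 : (c + 1) * h * (M * (r : ℝ) ^ d) ≤ C' * h * δ * (q / (20 * δ)) := by
    have h1 : (r : ℝ) ^ d ≤ (b₁ + b₂) * q := by
      refine (hb₁' r).trans ?_
      have : ζ * (μ - α) / 16 * (r : ℝ) = ζ * (μ - α) * r / 16 := by ring
      rw [this, ← hq]
      gcongr
      linarith
    calc (c + 1) * h * (M * (r : ℝ) ^ d) ≤ (c + 1) * h * (M * ((b₁ + b₂) * q)) := by gcongr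
      _ = C' * h * δ * (q / (20 * δ)) := by rw [hC']; field_simp
  have hdecay : ∀ p : ℕ, (p : ℝ) ^ d * θ ^ ((1 - μ) / 2 * p) ≤ b₂ := fun p => by
    have h1 : θ ^ ((1 - μ) / 2 * p) ≤ Real.exp (-((1 - μ) / 2 * p)) := by
      rw [← neg_one_mul, Real.exp_mul]
      refine Real.rpow_le_rpow hθ0.le hθ1 ?_
      have : 0 < 1 - μ := by linarith
      positivity
    calc (p : ℝ) ^ d * θ ^ ((1 - μ) / 2 * p)
        ≤ b₂ * Real.exp ((1 - μ) / 2 * p) * Real.exp (-((1 - μ) / 2 * p)) := by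
          gcongr
          exact hb₂' p
      _ = b₂ := by rw [mul_assoc, ← Real.exp_add]; simp
  -- The extra factor `δ`, available since `m + 1 ≤ b + 2e`, cancels the `1/l` of the first Duhamel
  -- integral.
  set E : ℝ := 10 * Real.exp (α * k) * δ * Real.exp (-(α * ζ / 8) * D) with hE
  let S : DecaySetup Λ :=
    { G := G, J := J, Φ := Φ, w := w, A := A, S₀ := S₀, S₁ := S₁, x := x, k := k, N := N, rs := rs
      n := n, r := r, d := d, c := c, h := h, ε := ε, Δ := Δ, ζ := ζ, μ := μ, θ := θ, y := 1 / θ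
      ρ := Δ / (80 * W ^ 2), M := M, l := C' * h * δ, δ := δ, q := q, E := E
      conn := hG, model := hmod, strength := hstr, mem_A := hA, nonempty := hS₁
      mem_x := (mem_boundary.1 hx).1
      le_dist := fun u hu v hv => hrD.trans (hdist u hu v hv)
      lt_dist := fun u hu v hv => by
        refine lt_of_lt_of_le ?_ (hdist u hu v hv)
        have h1 : n * r ≤ n * (rs + 1) := Nat.mul_le_mul_left _ (by omega)
        have h2 : n * (rs + 1) ≤ D - 1 := hn ▸ Nat.div_mul_le_self _ _
        omega
      r_le := by omega
      r_eq := fun h1 => by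
        have h2 : 1 ≤ (D - 1) / (rs + 1) := hn ▸ h1
        have h3 := (Nat.one_le_div_iff (by omega)).1 h2
        omega
      k_lt := by
        have h1 : 8 * (k : ℝ) < r := by
          refine lt_of_le_of_lt ?_ hkr
          rw [le_div_iff₀ hζ0]
          exact mul_le_of_le_one_right (by positivity) hζ1
        exact_mod_cast h1
      h_pos := hh, Δ_pos := hΔ
      one_le_y := (one_le_div hθ0).2 hθ1'
      y_mul_ε := by
        rw [one_div_mul_eq_div, div_le_div_iff₀ hθ0 (by positivity)]
        linarith
      ρ_le := by
        rw [div_le_one (by positivity)]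
        linarith
      gap_le := fun z R hR => by
        have h1 := hball z R hR
        have h2 : (R.card : ℝ) ^ 2 ≤ W ^ 2 := by gcongr
        calc 80 * (R.card : ℝ) * (h * (Δ / (80 * W ^ 2) * R.card))
            = h * Δ * ((R.card : ℝ) ^ 2 / W ^ 2) := by field_simp
          _ ≤ h * Δ * 1 := by
            gcongr
            exact (div_le_one (by positivity)).2 h2
          _ = h * Δ := mul_one _
      θ_pos := hθ0, θ_le := hθ1'
      ε_le := by
        have h1 : 1 * ε ≤ W ^ 2 * ε := by gcongr
        have h2 : θ * Δ ≤ θ * 2 := by gcongr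
        linarith
      one_le_θy := by rw [mul_one_div_cancel hθ0.ne']
      μ_pos := hμ0, μ_le := hμ5.le, M_nonneg := by linarith
      dim := hdim
      l_pos := hl0, δ_pos := hδ0, δ_le := hδ1, one_le_q := hq1
      rate := hrate1
      rate_far := fun p _ => by
        calc (c + 1) * h * (M * (p : ℝ) ^ d) * θ ^ ((1 - μ) / 2 * p)
            = (c + 1) * h * (M * ((p : ℝ) ^ d * θ ^ ((1 - μ) / 2 * p))) := by ring
          _ ≤ (c + 1) * h * (M * ((b₁ + b₂) * q)) := by
            have h1 : b₂ ≤ (b₁ + b₂) * q :=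
              (le_add_of_nonneg_left hb₁.le).trans (le_mul_of_one_le_right (by positivity) hq1)
            have h2 := (hdecay p).trans h1
            gcongr (c + 1) * h * (M * ?_)
          _ = C' * h * δ * (q / (20 * δ)) := by rw [hC']; field_simp
      resonant_le := hres x hx
      E_nonneg := by positivity
      total := fun b e m v h1 h2 h3 h4 h5 => by
        refine path_total_le hζ0 hζ1 hα0 hαμ.le hkr ?_ hθ0 hθ1 h1 h2 h3 h4 h5
        rcases Nat.lt_or_ge rs D with h6 | h6
        · have h7 : r = rs + 1 := by omega
          have h8 := Nat.lt_mul_div_succ (D - 1) (b := rs + 1) (by omega)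
          rw [h7, mul_comm, hn]
          omega
        · have h7 : r = D := by omega
          rw [h7]
          exact Nat.le_mul_of_pos_left _ (by omega) }
  have key := S.norm_lie_heis_le hres (K := K) (by
      change M * ((max k 1 : ℕ) : ℝ) ^ d ≤ K
      rw [hK]
      gcongr
      linarith) (fun p _ => by
      change M * (p : ℝ) ^ d * θ ^ ((1 - μ) / 2 * p) ≤ K
      rw [hK, mul_assoc]
      have h1 := hdecay p
      have h2 : (0 : ℝ) ≤ (max k 1 : ℕ) ^ d := by positivity
      gcongr
      linarith) hB ht
  refine key.trans (le_of_eq ?_)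
  change 2 * ‖B‖ * ((boundary G S₀).card * ((c + 1) * h * K * ‖A‖ * E) *
    (Real.exp (C' * h * δ * t) - 1) / (C' * h * δ)) = _
  rw [hE]
  field_simp

/-! ### The hypotheses force `Δ ≤ 2` -/

section GapSize

variable {Λ : Type*} [Fintype Λ] [LinearOrder Λ] {G : SimpleGraph Λ}

/-- A gap above `2 h` is not possible. -/
theorem not_nonResonantBall {J : Finset Λ → ℝ} {h Δ : ℝ} (hh : 0 < h) (hJ : ∀ I, |J I| ≤ h)
    (hΔ : 2 < Δ) (rs : ℕ) (y : Λ) : ¬ NonResonantBall G J h Δ rs y := by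
  intro hy
  have hS : ({y} : Finset Λ) ⊆ ball G y rs :=
    Finset.singleton_subset_iff.2 (mem_ball.2 (by simp))
  have h1 := hy {y} hS (fun _ => false) (fun _ => true) ⟨y, by simp, by simp⟩
  have e : ∀ b : Bool, energy J {y} (fun _ => b) = J ∅ + J {y} * spin b := by
    intro b
    have hp : ({y} : Finset Λ).powerset = {∅, {y}} := by
      ext I
      simp [Finset.subset_singleton_iff]
    rw [energy, hp, Finset.sum_pair (Finset.singleton_ne_empty y).symm]
    simp
  rw [e, e] at h1
  have h2 : J ∅ + J {y} * spin false - (J ∅ + J {y} * spin true) = 2 * J {y} := by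
    simp [spin]; ring
  rw [h2, abs_mul, abs_two] at h1
  have h3 := hJ {y}
  nlinarith

/-- If all balls are resonant, then some path consists of resonant steps only. -/
theorem exists_resonant_prefix (hG : G.Connected) {J : Finset Λ → ℝ} {h Δ : ℝ} {rs n : ℕ}
    (hres : ∀ y, ¬ NonResonantBall G J h Δ rs y) {x v : Λ} (hv : n * (rs + 1) < G.dist x v)
    (hfin : ∀ (Γ : ℕ → Finset Λ) (i : ℕ), IsPrefix G rs n {x} Γ i → i < max n 1 →
      (∀ j, j + 1 = i → Disjoint (Γ i) (pathInterior G rs {x} Γ j)) →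
      (Γ i ∩ pathInterior G rs {x} Γ i).Nonempty → (Γ i \ pathInterior G rs {x} Γ i).Nonempty →
      (∀ u ∈ pathInterior G rs {x} Γ (i + 1), G.dist x u ≤ (i + 1) * (rs + 1)) →
      i + 1 ≤ (resonantSteps G J h Δ rs {x} Γ (i + 1)).card →
      ¬ IsFar G rs n {x} (Γ i) ∧ i + 1 ≠ max n 1) :
    ∀ i < max n 1, ∃ Γ, IsPrefix G rs n {x} Γ i ∧
      (∀ u ∈ pathInterior G rs {x} Γ i, G.dist x u ≤ i * (rs + 1)) ∧
      i ≤ (resonantSteps G J h Δ rs {x} Γ i).card ∧ i + 1 ≠ max n 1 := by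
  classical
  suffices H : ∀ i < max n 1, (∃ Γ, IsPrefix G rs n {x} Γ i ∧
      (∀ u ∈ pathInterior G rs {x} Γ i, G.dist x u ≤ i * (rs + 1)) ∧
      i ≤ (resonantSteps G J h Δ rs {x} Γ i).card) →
      i + 1 ≠ max n 1 ∧ ∃ Γ, IsPrefix G rs n {x} Γ (i + 1) ∧
      (∀ u ∈ pathInterior G rs {x} Γ (i + 1), G.dist x u ≤ (i + 1) * (rs + 1)) ∧
      i + 1 ≤ (resonantSteps G J h Δ rs {x} Γ (i + 1)).card by
    have H' : ∀ i < max n 1, ∃ Γ, IsPrefix G rs n {x} Γ i ∧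
        (∀ u ∈ pathInterior G rs {x} Γ i, G.dist x u ≤ i * (rs + 1)) ∧
        i ≤ (resonantSteps G J h Δ rs {x} Γ i).card := by
      intro i
      induction i with
      | zero =>
        intro _
        refine ⟨fun _ => ∅, ⟨fun j hj => by omega, fun j hj => by omega, fun j hj => by omega,
          fun j hj => by omega⟩, fun u hu => ?_, Nat.zero_le _⟩
        rw [pathInterior, Finset.mem_singleton] at hu
        simp [hu]
      | succ i ih => intro hi; exact (H i (by omega) (ih (by omega))).2
    intro i hi
    obtain ⟨Γ, h1, h2, h3⟩ := H' i hi
    exact ⟨Γ, h1, h2, h3, (H i hi ⟨Γ, h1, h2, h3⟩).1⟩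
  rintro i hi ⟨Γ, hpre, hreach, hcard⟩
  set T := pathInterior G rs {x} Γ i with hT
  have hvT : v ∉ T := fun hc => by
    have h1 := hreach v hc
    have h2 : i * (rs + 1) ≤ n * (rs + 1) := Nat.mul_le_mul_right _ (by omega)
    omega
  have hxT : x ∈ T := pathInterior_mono (Nat.zero_le i) (by simp [pathInterior])
  obtain ⟨u, huT, hu⟩ : ∃ u ∈ T, ∀ j, j + 1 = i → u ∉ pathInterior G rs {x} Γ j := by
    rcases i with _ | i
    · exact ⟨x, hxT, fun j hj => by omega⟩
    · obtain ⟨u, hu⟩ := hpre.meets_exterior i (by omega)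
      obtain ⟨h1, h2⟩ := Finset.mem_sdiff.1 hu
      refine ⟨u, ?_, fun j hj => ?_⟩
      · rw [hT, pathInterior]
        exact sdiff_subset_grow rs _ _ (Finset.mem_union_right _ h1)
      · obtain rfl : j = i := by omega
        exact h2
  obtain ⟨y, hy, z, hz, hadj, -⟩ := exists_adj_dist_lt hG hvT _ x hxT le_rfl
  -- Outside the interior this set is the single vertex `y`, a center of itself; so the step is
  -- small and, by assumption, resonant.
  set Γ' := Function.update Γ i {u, y} with hΓ'
  have hagree : ∀ j < i, Γ j = Γ' j := fun j hj => by rw [hΓ', Function.update_of_ne (by omega)]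
  have hint : ∀ j ≤ i, pathInterior G rs {x} Γ' j = pathInterior G rs {x} Γ j := fun j hj =>
    (pathInterior_congr j fun a ha => hagree a (by omega)).symm
  have hΓi : Γ' i = {u, y} := by simp [hΓ']
  have hc : (centers G rs T {u, y}).Nonempty := by
    refine ⟨y, mem_centers.2 ⟨mem_boundary_compl.2 ⟨hy, z, hz, hadj⟩, fun w hw => ?_⟩⟩
    obtain ⟨h1, h2⟩ := Finset.mem_sdiff.1 hw
    rcases Finset.mem_insert.1 h1 with rfl | h1
    · exact absurd huT h2
    · rw [Finset.mem_singleton.1 h1]; exact mem_ball.2 (by simp)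
  have hsucc : pathInterior G rs {x} Γ' (i + 1) =
      T ∪ ball G ((centers G rs T {u, y}).min' hc) rs := by
    rw [pathInterior, hint i le_rfl, hΓi, ← hT, grow, dif_pos hc]
  have hpre' := hpre.congr hagree
  have a1 : ∀ j, j + 1 = i → Disjoint (Γ' i) (pathInterior G rs {x} Γ' j) := fun j hj => by
    have : y ∉ pathInterior G rs {x} Γ j := fun h => hy (pathInterior_mono (by omega) h)
    rw [hint j (by omega), hΓi]
    simp [hu j hj, this]
  have a2 : (Γ' i ∩ pathInterior G rs {x} Γ' i).Nonempty :=
    ⟨u, by rw [hint i le_rfl, hΓi]; simp [← hT, huT]⟩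
  have a3 : (Γ' i \ pathInterior G rs {x} Γ' i).Nonempty :=
    ⟨y, by rw [hint i le_rfl, hΓi]; simp [← hT, hy]⟩
  have a4 : ∀ w ∈ pathInterior G rs {x} Γ' (i + 1), G.dist x w ≤ (i + 1) * (rs + 1) := by
    intro w hw
    rw [hsucc] at hw
    rw [add_mul, one_mul]
    rcases Finset.mem_union.1 hw with hw | hw
    · exact (hreach w hw).trans (Nat.le_add_right _ _)
    · obtain ⟨-, z', hz', hadj'⟩ := mem_boundary_compl.1
        (mem_centers.1 (Finset.min'_mem _ hc)).1
      have h1 := hreach z' hz'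
      have h2 := SimpleGraph.dist_eq_one_iff_adj.2 hadj'.symm
      have h3 := mem_ball.1 hw
      have h4 := hG.dist_triangle (u := x) (v := z') (w := w)
      have h5 := hG.dist_triangle (u := z') (v := (centers G rs T {u, y}).min' hc) (w := w)
      omega
  have a5 : i + 1 ≤ (resonantSteps G J h Δ rs {x} Γ' (i + 1)).card := by
    have hci : (centers G rs (pathInterior G rs {x} Γ' i) (Γ' i)).Nonempty := by
      rwa [hint i le_rfl, hΓi]
    refine le_trans ?_ (card_resonantSteps_succ hci (hres _))
    rw [← resonantSteps_congr hagree]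
    exact Nat.succ_le_succ hcard
  obtain ⟨b1, b2⟩ := hfin Γ' i hpre' hi a1 a2 a3 a4 a5
  exact ⟨b2, Γ', hpre'.succ a1 a2 a3 b1, a4, a5⟩

/-- A single spin has level spacing `2|J_y| ≤ 2h`, so for `Δ > 2` every ball is resonant. Then a
path advancing by one ball at a time has at least `max n 1` resonant steps, more than `(1-ζ)n`. -/
theorem PartiallyNonResonantAt.le_two (hG : G.Connected) {J : Finset Λ → ℝ} {h Δ ζ : ℝ} {rs n : ℕ}
    {x v : Λ} (hP : PartiallyNonResonantAt G J h rs Δ n ζ x) (hh : 0 < h) (hζ : 0 < ζ)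
    (hv : n * (rs + 1) < G.dist x v) : Δ ≤ 2 := by
  by_contra hΔ
  push Not at hΔ
  obtain ⟨Γ, -, -, -, h1⟩ := exists_resonant_prefix hG
    (not_nonResonantBall hh hP.strength_le hΔ rs) hv (fun Γ i hpre hi a1 a2 a3 a4 a5 => by
      by_contra hcon
      have hfin : IsFar G rs n {x} (Γ i) ∨ i + 1 = max n 1 := by tauto
      have h0 : n = 0 → IsFar G rs n {x} (Γ i) := fun h0 y _ => by
        obtain ⟨w, hw⟩ := a3
        exact ⟨w, (Finset.mem_sdiff.1 hw).1, by simp [h0]⟩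
      have hn : n ≤ i + 1 := by
        rcases hfin with hf | hf
        · obtain ⟨w, hw, hd⟩ := hf x (by simp)
          have h2 := a4 w (by
            rw [pathInterior]
            exact sdiff_subset_grow rs _ _ (Finset.mem_union_right _ hw))
          rw [G.dist_comm] at hd
          exact Nat.le_of_mul_le_mul_right (hd.trans h2) (by omega)
        · omega
      have h2 := hpre.card_resonantSteps_le hP.resonant_le a1 a2 a3 (by omega) (by
        by_cases hf : IsFar G rs n {x} (Γ i)
        · exact Or.inl hf
        · have hn0 : n ≠ 0 := fun h => hf (h0 h)
          have hf' := hfin.resolve_left hf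
          have hin : i + 1 = n := by omega
          refine Or.inr ⟨hin, v, fun hc => ?_⟩
          have := a4 v hc
          rw [hin] at this
          omega)
      have h3 : ((i + 1 : ℕ) : ℝ) ≤ (1 - ζ) * n := le_trans (by exact_mod_cast a5) h2
      have h4 : (n : ℝ) ≤ (i + 1 : ℕ) := by exact_mod_cast hn
      have h5 : (0 : ℝ) < (i + 1 : ℕ) := by positivity
      rcases Nat.eq_zero_or_pos n with h6 | h6
      · rw [h6, Nat.cast_zero, mul_zero] at h3
        linarith
      · have h7 : 0 < ζ * (n : ℝ) := mul_pos hζ (by exact_mod_cast h6)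
        linarith) (max n 1 - 1) (by omega)
  omega

end GapSize

/-! ### Truncated models with self-adjoint terms -/

section Model

variable {Λ : Type*} [Fintype Λ] [LinearOrder Λ] {G : SimpleGraph Λ}

/-- The self-adjoint parts of the terms of `H_0 + V_ε`. -/
noncomputable def modelTerms (J : Finset Λ → ℝ) (ε : ℝ) (V : ℕ → Finset Λ → Op Λ) (p : ℕ)
    (Z : Finset Λ) : Op Λ :=
  if p = 0 then (J Z : ℂ) • pauliZ Z
  else ((ε ^ p : ℝ) : ℂ) • ((1 / 2 : ℂ) • (V p Z + star (V p Z)))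

theorem isSelfAdjoint_ofReal_smul (a : ℝ) {A : Op Λ} (hA : IsSelfAdjoint A) :
    IsSelfAdjoint ((a : ℂ) • A) := by
  rw [IsSelfAdjoint, star_smul, hA.star_eq]
  simp

theorem isSelfAdjoint_half_add_star (A : Op Λ) : IsSelfAdjoint ((1 / 2 : ℂ) • (A + star A)) := by
  rw [IsSelfAdjoint, star_smul, star_add, star_star, add_comm]
  simp

theorem norm_half_add_star_le (A : Op Λ) : ‖(1 / 2 : ℂ) • (A + star A)‖ ≤ ‖A‖ := by
  have h := norm_add_le A (star A)
  rw [norm_star] at h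
  rw [norm_smul]
  norm_num
  linarith

theorem isModel_modelTerms {J : Finset Λ → ℝ} {k : ℕ} {h : ℝ} (ε : ℝ)
    (hJ : ∀ I, J I ≠ 0 → graphDiam G I ≤ k) {V : ℕ → Finset Λ → Op Λ}
    (hV : IsLocalPerturbation G h V) : IsModel G k J (modelTerms J ε V) where
  supported p Z := by
    unfold modelTerms
    split_ifs with hp
    · exact Subalgebra.smul_mem _ (pauliZ_mem_suppAlg Z) _
    · have := supportedIn_iff.1 (hV.supported p Z)
      exact Subalgebra.smul_mem _ (Subalgebra.smul_mem _ (add_mem this (star_mem_suppAlg this)) _) _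
  selfAdjoint p Z := by
    unfold modelTerms
    split_ifs with hp
    · exact isSelfAdjoint_ofReal_smul _ (isSelfAdjoint_pauliZ Z)
    · exact isSelfAdjoint_ofReal_smul _ (isSelfAdjoint_half_add_star _)
  range_le p Z h0 := by
    unfold modelTerms hopRange at *
    split_ifs at h0 ⊢ with hp
    · refine hJ Z fun h => h0 ?_
      simp [h]
    · refine (hV.range_le p Z fun h => h0 ?_).2
      simp [h]
  zero_eq Z := by simp [modelTerms]
  classical_range_le := hJ

theorem norm_pauliZ_le (I : Finset Λ) : ‖pauliZ I‖ ≤ 1 := by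
  have h1 : ‖pauliZ I‖ * ‖pauliZ I‖ = 1 := by
    rw [← CStarRing.norm_star_mul_self, (isSelfAdjoint_pauliZ I).star_eq, pauliZ_mul_self,
      CStarRing.norm_one]
  nlinarith [norm_nonneg (pauliZ I)]

theorem sum_le_localStrength (Ψ : Finset Λ → Op Λ) (v : Λ) :
    ∑ S ∈ Finset.univ.filter (fun S : Finset Λ => v ∈ S), ‖Ψ S‖ ≤ localStrength Ψ :=
  le_ciSup (f := fun v => ∑ S ∈ Finset.univ.filter (fun S : Finset Λ => v ∈ S), ‖Ψ S‖)
    (Set.finite_range _).bddAbove v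

theorem localStrength_nonneg (Ψ : Finset Λ → Op Λ) : 0 ≤ localStrength Ψ :=
  Real.iSup_nonneg fun _ => Finset.sum_nonneg fun _ _ => norm_nonneg _

/-- The classical terms containing `v` are indexed by subsets of a ball of radius `max k 1`; the
constant bounds the number of these subsets. -/
theorem hasStrength_modelTerms {J : Finset Λ → ℝ} {d k : ℕ} {M h ε : ℝ} (N : ℕ)
    (hdim : HasDimension G d M) (hJ : ∀ I, J I ≠ 0 → graphDiam G I ≤ k) (hJh : ∀ I, |J I| ≤ h)
    (hh : 0 ≤ h) (hε : 0 ≤ ε) {V : ℕ → Finset Λ → Op Λ} (hV : IsLocalPerturbation G h V) :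
    HasStrength N (2 ^ ⌈M * (max k 1 : ℕ) ^ d⌉₊) h ε (fun p => localStrength (V p))
      (modelTerms J ε V) where
  c_nonneg := by positivity
  h_nonneg := hh
  ε_nonneg := hε
  nonneg p := localStrength_nonneg _
  zero_le v := by
    classical
    have h1 : ∑ Z ∈ Finset.univ.filter (fun Z : Finset Λ => v ∈ Z), ‖modelTerms J ε V 0 Z‖ ≤
        ∑ Z ∈ (ball G v (max k 1)).powerset, h := by
      rw [← Finset.sum_filter_of_ne (p := fun Z => J Z ≠ 0) (by
        intro Z _ hZ h0
        apply hZ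
        simp [modelTerms, h0])]
      refine le_trans (Finset.sum_le_sum (g := fun _ => h) fun Z _ => ?_)
        (Finset.sum_le_sum_of_subset_of_nonneg ?_ fun _ _ _ => hh)
      · rw [modelTerms, if_pos rfl, norm_smul, Complex.norm_real, Real.norm_eq_abs]
        calc |J Z| * ‖pauliZ Z‖ ≤ h * 1 := by
              gcongr
              · exact hJh Z
              · exact norm_pauliZ_le Z
          _ = h := mul_one h
      · intro Z hZ
        obtain ⟨h2, h3⟩ := Finset.mem_filter.1 hZ
        have hv := (Finset.mem_filter.1 h2).2
        refine Finset.mem_powerset.2 fun u hu => mem_ball.2 ?_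
        exact (graphDiam_le_iff.1 (hJ Z h3) v hv u hu).trans (le_max_left _ _)
    refine le_trans (by convert h1) ?_
    rw [Finset.sum_const, Finset.card_powerset, nsmul_eq_mul]
    refine mul_le_mul_of_nonneg_right ?_ hh
    push_cast
    refine pow_le_pow_right₀ (by norm_num) ?_
    have h2 := (hdim v (max k 1) (le_max_right _ _)).trans (Nat.le_ceil _)
    exact_mod_cast h2
  order_le p hp v := by
    classical
    have h1 := sum_le_localStrength (V p) v
    have h2 : ∑ Z ∈ Finset.univ.filter (fun Z : Finset Λ => v ∈ Z), ‖modelTerms J ε V p Z‖ ≤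
        ε ^ p * ∑ Z ∈ Finset.univ.filter (fun Z : Finset Λ => v ∈ Z), ‖V p Z‖ := by
      rw [Finset.mul_sum]
      refine Finset.sum_le_sum fun Z _ => ?_
      rw [modelTerms, if_neg (by omega), norm_smul, Complex.norm_real, Real.norm_eq_abs,
        abs_of_nonneg (by positivity)]
      exact mul_le_mul_of_nonneg_left (norm_half_add_star_le _) (by positivity)
    refine le_trans (by convert h2) (mul_le_mul_of_nonneg_left h1 (by positivity))
  sum_le := hV.strength_le N

theorem summable_perturbation {h ε : ℝ} (hε0 : 0 ≤ ε) (hε1 : ε ≤ 1) {V : ℕ → Finset Λ → Op Λ}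
    (hV : IsLocalPerturbation G h V) :
    Summable fun r : ℕ => ((ε ^ (r + 1) : ℝ) : ℂ) • ∑ S : Finset Λ, V (r + 1) S := by
  classical
  have h1 : ∀ r : ℕ, ‖∑ S : Finset Λ, V (r + 1) S‖ ≤
      Fintype.card Λ * localStrength (V (r + 1)) := fun r => by
    calc ‖∑ S : Finset Λ, V (r + 1) S‖ ≤ ∑ S : Finset Λ, ‖V (r + 1) S‖ := norm_sum_le _ _
      _ ≤ ∑ S : Finset Λ, ∑ v : Λ, if v ∈ S then ‖V (r + 1) S‖ else 0 := by
          refine Finset.sum_le_sum fun S _ => ?_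
          by_cases h0 : V (r + 1) S = 0
          · rw [h0, norm_zero]
            exact Finset.sum_nonneg fun v _ => by positivity
          · obtain ⟨v, hv⟩ := (hV.range_le _ _ h0).1
            have := Finset.single_le_sum (f := fun v => if v ∈ S then ‖V (r + 1) S‖ else 0)
              (fun v _ => by positivity) (Finset.mem_univ v)
            simpa only [if_pos hv] using this
      _ = ∑ v : Λ, ∑ S ∈ Finset.univ.filter (fun S : Finset Λ => v ∈ S), ‖V (r + 1) S‖ := by
          rw [Finset.sum_comm]
          exact Finset.sum_congr rfl fun v _ => (Finset.sum_filter _ _).symm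
      _ ≤ ∑ _v : Λ, localStrength (V (r + 1)) :=
          Finset.sum_le_sum fun v _ => sum_le_localStrength _ v
      _ = _ := by simp
  have h2 : Summable fun r : ℕ => (Fintype.card Λ : ℝ) * localStrength (V (r + 1)) := by
    refine Summable.mul_left _ (summable_of_sum_range_le (c := h)
      (fun r => localStrength_nonneg _) fun N => ?_)
    refine le_trans (le_of_eq ?_) (hV.strength_le N)
    rw [Finset.range_eq_Ico, Finset.sum_Ico_add' (fun r => localStrength (V r)) 0 N 1]
    rfl
  refine Summable.of_norm_bounded h2 fun r => ?_
  rw [norm_smul, Complex.norm_real, Real.norm_eq_abs, abs_of_nonneg (by positivity)]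
  refine le_trans (mul_le_of_le_one_left (norm_nonneg _) (pow_le_one₀ hε0 hε1)) (h1 r)

theorem hamOn_modelTerms {J : Finset Λ → ℝ} {h : ℝ} (ε : ℝ) {V : ℕ → Finset Λ → Op Λ}
    (hV : IsLocalPerturbation G h V) (N : ℕ) :
    hamOn N (modelTerms J ε V) Finset.univ + (J ∅ : ℂ) • 1 = classicalHamiltonian J +
      ∑ r ∈ Finset.range N, (1 / 2 : ℂ) •
        (((ε ^ (r + 1) : ℝ) : ℂ) • ∑ S : Finset Λ, V (r + 1) S +
          star (((ε ^ (r + 1) : ℝ) : ℂ) • ∑ S : Finset Λ, V (r + 1) S)) := by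
  classical
  have h0 : ∀ p, V p ∅ = 0 := fun p => by
    by_contra hne
    simpa using (hV.range_le p ∅ hne).1
  have e0 : ∑ Z ∈ (Finset.univ : Finset Λ).powerset.erase ∅, modelTerms J ε V 0 Z +
      (J ∅ : ℂ) • 1 = classicalHamiltonian J := by
    rw [classicalHamiltonian, Finset.powerset_univ, ← Finset.add_sum_erase _ _ (Finset.mem_univ ∅),
      add_comm]
    simp [modelTerms, pauliZ]
  rw [hamOn, bonds, Finset.sum_product, Finset.sum_range_succ', add_assoc, e0, add_comm]
  congr 1
  refine Finset.sum_congr rfl fun r _ => ?_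
  rw [Finset.powerset_univ, Finset.sum_erase _ (by simp [modelTerms, h0]), star_smul, star_sum]
  simp only [modelTerms, Nat.add_eq_zero_iff, one_ne_zero, and_false, if_false,
    Complex.star_def, Complex.conj_ofReal]
  rw [← Finset.smul_sum, ← Finset.smul_sum, Finset.sum_add_distrib, ← smul_add, smul_comm]

/-- Only the whole perturbation is assumed self-adjoint, not its terms. Replacing each term by its
self-adjoint part keeps supports and bounds, and does not change the sum. -/
theorem tendsto_hamOn_modelTerms {J : Finset Λ → ℝ} {h ε : ℝ} (hε0 : 0 ≤ ε) (hε1 : ε ≤ 1)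
    {V : ℕ → Finset Λ → Op Λ} (hV : IsLocalPerturbation G h V)
    (hH : (perturbation ε V).IsHermitian) :
    Filter.Tendsto (fun N => hamOn N (modelTerms J ε V) Finset.univ + (J ∅ : ℂ) • 1) Filter.atTop
      (nhds (classicalHamiltonian J + perturbation ε V)) := by
  have h1 := (summable_perturbation hε0 hε1 hV).hasSum
  have h2 := ((h1.add h1.star).const_smul (1 / 2 : ℂ)).tendsto_sum_nat
  have h3 : (1 / 2 : ℂ) • (perturbation ε V + star (perturbation ε V)) = perturbation ε V := by
    rw [Matrix.star_eq_conjTranspose, hH.eq, ← two_smul ℂ, smul_smul]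
    norm_num
  unfold perturbation at h3 ⊢
  rw [h3] at h2
  exact (h2.const_add (classicalHamiltonian J)).congr fun N => (hamOn_modelTerms ε hV N).symm

theorem heisenberg_eq_heis (H : Op Λ) (t : ℝ) (A : Op Λ) : heisenberg H t A = heis H t A := by
  unfold heisenberg heis evol
  rw [Complex.ofReal_neg, mul_neg, neg_smul]

theorem heis_add_smul_one (K : Op Λ) (a : ℂ) (t : ℝ) (A : Op Λ) :
    heis (K + a • 1) t A = heis K t A := by
  have h : ∀ B : Op Λ, Commute (a • (1 : Op Λ)) B := fun B => (Commute.one_left B).smul_left a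
  rw [heis_add_of_commute (h K).symm, heis_of_commute (h A)]

theorem continuous_heis (t : ℝ) (A : Op Λ) : Continuous fun K : Op Λ => heis K t A := by
  unfold heis evol
  have h : Continuous (NormedSpace.exp : Op Λ → Op Λ) := by
    let +nondep : NormedAlgebra ℚ (Op Λ) := .restrictScalars ℚ ℂ (Op Λ)
    exact NormedSpace.exp_continuous
  fun_prop

end Model

/-! ### From truncated models to the full perturbation -/

section Reduction

variable {Λ : Type*} [Fintype Λ] [LinearOrder Λ] {G : SimpleGraph Λ}

theorem setDist_le {S T : Finset Λ} {u v : Λ} (hu : u ∈ S) (hv : v ∈ T) :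
    setDist G S T ≤ G.dist u v :=
  Nat.sInf_le ⟨u, hu, v, hv, rfl⟩

theorem nonempty_of_setDist_pos {S T : Finset Λ} (h : 0 < setDist G S T) :
    S.Nonempty ∧ T.Nonempty := by
  obtain ⟨n, u, hu, v, hv, -⟩ := Nat.nonempty_of_pos_sInf h
  exact ⟨⟨u, hu⟩, ⟨v, hv⟩⟩

theorem setDist_comm (S T : Finset Λ) : setDist G S T = setDist G T S := by
  unfold setDist
  congr 1
  ext n
  constructor <;> rintro ⟨x, hx, y, hy, rfl⟩ <;> exact ⟨y, hy, x, hx, G.dist_comm⟩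

theorem boundary_nonempty (hG : G.Connected) {S T : Finset Λ} (h : 0 < setDist G S T) :
    (boundary G S).Nonempty := by
  obtain ⟨⟨u, hu⟩, v, hv⟩ := nonempty_of_setDist_pos h
  have hvS : v ∉ S := fun hvS => by
    have := setDist_le (G := G) hvS hv
    rw [G.dist_self] at this
    omega
  obtain ⟨y, hy, z, hz, hadj, -⟩ := exists_adj_dist_lt hG hvS _ u hu le_rfl
  exact ⟨z, mem_boundary.2 ⟨hz, y, hy, hadj.symm⟩⟩

theorem le_epsTilde [Nonempty Λ] {rs : ℕ} {Δ ε : ℝ} (hε : 0 ≤ ε) (hΔ : 0 < Δ) (hΔ2 : Δ ≤ 2) :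
    ε ≤ epsTilde G rs Δ ε := by
  obtain ⟨x⟩ := ‹Nonempty Λ›
  have h1 : (ball G x rs).card ≤ maxBallCard G rs :=
    Finset.le_sup (f := fun x => (ball G x rs).card) (Finset.mem_univ x)
  have h2 : 1 ≤ (ball G x rs).card := Finset.card_pos.2 ⟨x, mem_ball.2 (by simp)⟩
  have h3 : (1 : ℝ) ≤ maxBallCard G rs := by exact_mod_cast h2.trans h1
  have h4 : 1 / 2 ≤ (maxBallCard G rs : ℝ) / Δ := by
    rw [div_le_div_iff₀ (by norm_num) hΔ]; linarith
  have h5 : 1 / 4 ≤ ((maxBallCard G rs : ℝ) / Δ) ^ 2 := by nlinarith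
  have h6 : 9 ≤ Real.pi ^ 2 := by nlinarith [Real.pi_gt_three]
  have h7 : 1 ≤ 32 * Real.pi ^ 2 * ((maxBallCard G rs : ℝ) / Δ) ^ 2 := by nlinarith
  exact le_mul_of_one_le_left hε h7

end Reduction

/-- The estimate in terms of the paths that start at the boundary of `S₀`. -/
theorem exists_norm_lie_heis_perturbation_le (d k : ℕ) (M ζ α : ℝ) (hζ0 : 0 < ζ) (hζ1 : ζ ≤ 1)
    (hα0 : 0 < α) (hα1 : α < 1 / (5 * (k : ℝ) + 1)) :
    ∃ C C' : ℝ, 0 < C ∧ 0 < C' ∧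
      ∀ (Λ : Type*) [Fintype Λ] [LinearOrder Λ] (G : SimpleGraph Λ),
        G.Connected → HasDimension G d M →
      ∀ (h Δ ε : ℝ), 0 < h → 0 < Δ → 0 ≤ ε →
      ∀ (J : Finset Λ → ℝ), (∀ I, J I ≠ 0 → graphDiam G I ≤ k) →
      ∀ (V : ℕ → Finset Λ → Op Λ), IsLocalPerturbation G h V → (perturbation ε V).IsHermitian →
      ∀ (S₀ S₁ : Finset Λ) (rs ns r : ℕ),
        ns = (setDist G S₀ S₁ - 1) / (rs + 1) →
        r = min (rs + 1) (setDist G S₀ S₁) →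
        8 * (k : ℝ) / ζ < (r : ℝ) →
        (∀ x ∈ boundary G S₀, PartiallyNonResonantAt G J h rs Δ ns ζ x) →
        epsTilde G rs Δ ε < Real.exp (-1) →
      ∀ (A B : Op Λ), A ∈ suppAlg S₁ → B ∈ suppAlg S₀ → ∀ t : ℝ, 0 ≤ t →
        ‖⁅B, heis (classicalHamiltonian J + perturbation ε V) t A⁆‖ ≤
          C * (boundary G S₀).card * ‖A‖ * ‖B‖ *
            (Real.exp (C' * h * (Real.exp 1 * epsTilde G rs Δ ε) ^ (α * (ζ * r / 8 - k)) * t) - 1) *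
            Real.exp (-(α * ζ / 8) * (setDist G S₀ S₁ : ℝ)) := by
  obtain ⟨C, C', hC, hC', H⟩ := exists_norm_lie_heis_le d k (M := max M 1)
    (c := 2 ^ ⌈max M 1 * (max k 1 : ℕ) ^ d⌉₊) (le_max_right _ _) (by positivity) hζ0 hζ1 hα0 hα1
  refine ⟨C, C', hC, hC', ?_⟩
  intro Λ _ _ G hG hdim h Δ ε hh hΔ hε J hJ V hV hHerm S₀ S₁ rs ns r hns hr hkr hP hεt A B hA hB t ht
  have hr0 : (0 : ℝ) < r := lt_of_le_of_lt (by positivity) hkr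
  have hD : 0 < setDist G S₀ S₁ := by
    have : 0 < r := by exact_mod_cast hr0
    omega
  obtain ⟨hS₀, hS₁⟩ := nonempty_of_setDist_pos hD
  have hbd := boundary_nonempty hG hD
  obtain ⟨x, hx⟩ := hbd
  obtain ⟨v, hv⟩ := hS₁
  have : Nonempty Λ := ⟨x⟩
  have hdim' : HasDimension G d (max M 1) := fun x r hr =>
    (hdim x r hr).trans (by gcongr; exact le_max_left _ _)
  have hfar : ns * (rs + 1) < G.dist x v := by
    have h1 : ns * (rs + 1) ≤ setDist G S₀ S₁ - 1 := hns ▸ Nat.div_mul_le_self _ _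
    have h2 := setDist_le (G := G) (mem_boundary.1 hx).1 hv
    omega
  have hΔ2 : Δ ≤ 2 := (hP x hx).le_two hG hh hζ0 hfar
  have hε1 : ε ≤ 1 := by
    have h1 := le_epsTilde (G := G) (rs := rs) hε hΔ hΔ2
    have h2 : Real.exp (-1) ≤ 1 := by simp
    linarith
  have hεt0 : 0 ≤ epsTilde G rs Δ ε := hε.trans (le_epsTilde hε hΔ hΔ2)
  have hmodel := isModel_modelTerms ε hJ hV
  have hg0 : 0 ≤ α * (ζ * r / 8 - k) := by
    have := (div_lt_iff₀ hζ0).1 hkr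
    exact mul_nonneg hα0.le (by linarith)
  -- A strictly larger `θ` is positive even when `ε = 0`. The limit `θ ↓ ε̃` is taken at the end, by
  -- continuity of a power with nonnegative exponent.
  have key : ∀ θ, epsTilde G rs Δ ε < θ → θ ≤ Real.exp (-1) →
      ‖⁅B, heis (classicalHamiltonian J + perturbation ε V) t A⁆‖ ≤
        C * (boundary G S₀).card * ‖A‖ * ‖B‖ *
          (Real.exp (C' * h * (Real.exp 1 * θ) ^ (α * (ζ * r / 8 - k)) * t) - 1) *
          Real.exp (-(α * ζ / 8) * (setDist G S₀ S₁ : ℝ)) := by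
    intro θ hθ hθ1
    have hlim : Filter.Tendsto
        (fun N => ‖⁅B, heis (hamOn N (modelTerms J ε V) Finset.univ + (J ∅ : ℂ) • 1) t A⁆‖)
        Filter.atTop (nhds ‖⁅B, heis (classicalHamiltonian J + perturbation ε V) t A⁆‖) := by
      have h1 := ((continuous_heis t A).tendsto _).comp
        (tendsto_hamOn_modelTerms (J := J) hε hε1 hV hHerm)
      simp only [Ring.lie_def]
      exact ((h1.const_mul B).sub (h1.mul_const B)).norm
    refine le_of_tendsto' hlim fun N => ?_
    rw [heis_add_smul_one]
    exact H Λ G J _ _ S₀ S₁ N rs ns r _ h ε Δ θ hG hdim' hmodel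
      (hasStrength_modelTerms N hdim' hJ (hP x hx).strength_le hh.le hε hV) hh hΔ hΔ2
      (hεt0.trans_lt hθ) hθ1 hθ.le ⟨v, hv⟩ ⟨x, hx⟩ (fun u hu w hw => setDist_le hu hw) hns hr hkr
      (fun y hy => (hP y hy).resonant_le) A B hA hB t ht
  have hcont : Continuous fun θ : ℝ => C * (boundary G S₀).card * ‖A‖ * ‖B‖ *
      (Real.exp (C' * h * (Real.exp 1 * θ) ^ (α * (ζ * r / 8 - k)) * t) - 1) *
      Real.exp (-(α * ζ / 8) * (setDist G S₀ S₁ : ℝ)) := by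
    have h1 : Continuous fun θ : ℝ => (Real.exp 1 * θ) ^ (α * (ζ * r / 8 - k)) :=
      (continuous_const.mul continuous_id).rpow_const fun _ => Or.inr hg0
    fun_prop
  refine ge_of_tendsto ((hcont.tendsto (epsTilde G rs Δ ε)).mono_left
    (nhdsWithin_le_nhds (s := Set.Ioi (epsTilde G rs Δ ε)))) ?_
  filter_upwards [Ioo_mem_nhdsGT hεt] with θ hθ
  exact key θ hθ.1 hθ.2.le

/-! ### Exchanging the two sets -/

section Reflection

variable {Λ : Type*} [Fintype Λ] [LinearOrder Λ] {G : SimpleGraph Λ}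

theorem resonantSteps_neg (J : Finset Λ → ℝ) (h Δ : ℝ) (rs : ℕ) (S₀ : Finset Λ)
    (Γ : ℕ → Finset Λ) (l : ℕ) :
    resonantSteps G (-J) h Δ rs S₀ Γ l = resonantSteps G J h Δ rs S₀ Γ l := by
  have h1 : ∀ S σ, energy (-J) S σ = -energy J S σ := fun S σ => by simp [energy]
  have h2 : ∀ S g, HasGap (-J) S g ↔ HasGap J S g := fun S g => by
    unfold HasGap
    simp only [h1, neg_sub_neg]
    constructor <;> intro hg σ τ hστ
    · rw [abs_sub_comm]; exact hg σ τ hστ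
    · rw [abs_sub_comm]; exact hg σ τ hστ
  have h3 : ∀ y, NonResonantBall G (-J) h Δ rs y ↔ NonResonantBall G J h Δ rs y := fun y =>
    forall₂_congr fun S _ => h2 S _
  ext j
  simp only [resonantSteps, Finset.mem_filter, h3]

theorem PartiallyNonResonantAt.neg {J : Finset Λ → ℝ} {h Δ ζ : ℝ} {rs ns : ℕ} {x : Λ}
    (hP : PartiallyNonResonantAt G J h rs Δ ns ζ x) :
    PartiallyNonResonantAt G (-J) h rs Δ ns ζ x :=
  ⟨fun I => by simpa using hP.strength_le I,
    fun Γ l hΓ => by rw [resonantSteps_neg]; exact hP.resonant_le Γ l hΓ⟩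

theorem IsLocalPerturbation.neg {h : ℝ} {V : ℕ → Finset Λ → Op Λ}
    (hV : IsLocalPerturbation G h V) : IsLocalPerturbation G h (-V) where
  supported r S := supportedIn_iff.2 (neg_mem (supportedIn_iff.1 (hV.supported r S)))
  range_le r S h0 := hV.range_le r S fun h => h0 (by simp [h])
  strength_le N := by simpa [localStrength] using hV.strength_le N

theorem perturbation_neg (ε : ℝ) (V : ℕ → Finset Λ → Op Λ) :
    perturbation ε (-V) = -perturbation ε V := by
  simp [perturbation, tsum_neg]

theorem classicalHamiltonian_neg (J : Finset Λ → ℝ) :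
    classicalHamiltonian (-J) = -classicalHamiltonian J := by
  simp [classicalHamiltonian]

theorem isHermitian_classicalHamiltonian (J : Finset Λ → ℝ) :
    (classicalHamiltonian J).IsHermitian := by
  rw [Matrix.IsHermitian, ← Matrix.star_eq_conjTranspose]
  exact isSelfAdjoint_sum _ fun I _ => isSelfAdjoint_ofReal_smul _ (isSelfAdjoint_pauliZ I)

/-- Moving the evolution to `B` reverses time, and evolving backwards under `H` is evolving forwards
under `-H`. -/
theorem norm_lie_heis_neg {H : Op Λ} (hH : IsSelfAdjoint H) (t : ℝ) (A B : Op Λ) :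
    ‖⁅B, heis H t A⁆‖ = ‖⁅A, heis (-H) t B⁆‖ := by
  have h : heis H (-t) B = heis (-H) t B := by simp [heis, evol]
  rw [norm_lie_heis hH, h, ← op_lie_swap, norm_neg]

end Reflection

end SlowLR

theorem mainTheorem1 (d k : ℕ) (M ζ α : ℝ) (hζ0 : 0 < ζ) (hζ1 : ζ ≤ 1)
    (hα0 : 0 < α) (hα1 : α < 1 / (5 * (k : ℝ) + 1)) :
    ∃ C C' : ℝ, 0 < C ∧ 0 < C' ∧
      ∀ (Λ : Type*) [Fintype Λ] [LinearOrder Λ] (G : SimpleGraph Λ),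
        G.Connected → HasDimension G d M →
      ∀ (h Δ ε : ℝ), 0 < h → 0 < Δ → 0 ≤ ε →
      ∀ (J : Finset Λ → ℝ), (∀ I, J I ≠ 0 → graphDiam G I ≤ k) →
      ∀ (V : ℕ → Finset Λ → Op Λ), IsLocalPerturbation G h V → (perturbation ε V).IsHermitian →
      ∀ (S₀ S₁ : Finset Λ) (rs ns r : ℕ),
        ns = (setDist G S₀ S₁ - 1) / (rs + 1) →
        r = min (rs + 1) (setDist G S₀ S₁) →
        8 * (k : ℝ) / ζ < (r : ℝ) →
        ((boundary G S₀).card ≤ (boundary G S₁).card →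
          ∀ x ∈ boundary G S₀, PartiallyNonResonantAt G J h rs Δ ns ζ x) →
        ((boundary G S₁).card < (boundary G S₀).card →
          ∀ y ∈ boundary G S₁, PartiallyNonResonantAt G J h rs Δ ns ζ y) →
        epsTilde G rs Δ ε < Real.exp (-1) →
      ∀ (A B : Op Λ), SupportedIn S₁ A → SupportedIn S₀ B → ∀ t : ℝ, 0 ≤ t →
        ‖B * heisenberg (classicalHamiltonian J + perturbation ε V) t A
            - heisenberg (classicalHamiltonian J + perturbation ε V) t A * B‖ ≤
          C * (min (boundary G S₀).card (boundary G S₁).card : ℕ) * ‖A‖ * ‖B‖ *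
            (Real.exp (C' * h * (Real.exp 1 * epsTilde G rs Δ ε) ^ (α * (ζ * r / 8 - k)) * t) - 1) *
            Real.exp (-(α * ζ / 8) * (setDist G S₀ S₁ : ℝ)) := by
  obtain ⟨C, C', hC, hC', H⟩ :=
    exists_norm_lie_heis_perturbation_le d k M ζ α hζ0 hζ1 hα0 hα1
  refine ⟨C, C', hC, hC', ?_⟩
  intro Λ _ _ G hG hdim h Δ ε hh hΔ hε J hJ V hV hHerm S₀ S₁ rs ns r hns hr hkr hP₀ hP₁ hεt A B hA hB
    t ht
  rw [heisenberg_eq_heis, ← Ring.lie_def]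
  -- If `S₁` has the smaller boundary, the paths start there: the commutator is reflected, and `-H`
  -- satisfies the same hypotheses as `H` because gaps and norms do not see the sign.
  rcases Nat.lt_or_ge (boundary G S₁).card (boundary G S₀).card with hlt | hle
  · have hsa : IsSelfAdjoint (classicalHamiltonian J + perturbation ε V) :=
      (isHermitian_classicalHamiltonian J).add hHerm
    rw [min_eq_right hlt.le, norm_lie_heis_neg hsa, neg_add, ← classicalHamiltonian_neg,
      ← perturbation_neg, setDist_comm]
    refine (H Λ G hG hdim h Δ ε hh hΔ hε (-J) (fun I hI => hJ I (by simpa using hI)) (-V) hV.neg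
      (by rw [perturbation_neg]; exact hHerm.neg) S₁ S₀ rs ns r (by rw [setDist_comm]; exact hns)
      (by rw [setDist_comm]; exact hr) hkr (fun y hy => (hP₁ hlt y hy).neg) hεt B A
      (supportedIn_iff.1 hB) (supportedIn_iff.1 hA) t ht).trans (le_of_eq (by ring))
  · rw [min_eq_left hle]
    exact H Λ G hG hdim h Δ ε hh hΔ hε J hJ V hV hHerm S₀ S₁ rs ns r hns hr hkr (hP₀ hle) hεt A B
      (supportedIn_iff.1 hA) (supportedIn_iff.1 hB) t ht
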